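/- **Setting.** Let $k,M_1,M_2,M_3\ge 1$ be integers, $\varepsilon=1/k$, $x_\ell=\varepsilon\ell$ for $\ell\in\mathbb Z^3$, $\Omega=\prod_{i}[-M_i+1,M_i]$ and $\mathfrak L=\mathbb Z^3\cap\frac1\varepsilon\Omega$. The lattice cells in $\Omega$ are all decomposed into six tetrahedra by the *type A* decomposition: for a box with main diagonal from $x_\ell$ to $x_{\ell+\eta}$ its tetrahedra have the vertices $x_\ell,\ x_{\ell+\eta_{\sigma(1)}e_{\sigma(1)}},\ x_{\ell+\eta_{\sigma(1)}e_{\sigma(1)}+\eta_{\sigma(2)}e_{\sigma(2)}},\ x_{\ell+\eta}$, where $\sigma$ runs over the permutations of $\{1,2,3\}$ (for cells $\eta=(1,1,1)$). Let $\mathcal T_T$ be the set of these lattice tetrahedra, split into two disjoint sets, and let $\Omega_a$ and $\Omega_*$ be the interiors of the closures of the unions of the tetrahedra of the first and of the second set. Both are assumed connected (and nonempty), with $\overline\Omega_a\subset\operatorname{int}\Omega$. Put $\Gamma=\overline\Omega_a\cap\overline\Omega_*$. Let $R\subset\mathbb Z^3$ be finite with $\eta_1\eta_2\eta_3\neq0$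 for all $\eta\in R$, and let $\phi_\eta:\mathbb R^3\to\mathbb R$, $\eta\in R$, be continuously differentiable. The bond volume $B_{\ell,\eta}$ is the open box with edges parallel to the axes and main diagonal from $x_\ell$ to $x_{\ell+\eta}$. It is assumed that $\Omega_a$ is so far from $\partial\Omega$ that each $\overline B_{\ell,\eta}$ ($\eta\in R$, $\ell\in\mathbb Z^3$) which meets $\overline\Omega_a$ is contained in $\operatorname{int}\Omega$. Let $B_\Gamma$ be the set of bond volumes with $B_{\ell,\eta}\cap\Gamma\ne\emptyset$, or with $B_{\ell,\eta}\subset\Omega_a$ and $\overline B_{\ell,\eta}\cap\Gamma\neq\emptyset$. **Interface meshes.** For each $B_{\ell,\eta}\in B_\Gamma$, $\eta\in R$, let $\mathcal T(B_{\ell,\eta})$ be a finite set of nondegenerate closed tetrahedra with vertices in $\varepsilon\mathbb Z^3$, with union $\overline B_{\ell,\eta}$ and disjoint interiors, each contained in $\overline\Omega_a$ or in $\overline\Omega_*$, those in $\overline\Omega_*$ being elements of $\mathcal T_T$. Away from $\Gamma$ the meshes are conforming: for $T,T'\in\mathcal T(B_{\ell,\eta})$ the set $(T\cap T')\setminus\Gamma$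 is contained in the convex hull of the common vertices of $T$ and $T'$; and the same holds for $T\in\mathcal T(B_{\ell,\eta})$, $T'\in\mathcal T(B_{\ell',\eta})$ if $\ell'=\ell\pm\eta_ie_i$ for some $i$ (bond volumes sharing a face), where $\mathcal T(B)$ is the type A decomposition of $B$ if $\overline B\subset\Omega_a$. No matching across $\Gamma$ is required, so hanging nodes on $\Gamma$ are allowed. **Energy.** For $y:\mathbb Z^3\to\mathbb R^3$ let $\overline D_\eta y_\ell=(y_{\ell+\eta}-y_\ell)/\varepsilon$, let $\bar y$ be the piecewise affine interpolant of $y$ on the lattice tetrahedra in $\overline\Omega_*$, and let $y^{\ell,\eta}$ be affine on each $T\in\mathcal T(B_{\ell,\eta})$, interpolating $y$ at the vertices of $T$; it may be discontinuous across $\Gamma$, and it equals $\bar y$ on $B_{\ell,\eta}\cap\Omega_*$. Let $$\mathcal E^D_{bv}\{y\}=\sum_{\eta\in R}\Big(\varepsilon^3\!\!\sum_{\ell\in\mathfrak L,\ \overline B_{\ell,\eta}\subset\Omega_a}\!\!\phi_\eta(\overline D_\eta y_\ell)+\int_{\Omega_*}\phi_\eta(\nabla\bar y\,\eta)\,dx+E^D_{\Gamma,\eta}\{y\}\Big),$$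 $$E^D_{\Gamma,\eta}\{y\}=\sum_{\ell\in\mathfrak L,\ B_{\ell,\eta}\in B_\Gamma}\frac1{|\eta_1\eta_2\eta_3|}\Big[\int_{B_{\ell,\eta}\cap\Omega_a}\phi_\eta(\nabla y^{\ell,\eta}\eta)\,dx-\int_{\Gamma_{\ell,\eta}}\phi_\eta'\big(\{\nabla y^{\ell,\eta}\eta\}\big)\cdot[\![y^{\ell,\eta}\eta]\!]\,dS\Big].$$ Here $\Gamma_{\ell,\eta}=\Gamma\cap\overline{B_{\ell,\eta}\cap\Omega_a}$, that is, $B_{\ell,\eta}\cap\Gamma$ together with the parts of $\Gamma$ on $\partial B_{\ell,\eta}$ that bound $B_{\ell,\eta}\cap\Omega_a$ (up to a set of zero area); $\{w\}=\frac12(w^-+w^+)$ and $[\![w\eta]\!]=(\nu_{\Omega_a}\cdot\eta)w^-+(\nu_{\Omega_*}\cdot\eta)w^+$, where $\nu_{\Omega_a}=-\nu_{\Omega_*}$ is the unit normal exterior to $\Omega_a$, $w^-$ is the limit of $y^{\ell,\eta}$ (or $\nabla y^{\ell,\eta}\eta$) from $B_{\ell,\eta}\cap\Omega_a$, and $w^+$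 is the limit of $\bar y$ (or $\nabla\bar y\,\eta$) from $\Omega_*$. **Proposition 5.1.** The energy $\mathcal E^D_{bv}$ is free of ghost forces: for every $\mathsf F\in\mathbb R^{3\times3}$ with $\det\mathsf F>0$ and $y_F(x)=\mathsf Fx$, $$\langle D\mathcal E^D_{bv}(y_F),v\rangle=\frac{d}{dt}\Big|_{t=0}\mathcal E^D_{bv}\{y_F+tv\}=0$$ (the derivative exists) for all $v:\mathbb Z^3\to\mathbb R^3$ which are periodic with period $(2M_i-1)k$ in the $i$-th coordinate, $i=1,2,3$, and have zero average over a period. -/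

import Mathlib

/-! Bond volume based atomistic / continuum coupling on the lattice `ε ℤ³`, `ε = 1 / k`,
with an interface energy that allows discontinuities across the interface. -/

namespace BondVolume

/-- Three dimensional Euclidean space. -/
abbrev Space := EuclideanSpace ℝ (Fin 3)

/-- The unscaled lattice `ℤ³`. -/
abbrev Site := Fin 3 → ℤ

/-- The four vertices, as points of the unscaled lattice, of a tetrahedron. -/
abbrev Tet := Fin 4 → Site

/-- The lattice point `x_ℓ = ε ℓ`. -/
noncomputable def pos (ε : ℝ) (l : Site) : Space := WithLp.toLp 2 (fun i => ε * (l i : ℝ))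

/-- The (closed) tetrahedron with the given lattice vertices. -/
noncomputable def hull (ε : ℝ) (T : Tet) : Set Space :=
  convexHull ℝ (Set.range (fun j => pos ε (T j)))

/-- The tetrahedra of the type A decomposition of the box with main diagonal from `x_l` to
`x_{l+η}`. There is one for each order `σ` in which the three coordinates can be increased on
the way from `x_l` to `x_{l+η}`: its vertices are `l`, `l + η_{σ 0} e_{σ 0}`,
`l + η_{σ 0} e_{σ 0} + η_{σ 1} e_{σ 1}` and `l + η`. Hence their edges are the edges of the box,
the main diagonal, and the face diagonals that start at `x_l` or end at `x_{l+η}`. -/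
def typeATet (η l : Site) (σ : Equiv.Perm (Fin 3)) : Tet :=
  fun j c => l c + if (σ.symm c).val < j.val then η c else 0

/-- The type A decomposition of a box into six tetrahedra. -/
def typeA (η l : Site) : Finset Tet := Finset.univ.image (typeATet η l)

/-- The affine function on the tetrahedron `T` that takes the values of the lattice function `y`
at the four vertices (it exists and is unique if the vertices are affinely independent). Its
linear part, applied to `η`, is `∇y η` on `T`. -/
noncomputable def interp (ε : ℝ) (T : Tet) (y : Site → Space) : Space →ᵃ[ℝ] Space :=
  open Classical in
  if h : ∃ A : Space →ᵃ[ℝ] Space, ∀ j, A (pos ε (T j)) = y (T j) then h.choose else 0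

/-- The difference quotient of `y` at `l` in direction `η`. -/
noncomputable def diffQuot (ε : ℝ) (η : Site) (y : Site → Space) (l : Site) : Space :=
  ε⁻¹ • (y (l + η) - y l)

/-- The bond volume of `l` and `η`: the open box with edges parallel to the axes and main
diagonal from `x_l` to `x_{l+η}`. -/
def bondVolume (ε : ℝ) (η l : Site) : Set Space :=
  {x | ∀ i, x i ∈ Set.Ioo (min (ε * (l i : ℝ)) (ε * ((l i + η i : ℤ) : ℝ)))
    (max (ε * (l i : ℝ)) (ε * ((l i + η i : ℤ) : ℝ)))}

/-! ### Integration over triangles -/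

/-- The cross product of `b - a` and `c - a`; its length is twice the area of the triangle. -/
noncomputable def areaVector (a b c : Space) : Space :=
  WithLp.toLp 2 (crossProduct (WithLp.ofLp (b - a)) (WithLp.ofLp (c - a)))

/-- The surface integral of `f` over the triangle with vertices `a`, `b`, `c`. -/
noncomputable def surfaceIntegral (a b c : Space) (f : Space → ℝ) : ℝ :=
  ‖areaVector a b c‖ *
    ∫ q in {q : ℝ × ℝ | 0 ≤ q.1 ∧ 0 ≤ q.2 ∧ q.1 + q.2 ≤ 1},
      f (a + q.1 • (b - a) + q.2 • (c - a))

/-- The unit normal of the triangle with vertices `a`, `b`, `c` that is exterior to the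
tetrahedron with fourth vertex `d`. -/
noncomputable def exteriorNormal (a b c d : Space) : Space :=
  (-(SignType.sign (inner ℝ (areaVector a b c) (d - a)) : ℝ)) •
    (‖areaVector a b c‖⁻¹ • areaVector a b c)

/-! ### The domain, the two regions and the interface -/

/-- The data of the geometry: `ε = 1 / k`, the numbers `M i` that fix the size of the domain,
and the set of lattice tetrahedra which make up the atomistic region. -/
structure Geometry where
  k : ℕ
  M : Fin 3 → ℕ
  atomistic : Finset Tet

namespace Geometry

variable (G : Geometry)

/-- The lattice distance. -/
noncomputable def ε : ℝ := 1 / (G.k : ℝ)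

/-- The domain `Ω`, the product of the intervals `[-M i + 1, M i]`. -/
def domain : Set Space := {x | ∀ i, x i ∈ Set.Icc (-(G.M i : ℝ) + 1) (G.M i : ℝ)}

/-- All `ℓ` for which `ε ℓ` lies in the closed domain. -/
noncomputable def sites : Finset Site :=
  Fintype.piFinset fun i => Finset.Icc ((-(G.M i : ℤ) + 1) * (G.k : ℤ)) ((G.M i : ℤ) * (G.k : ℤ))

/-- One representative of each class of sites modulo the period of the domain (opposite faces of
the domain are identified). These are also the lower corners of the lattice cells in `Ω`. -/
noncomputable def periodSites : Finset Site :=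
  Fintype.piFinset fun i => Finset.Ico ((-(G.M i : ℤ) + 1) * (G.k : ℤ)) ((G.M i : ℤ) * (G.k : ℤ))

/-- The lattice tetrahedra: all cells of the lattice in `Ω` are decomposed by type A. -/
noncomputable def latticeTets : Finset Tet := G.periodSites.biUnion (typeA (fun _ => 1))

/-- The lattice tetrahedra of the atomistic Cauchy--Born region: those which are not in the
atomistic region. -/
noncomputable def continuum : Finset Tet := G.latticeTets \ G.atomistic

/-- The interior of the closure of a union of tetrahedra. -/
noncomputable def region (S : Finset Tet) : Set Space :=
  interior (closure (⋃ T ∈ S, hull G.ε T))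

/-- The atomistic region `Ω_a`. -/
noncomputable def Ωa : Set Space := G.region G.atomistic

/-- The atomistic Cauchy--Born region `Ω_*`. -/
noncomputable def Ωstar : Set Space := G.region G.continuum

/-- The interface `Γ`. -/
noncomputable def Γ : Set Space := closure G.Ωa ∩ closure G.Ωstar

/-- The bond volume of `l` and `η` on the scaled lattice. -/
noncomputable def B (η l : Site) : Set Space := bondVolume G.ε η l

/-- The bond volume is of atomistic type: its closure is contained in `Ω_a`. -/
def IsAtomistic (η l : Site) : Prop := closure (G.B η l) ⊆ G.Ωa

/-- The bond volume belongs to `B_Γ`: it intersects the interface, or it is contained in `Ω_a`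
and its closure intersects the interface. -/
def IsInterfacial (η l : Site) : Prop :=
  (G.B η l ∩ G.Γ).Nonempty ∨ (G.B η l ⊆ G.Ωa ∧ (closure (G.B η l) ∩ G.Γ).Nonempty)

/-- Standing assumptions on the geometry, for the finite set `R` of interaction vectors. -/
structure IsAdmissible (R : Finset Site) : Prop where
  k_pos : 0 < G.k
  M_pos : ∀ i, 0 < G.M i
  atomistic_subset : G.atomistic ⊆ G.latticeTets
  connected_a : IsConnected G.Ωa
  connected_star : IsConnected G.Ωstar
  closure_subset : closure G.Ωa ⊆ interior G.domain
  /-- `Ω_a` has sufficient distance from the boundary of `Ω`: no bond volume reaches from one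
  to the other. -/
  distance : ∀ η ∈ R, ∀ l : Site,
    (closure (G.B η l) ∩ closure G.Ωa).Nonempty → closure (G.B η l) ⊆ interior G.domain

/-- Two tetrahedra fit together away from the interface: outside `Γ` they meet only in the common
face which is spanned by their common vertices. -/
def Conforming (T T' : Tet) : Prop :=
  (hull G.ε T ∩ hull G.ε T') \ G.Γ ⊆
    convexHull ℝ (pos G.ε '' (Set.range T ∩ Set.range T'))

open Classical in
/-- The decomposition which is used for the bond volume of `l` and `η`: type A in the atomistic
case, and the given decomposition `𝒯 l` otherwise. -/
noncomputable def bondMesh (η : Site) (𝒯 : Site → Finset Tet) (l : Site) : Finset Tet :=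
  if G.IsAtomistic η l then typeA η l else 𝒯 l

/-- Admissible decompositions `𝒯 l` of the bond volumes of `B_Γ`, for a fixed `η`. -/
structure IsInterfaceMesh (η : Site) (𝒯 : Site → Finset Tet) : Prop where
  /-- The elements are nondegenerate tetrahedra (with vertices in the lattice). -/
  nondegenerate : ∀ l, G.IsInterfacial η l → ∀ T ∈ 𝒯 l,
    AffineIndependent ℝ (fun j => pos G.ε (T j))
  /-- The elements decompose the bond volume. -/
  cover : ∀ l, G.IsInterfacial η l → ⋃ T ∈ 𝒯 l, hull G.ε T = closure (G.B η l)
  disjoint : ∀ l, G.IsInterfacial η l → ∀ T ∈ 𝒯 l, ∀ T' ∈ 𝒯 l, T ≠ T' →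
    Disjoint (interior (hull G.ε T)) (interior (hull G.ε T'))
  /-- Each element lies on one side of the interface. -/
  one_side : ∀ l, G.IsInterfacial η l → ∀ T ∈ 𝒯 l,
    hull G.ε T ⊆ closure G.Ωa ∨ hull G.ε T ⊆ closure G.Ωstar
  /-- Elements in `Ω_*` are tetrahedra of the type A decomposition of a lattice cell. -/
  star : ∀ l, G.IsInterfacial η l → ∀ T ∈ 𝒯 l, hull G.ε T ⊆ closure G.Ωstar →
    ∃ T' ∈ G.latticeTets, Set.range T = Set.range T'
  /-- The piecewise affine interpolants are continuous on the closed bond volume without `Γ`. -/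
  conforming : ∀ l, G.IsInterfacial η l → ∀ T ∈ 𝒯 l, ∀ T' ∈ 𝒯 l, G.Conforming T T'
  /-- Away from `Γ`, the decompositions of bond volumes that share a face are compatible; those
  of atomistic type carry the type A decomposition. -/
  compatible : ∀ (l : Site) (i : Fin 3),
    (G.IsAtomistic η l ∨ G.IsInterfacial η l) →
    (G.IsAtomistic η (l + Pi.single i (η i)) ∨ G.IsInterfacial η (l + Pi.single i (η i))) →
    ∀ T ∈ G.bondMesh η 𝒯 l, ∀ T' ∈ G.bondMesh η 𝒯 (l + Pi.single i (η i)), G.Conforming T T'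

/-! ### The energy -/

open Classical in
/-- The energy of the atomistic region. -/
noncomputable def energyAtomistic (φ : Site → Space → ℝ) (η : Site) (y : Site → Space) : ℝ :=
  G.ε ^ 3 * ∑ l ∈ G.sites with G.IsAtomistic η l, φ η (diffQuot G.ε η y l)

/-- The energy of the atomistic Cauchy--Born region. Each lattice tetrahedron has volume
`ε ^ 3 / 6`, so this is the integral of `φ_η (∇ȳ η)` over `Ω_*`, for the piecewise affine
interpolant `ȳ` on the lattice tetrahedra. -/
noncomputable def energyContinuum (φ : Site → Space → ℝ) (η : Site) (y : Site → Space) : ℝ :=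
  G.ε ^ 3 / 6 * ∑ T ∈ G.continuum, φ η ((interp G.ε T y).linear (pos 1 η))

open Classical in
/-- The faces of the interface which bound the part of the bond volume in `Ω_a`. An entry
`(T, T', i)` stands for the face of `T` opposite to its vertex `i`, where `T` is a lattice
tetrahedron of `Ω_a` inside the closed bond volume, and the face is shared with the lattice
tetrahedron `T'` of `Ω_*`. Together these faces are, up to a set of zero area, the intersection of
`Γ` with the closure of the part of the bond volume in `Ω_a`. -/
noncomputable def interfaceFaces (η l : Site) : Finset (Tet × Tet × Fin 4) :=
  (G.atomistic ×ˢ G.continuum ×ˢ Finset.univ).filter fun f =>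
    hull G.ε f.1 ⊆ closure (G.B η l) ∧ ∀ j, j ≠ f.2.2 → f.1 j ∈ Set.range f.2.1

open Classical in
/-- The elements in `Ω_a` of a decomposition. -/
noncomputable def atomisticElements (𝒯 : Finset Tet) : Finset Tet :=
  𝒯.filter fun S => hull G.ε S ⊆ closure G.Ωa

/-- `φ_η' ({∇y η}) · ⟦y η⟧` at a point `x` of an interface face with unit normal `ν` exterior to
`Ω_a`. The limits from `Ω_a` are those of the element `S` of the bond volume, and the limits from
`Ω_*` are those of the lattice tetrahedron `T'`. -/
noncomputable def jumpDensity (φ : Site → Space → ℝ) (η : Site) (y : Site → Space)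
    (S T' : Tet) (ν x : Space) : ℝ :=
  fderiv ℝ (φ η)
    ((1 / 2 : ℝ) • ((interp G.ε S y).linear (pos 1 η) + (interp G.ε T' y).linear (pos 1 η)))
    (inner ℝ ν (pos 1 η) • interp G.ε S y x + inner ℝ (-ν) (pos 1 η) • interp G.ε T' y x)

/-- The correction term on the interface: the surface integral of `φ_η' ({∇y η}) · ⟦y η⟧` over the
interface faces of the bond volume. The part of a face which lies in an element `S` of `Ω_a`
contributes with the trace from `S`; almost every point of the face lies in exactly one `S`. -/
noncomputable def jumpTerm (φ : Site → Space → ℝ) (η : Site) (𝒯 : Site → Finset Tet)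
    (y : Site → Space) (l : Site) : ℝ :=
  ∑ f ∈ G.interfaceFaces η l, ∑ S ∈ G.atomisticElements (𝒯 l),
    surfaceIntegral (pos G.ε (f.1 (f.2.2.succAbove 0))) (pos G.ε (f.1 (f.2.2.succAbove 1)))
      (pos G.ε (f.1 (f.2.2.succAbove 2)))
      ((hull G.ε S).indicator
        (G.jumpDensity φ η y S f.2.1
          (exteriorNormal (pos G.ε (f.1 (f.2.2.succAbove 0))) (pos G.ε (f.1 (f.2.2.succAbove 1)))
            (pos G.ε (f.1 (f.2.2.succAbove 2))) (pos G.ε (f.1 f.2.2)))))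

/-- The integral of `φ_η (∇y η)` over the part of the bond volume in `Ω_a`, where `y` stands for
the piecewise affine interpolant on the elements. -/
noncomputable def bulkTerm (φ : Site → Space → ℝ) (η : Site) (𝒯 : Site → Finset Tet)
    (y : Site → Space) (l : Site) : ℝ :=
  ∑ S ∈ G.atomisticElements (𝒯 l), ∫ _x in hull G.ε S, φ η ((interp G.ε S y).linear (pos 1 η))

open Classical in
/-- The energy of the bond volumes of `B_Γ`. -/
noncomputable def energyInterface (φ : Site → Space → ℝ) (η : Site) (𝒯 : Site → Finset Tet)
    (y : Site → Space) : ℝ :=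
  ∑ l ∈ G.sites with G.IsInterfacial η l,
    1 / |(η 0 * η 1 * η 2 : ℝ)| * (G.bulkTerm φ η 𝒯 y l - G.jumpTerm φ η 𝒯 y l)

/-- The total energy. The decompositions may depend on the interaction vector. -/
noncomputable def energy (R : Finset Site) (φ : Site → Space → ℝ) (𝒯 : Site → Site → Finset Tet)
    (y : Site → Space) : ℝ :=
  ∑ η ∈ R, (G.energyAtomistic φ η y + G.energyContinuum φ η y + G.energyInterface φ η (𝒯 η) y)

/-- Periodic lattice functions (given on all of `ℤ³`) with zero average over the period. -/
structure IsPeriodicZeroMean (v : Site → Space) : Prop where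
  periodic : ∀ (i : Fin 3) (l : Site),
    v (l + Pi.single i ((2 * (G.M i : ℤ) - 1) * (G.k : ℤ))) = v l
  zero_mean : ∑ l ∈ G.periodSites, v l = 0

/-- The homogeneous deformation `y_F (x) = F x` on the lattice. -/
noncomputable def homogeneous (F : Matrix (Fin 3) (Fin 3) ℝ) (l : Site) : Space :=
  Matrix.toEuclideanLin F (pos G.ε l)

end Geometry

end BondVolume

/-! Fix `η` and put `g = φ_η'(Fη)`. At `y_F` every argument of `φ_η` equals `Fη` and all jumps
vanish. Hence the derivative in direction `v` replaces each energy density by `g` applied to the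
corresponding difference quotient or gradient of `v`, and in the interface term only the jump is
differentiated. What remains is a linear identity for the scalar interpolants of `g ∘ v`, stated in
`sum_derivatives_eq_zero`.

Consider one bond volume that reaches into `Ω_a`. The divergence theorem turns the bulk integral
over each lattice tetrahedron of `Ω_a` in it into fluxes of the interpolant through the four faces.
On faces in `Γ` the jump term subtracts the flux of the interpolant of the bond volume and adds that
of the lattice interpolant `v̄` from `Ω_*` (`bulkSum_sub_jumpSum`). If the bond volume is atomistic,
the main diagonal is an edge of every type A tetrahedron, so the bulk integral is a multiple of the
difference quotient (`bulkSum_of_isAtomistic`).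

The bond volumes fall into `|η₁η₂η₃|` classes, each of which tiles the space. Within a class, two
adjacent lattice tetrahedra lie in the same bond volume or in two that share a face. The meshes
conform there away from `Γ`, so the fluxes through faces inside `Ω_a` cancel (`trace_neighbor`,
`sum_flux_eq`). Only the flux of `v̄` through `Γ` is left. It does not depend on the class, and by
the divergence theorem it is the integral over `Ω_a` of the derivative of the lattice interpolant
(`sum_interface_flux`). After division by `|η₁η₂η₃|`, the atomistic and the interface energies
therefore contribute what a Cauchy-Born energy on `Ω_a` would. Adding `Ω_*` gives a sum over all
lattice tetrahedra, in which each vertex value runs over a full period, so that it vanishes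
(`sum_latticeTets`).

The interface meshes need not be aligned with the lattice tetrahedra and may have hanging nodes on
`Γ`. The fluxes are therefore formed with traces: on the open lattice tetrahedron, which avoids `Γ`,
the interpolant is single valued and Lipschitz, and it is extended from there (`exists_isTrace`). On
an interface face the trace agrees with the interpolant of every element that touches the face, and
almost every point of the face lies in exactly one element (`IsTrace.eq_of_mem`,
`ae_existsUnique_element`). -/

namespace BondVolume
open MeasureTheory Set Filter Topology

/-! ### The divergence theorem on a tetrahedron -/

/-- The standard triangle. -/
def triangle : Set (ℝ × ℝ) := {q | 0 ≤ q.1 ∧ 0 ≤ q.2 ∧ q.1 + q.2 ≤ 1}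

/-- The integral over a triangle with respect to the affine parametrization. -/
noncomputable def triangleIntegral (a b c : Space) (f : Space → ℝ) : ℝ :=
  ∫ q in triangle, f (a + q.1 • (b - a) + q.2 • (c - a))

theorem surfaceIntegral_eq (a b c : Space) (f : Space → ℝ) :
    surfaceIntegral a b c f = ‖areaVector a b c‖ * triangleIntegral a b c f := rfl

theorem measurableSet_triangle : MeasurableSet triangle := by
  have : IsClosed triangle := by
    refine (isClosed_le continuous_const continuous_fst).inter
      ((isClosed_le continuous_const continuous_snd).inter
        (isClosed_le (continuous_fst.add continuous_snd) continuous_const))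
  exact this.measurableSet

theorem isCompact_triangle : IsCompact triangle := by
  have : IsClosed triangle := by
    refine (isClosed_le continuous_const continuous_fst).inter
      ((isClosed_le continuous_const continuous_snd).inter
        (isClosed_le (continuous_fst.add continuous_snd) continuous_const))
  refine (isCompact_Icc (a := ((0 : ℝ), (0 : ℝ))) (b := (1, 1))).of_isClosed_subset this ?_
  rintro ⟨x, y⟩ ⟨h1, h2, h3⟩
  simp only at h1 h2 h3
  exact ⟨⟨h1, h2⟩, ⟨by simp only; linarith, by simp only; linarith⟩⟩

/-- Reflections of the plane about a line preserve the area. -/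
theorem measurePreserving_reflect_fst :
    MeasurePreserving (fun q : ℝ × ℝ => (1 - q.1 - q.2, q.2)) volume volume := by
  -- For fixed second coordinate the map is a reflection of the line. Conjugation by the swap puts
  -- the fixed coordinate first, as a skew product requires.
  have h := (MeasurePreserving.skew_product (μa := (volume : Measure ℝ)) (μb := volume)
    (μc := (volume : Measure ℝ)) (μd := volume) (MeasurePreserving.id volume)
    (g := fun a b => (1 - a) - b) (by fun_prop)
    (ae_of_all _ fun a => (Measure.measurePreserving_sub_left volume (1 - a)).map_eq))
  have s := Measure.measurePreserving_swap (μ := (volume : Measure ℝ)) (ν := (volume : Measure ℝ))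
  have := s.comp (h.comp s)
  have he : (fun q : ℝ × ℝ => (1 - q.1 - q.2, q.2)) =
      Prod.swap ∘ (fun p : ℝ × ℝ => (id p.1, 1 - p.1 - p.2)) ∘ Prod.swap := by
    funext q
    simp [sub_right_comm]
  rw [he]
  exact this

theorem triangleIntegral_swap (a b c : Space) (f : Space → ℝ) :
    triangleIntegral a c b f = triangleIntegral a b c f := by
  have s := Measure.measurePreserving_swap (μ := (volume : Measure ℝ)) (ν := (volume : Measure ℝ))
  have := s.setIntegral_preimage_emb MeasurableEquiv.prodComm.measurableEmbedding
    (fun q : ℝ × ℝ => f (a + q.1 • (b - a) + q.2 • (c - a))) triangle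
  rw [triangleIntegral, triangleIntegral, Measure.volume_eq_prod, ← this]
  have hs : Prod.swap ⁻¹' triangle = triangle := by
    ext ⟨x, y⟩; simp [triangle, add_comm]; tauto
  rw [hs]
  refine setIntegral_congr_fun measurableSet_triangle fun q _ => ?_
  simp only [Prod.fst_swap, Prod.snd_swap]
  congr 1; abel

/-- Together with `triangleIntegral_swap` this covers generators of all permutations of the
vertices, so the integral depends on the triangle only. -/
theorem triangleIntegral_swap_left (a b c : Space) (f : Space → ℝ) :
    triangleIntegral b a c f = triangleIntegral a b c f := by
  have s := measurePreserving_reflect_fst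
  have hemb : MeasurableEmbedding (fun q : ℝ × ℝ => (1 - q.1 - q.2, q.2)) := by
    let e : (ℝ × ℝ) ≃ᵐ (ℝ × ℝ) :=
      { toFun := fun q : ℝ × ℝ => (1 - q.1 - q.2, q.2)
        invFun := fun q : ℝ × ℝ => (1 - q.1 - q.2, q.2)
        left_inv := by rintro ⟨x, y⟩; simp; ring
        right_inv := by rintro ⟨x, y⟩; simp; ring
        measurable_toFun := by simp only [Equiv.coe_fn_mk]; fun_prop
        measurable_invFun := by simp only [Equiv.coe_fn_symm_mk]; fun_prop }
    exact e.measurableEmbedding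
  have := s.setIntegral_preimage_emb hemb
    (fun q : ℝ × ℝ => f (a + q.1 • (b - a) + q.2 • (c - a))) triangle
  rw [triangleIntegral, triangleIntegral, ← this]
  have hs : (fun q : ℝ × ℝ => (1 - q.1 - q.2, q.2)) ⁻¹' triangle = triangle := by
    ext ⟨x, y⟩; simp only [triangle, mem_preimage, mem_ofPred_eq]
    constructor <;> rintro ⟨h1, h2, h3⟩ <;> refine ⟨?_, ?_, ?_⟩ <;> linarith
  rw [hs]
  refine setIntegral_congr_fun measurableSet_triangle fun q _ => ?_
  simp only
  congr 1; module

/-- Six times the signed volume of a tetrahedron. -/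
noncomputable def tripleProduct (p₀ p₁ p₂ p₃ : Space) : ℝ :=
  inner ℝ (areaVector p₀ p₁ p₂) (p₃ - p₀)

theorem tripleProduct_eq (p₀ p₁ p₂ p₃ : Space) : tripleProduct p₀ p₁ p₂ p₃ =
    ((p₁ 1 - p₀ 1) * (p₂ 2 - p₀ 2) - (p₁ 2 - p₀ 2) * (p₂ 1 - p₀ 1)) * (p₃ 0 - p₀ 0) +
    ((p₁ 2 - p₀ 2) * (p₂ 0 - p₀ 0) - (p₁ 0 - p₀ 0) * (p₂ 2 - p₀ 2)) * (p₃ 1 - p₀ 1) +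
    ((p₁ 0 - p₀ 0) * (p₂ 1 - p₀ 1) - (p₁ 1 - p₀ 1) * (p₂ 0 - p₀ 0)) * (p₃ 2 - p₀ 2) := by
  simp [tripleProduct, areaVector, PiLp.inner_apply, Fin.sum_univ_three, cross_apply]
  ring

/-- The standard tetrahedron. -/
def simplex : Set Space := {q | 0 ≤ q 0 ∧ 0 ≤ q 1 ∧ 0 ≤ q 2 ∧ q 0 + q 1 + q 2 ≤ 1}

/-- The linear part of the parametrization of a tetrahedron by the standard one. -/
noncomputable def edgeMap (p₀ p₁ p₂ p₃ : Space) : Space →L[ℝ] Space :=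
  (EuclideanSpace.proj (0 : Fin 3) : Space →L[ℝ] ℝ).smulRight (p₁ - p₀) +
  (EuclideanSpace.proj (1 : Fin 3) : Space →L[ℝ] ℝ).smulRight (p₂ - p₀) +
  (EuclideanSpace.proj (2 : Fin 3) : Space →L[ℝ] ℝ).smulRight (p₃ - p₀)

theorem edgeMap_apply (p₀ p₁ p₂ p₃ q : Space) : edgeMap p₀ p₁ p₂ p₃ q =
    q 0 • (p₁ - p₀) + q 1 • (p₂ - p₀) + q 2 • (p₃ - p₀) := by
  simp [edgeMap]

theorem det_edgeMap (p₀ p₁ p₂ p₃ : Space) :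
    (edgeMap p₀ p₁ p₂ p₃).det = tripleProduct p₀ p₁ p₂ p₃ := by
  rw [ContinuousLinearMap.det, ← LinearMap.det_toMatrix (EuclideanSpace.basisFun (Fin 3) ℝ).toBasis,
    Matrix.det_fin_three, tripleProduct_eq]
  simp [LinearMap.toMatrix_apply, edgeMap_apply]
  ring

theorem convex_simplex : Convex ℝ simplex := by
  rintro x ⟨h1, h2, h3, h4⟩ y ⟨g1, g2, g3, g4⟩ a b ha hb hab
  simp only [simplex, mem_ofPred_eq, PiLp.add_apply, PiLp.smul_apply, smul_eq_mul]
  refine ⟨by positivity, by positivity, by positivity, ?_⟩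
  have := mul_le_mul_of_nonneg_left h4 ha
  have := mul_le_mul_of_nonneg_left g4 hb
  nlinarith

theorem isClosed_simplex : IsClosed simplex := by
  have h (i : Fin 3) : IsClosed {q : Space | 0 ≤ q i} := isClosed_le (by fun_prop) (by fun_prop)
  have h' : IsClosed {q : Space | q 0 + q 1 + q 2 ≤ 1} := isClosed_le (by fun_prop) (by fun_prop)
  exact (h 0).inter ((h 1).inter ((h 2).inter h'))

theorem convexHull_eq_image_simplex (p₀ p₁ p₂ p₃ : Space) :
    convexHull ℝ {p₀, p₁, p₂, p₃} = (fun q => p₀ + edgeMap p₀ p₁ p₂ p₃ q) '' simplex := by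
  apply Subset.antisymm
  · refine convexHull_min ?_ ?_
    · intro x hx
      simp only [mem_insert_iff, mem_singleton_iff] at hx
      rcases hx with rfl | rfl | rfl | rfl
      · exact ⟨0, by simp [simplex], by simp⟩
      · exact ⟨EuclideanSpace.single 0 1, by simp [simplex], by simp [edgeMap_apply]⟩
      · exact ⟨EuclideanSpace.single 1 1, by simp [simplex], by simp [edgeMap_apply]⟩
      · exact ⟨EuclideanSpace.single 2 1, by simp [simplex], by simp [edgeMap_apply]⟩
    · have := (convex_simplex.is_linear_image (f := edgeMap p₀ p₁ p₂ p₃)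
        (edgeMap p₀ p₁ p₂ p₃).toLinearMap.isLinear).translate p₀
      rwa [image_image] at this
  · rintro _ ⟨q, ⟨h1, h2, h3, h4⟩, rfl⟩
    have hc := convex_convexHull ℝ ({p₀, p₁, p₂, p₃} : Set Space)
    have h := hc.sum_mem (t := Finset.univ) (w := ![1 - q 0 - q 1 - q 2, q 0, q 1, q 2])
      (z := ![p₀, p₁, p₂, p₃]) (by
        intro i _; fin_cases i <;> simp <;> linarith)
        (by simp [Fin.sum_univ_four]; ring) (by
        intro i _; apply subset_convexHull; fin_cases i <;> simp)
    convert h using 1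
    simp [Fin.sum_univ_four, edgeMap_apply]
    module

/-- Change of variables under the affine parametrization, whose Jacobian determinant is the triple
product; nondegeneracy gives injectivity. -/
theorem setIntegral_tetrahedron (p₀ p₁ p₂ p₃ : Space) (hp : tripleProduct p₀ p₁ p₂ p₃ ≠ 0)
    (g : Space → ℝ) : ∫ x in convexHull ℝ {p₀, p₁, p₂, p₃}, g x =
    |tripleProduct p₀ p₁ p₂ p₃| * ∫ q in simplex, g (p₀ + edgeMap p₀ p₁ p₂ p₃ q) := by
  rw [convexHull_eq_image_simplex, integral_image_eq_integral_abs_det_fderiv_smul volume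
    isClosed_simplex.measurableSet (f' := fun _ => edgeMap p₀ p₁ p₂ p₃)]
  · simp only [det_edgeMap, smul_eq_mul]
    rw [integral_const_mul]
  · intro x _
    exact ((edgeMap p₀ p₁ p₂ p₃).hasFDerivAt.const_add p₀).hasFDerivWithinAt
  · intro x _ y _ h
    have h' := add_left_cancel h
    have h0 : LinearMap.det (edgeMap p₀ p₁ p₂ p₃).toLinearMap ≠ 0 := by
      have := det_edgeMap p₀ p₁ p₂ p₃
      rw [ContinuousLinearMap.det] at this
      rwa [this]
    exact (LinearMap.equivOfDetNeZero _ h0).injective h'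

/-- The coordinates of space as a product, the last coordinate first. -/
theorem exists_measurePreserving_coords :
    ∃ e : Space ≃ᵐ ℝ × (ℝ × ℝ), MeasurePreserving e volume volume ∧
      ∀ q, e q = (q 2, (q 0, q 1)) := by
  let e₁ : Space ≃ᵐ (Fin 3 → ℝ) := (MeasurableEquiv.toLp 2 (Fin 3 → ℝ)).symm
  let e₂ := MeasurableEquiv.piFinSuccAbove (fun _ : Fin 3 => ℝ) 2
  let e₃ : (Fin 2 → ℝ) ≃ᵐ ℝ × ℝ := MeasurableEquiv.finTwoArrow
  refine ⟨(e₁.trans e₂).trans (MeasurableEquiv.prodCongr (MeasurableEquiv.refl ℝ) e₃), ?_, ?_⟩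
  · have h1 := PiLp.volume_preserving_ofLp (Fin 3)
    have h2 := volume_preserving_piFinSuccAbove (fun _ : Fin 3 => ℝ) 2
    have h3 := (MeasurePreserving.id (volume : Measure ℝ)).prod (volume_preserving_finTwoArrow ℝ)
    exact h3.comp (h2.comp h1)
  · intro q
    rfl

end BondVolume

namespace BondVolume
open MeasureTheory Set Filter Topology
open scoped NNReal

theorem isBounded_simplex : Bornology.IsBounded simplex := by
  have h := (convexHull_eq_image_simplex 0 (EuclideanSpace.single 0 1) (EuclideanSpace.single 1 1)
    (EuclideanSpace.single 2 1))
  have he : (fun q => (0 : Space) + edgeMap 0 (EuclideanSpace.single 0 1)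
      (EuclideanSpace.single 1 1) (EuclideanSpace.single 2 1) q) = id := by
    funext q
    ext i
    fin_cases i <;> simp [edgeMap_apply]
  rw [he, image_id] at h
  rw [← h]
  exact (isBounded_convexHull).2 (by simp)

/-- Integration over the standard tetrahedron by lines in the direction of the last coordinate. -/
theorem setIntegral_simplex (G : Space → ℝ) (hG : Measurable G) (C : ℝ) (hC : ∀ q, ‖G q‖ ≤ C) :
    ∫ q in simplex, G q =
      ∫ z in triangle, ∫ t in (0 : ℝ)..(1 - z.1 - z.2), G !₂[z.1, z.2, t] := by
  obtain ⟨e, he, hev⟩ := exists_measurePreserving_coords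
  have hsymm : ∀ z : ℝ × (ℝ × ℝ), e.symm z = !₂[z.2.1, z.2.2, z.1] := by
    intro z
    rw [MeasurableEquiv.symm_apply_eq, hev]
    simp
  have hint : Integrable (simplex.indicator G) volume := by
    rw [integrable_indicator_iff isClosed_simplex.measurableSet]
    exact Measure.integrableOn_of_bounded (isBounded_simplex.measure_lt_top).ne
      hG.aestronglyMeasurable (ae_of_all _ hC)
  rw [← integral_indicator isClosed_simplex.measurableSet]
  have he' := he.symm e
  have h1 := he'.integral_comp e.symm.measurableEmbedding (simplex.indicator G)
  have hint' : Integrable (fun z => simplex.indicator G (e.symm z)) volume :=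
    he'.integrable_comp_of_integrable hint
  rw [← h1, Measure.volume_eq_prod, integral_prod_symm _ hint',
    ← integral_indicator measurableSet_triangle]
  congr 1
  funext z
  by_cases hz : z ∈ triangle
  · rw [indicator_of_mem hz]
    obtain ⟨h1, h2, h3⟩ := hz
    rw [intervalIntegral.integral_of_le (by linarith), ← integral_Icc_eq_integral_Ioc,
      ← integral_indicator measurableSet_Icc]
    congr 1
    funext t
    rw [hsymm]
    by_cases ht : t ∈ Icc (0 : ℝ) (1 - z.1 - z.2)
    · rw [indicator_of_mem ht, indicator_of_mem]
      refine ⟨by simpa, by simpa, by simpa using ht.1, ?_⟩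
      have := ht.2
      simp
      linarith
    · rw [indicator_of_notMem ht, indicator_of_notMem]
      rintro ⟨g1, g2, g3, g4⟩
      simp at g1 g2 g3 g4
      exact ht ⟨g3, by linarith⟩
  · rw [indicator_of_notMem hz]
    refine integral_eq_zero_of_ae (ae_of_all _ fun t => ?_)
    simp only [hsymm, Pi.zero_apply]
    apply indicator_of_notMem
    rintro ⟨g1, g2, g3, g4⟩
    simp at g1 g2 g3 g4
    exact hz ⟨g1, g2, by linarith⟩

theorem integrableOn_triangle_comp (a b c : Space) {f : Space → ℝ} (hf : Continuous f) :
    IntegrableOn (fun q : ℝ × ℝ => f (a + q.1 • (b - a) + q.2 • (c - a))) triangle := by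
  apply ContinuousOn.integrableOn_compact isCompact_triangle
  exact (by fun_prop : Continuous _).continuousOn

/-- Fundamental theorem of calculus on the segments parallel to the edge from `p₀` to `p₃`. They
join points of the faces `p₀p₁p₂` and `p₃p₁p₂` with the same parameters. A Lipschitz function is
absolutely continuous on them, which is all that is needed. -/
theorem setIntegral_lineDeriv_edge {p₀ p₁ p₂ p₃ : Space} (hp : tripleProduct p₀ p₁ p₂ p₃ ≠ 0)
    {h : Space → ℝ} {K : ℝ≥0} (hh : LipschitzWith K h) :
    ∫ x in convexHull ℝ {p₀, p₁, p₂, p₃}, lineDeriv ℝ h x (p₃ - p₀) =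
      |tripleProduct p₀ p₁ p₂ p₃| *
        (triangleIntegral p₃ p₁ p₂ h - triangleIntegral p₀ p₁ p₂ h) := by
  rw [setIntegral_tetrahedron _ _ _ _ hp]
  congr 1
  have hm : Measurable fun q => lineDeriv ℝ h (p₀ + edgeMap p₀ p₁ p₂ p₃ q) (p₃ - p₀) :=
    (measurable_lineDeriv hh.continuous).comp (by fun_prop)
  rw [setIntegral_simplex _ hm (K * ‖p₃ - p₀‖) fun q => norm_lineDeriv_le_of_lipschitz ℝ hh,
    triangleIntegral, triangleIntegral, ← integral_sub
      (integrableOn_triangle_comp _ _ _ hh.continuous)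
      (integrableOn_triangle_comp _ _ _ hh.continuous)]
  refine setIntegral_congr_fun measurableSet_triangle fun z _ => ?_
  set f : ℝ → ℝ := fun t => h (p₀ + z.1 • (p₁ - p₀) + z.2 • (p₂ - p₀) + t • (p₃ - p₀)) with hf
  have hlip : ∃ K', LipschitzWith K' f := by
    have : LipschitzWith ‖p₃ - p₀‖₊ fun t : ℝ =>
        p₀ + z.1 • (p₁ - p₀) + z.2 • (p₂ - p₀) + t • (p₃ - p₀) := by
      refine LipschitzWith.of_dist_le_mul fun s t => ?_
      rw [dist_add_left, dist_eq_norm, ← sub_smul, norm_smul, Real.dist_eq, mul_comm]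
      simp
    exact ⟨_, hh.comp this⟩
  obtain ⟨K', hK'⟩ := hlip
  have hd : ∀ t : ℝ, lineDeriv ℝ h (p₀ + edgeMap p₀ p₁ p₂ p₃ !₂[z.1, z.2, t]) (p₃ - p₀) =
      deriv f t := by
    intro t
    have := deriv_comp_const_add f t 0
    rw [add_zero] at this
    rw [← this, lineDeriv]
    congr 1
    funext s
    simp only [edgeMap_apply, hf]
    congr 1
    simp
    module
  simp only [hd]
  rw [((hK'.lipschitzOnWith (s := uIcc 0 (1 - z.1 - z.2))).absolutelyContinuousOnInterval
    ).integral_deriv_eq_sub]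
  simp only [hf]
  congr 2
  · module
  · module

theorem tripleProduct_rotate (p₀ p₁ p₂ p₃ : Space) :
    tripleProduct p₀ p₂ p₃ p₁ = tripleProduct p₀ p₁ p₂ p₃ := by
  simp only [tripleProduct_eq]; ring

/-- The integral of `f` over the face of the tetrahedron `p` opposite to the vertex `i`, with
respect to the affine parametrization. -/
noncomputable def faceIntegral (p : Fin 4 → Space) (i : Fin 4) (f : Space → ℝ) : ℝ :=
  triangleIntegral (p (i.succAbove 0)) (p (i.succAbove 1)) (p (i.succAbove 2)) f

theorem range_fin_four (p : Fin 4 → Space) : range p = {p 0, p 1, p 2, p 3} := by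
  ext x
  simp only [mem_range, mem_insert_iff, mem_singleton_iff]
  constructor
  · rintro ⟨i, rfl⟩; fin_cases i <;> simp
  · rintro (rfl | rfl | rfl | rfl) <;> exact ⟨_, rfl⟩

/-- The vertices are reordered so that `p i` comes last. The volume does not depend on the order,
and neither do the integrals over the faces. -/
theorem setIntegral_lineDeriv_vertex {p : Fin 4 → Space}
    (hp : tripleProduct (p 0) (p 1) (p 2) (p 3) ≠ 0)
    {h : Space → ℝ} {K : ℝ≥0} (hh : LipschitzWith K h) (i : Fin 4) :
    ∫ x in convexHull ℝ (range p), lineDeriv ℝ h x (p i - p 0) =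
      |tripleProduct (p 0) (p 1) (p 2) (p 3)| * (faceIntegral p 0 h - faceIntegral p i h) := by
  rw [range_fin_four]
  have a1 : triangleIntegral (p 2) (p 1) (p 3) h = triangleIntegral (p 1) (p 2) (p 3) h :=
    triangleIntegral_swap_left _ _ _ _
  have a2 : triangleIntegral (p 3) (p 1) (p 2) h = triangleIntegral (p 1) (p 2) (p 3) h := by
    rw [triangleIntegral_swap_left, triangleIntegral_swap]
  fin_cases i
  · simp [lineDeriv_zero]
  · have h1 : ({p 0, p 1, p 2, p 3} : Set Space) = {p 0, p 2, p 3, p 1} := by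
      ext x; simp only [mem_insert_iff, mem_singleton_iff]; tauto
    have := setIntegral_lineDeriv_edge (p₀ := p 0) (p₁ := p 2) (p₂ := p 3) (p₃ := p 1)
      (by rwa [tripleProduct_rotate]) hh
    rw [tripleProduct_rotate, ← h1] at this
    exact this
  · have h1 : ({p 0, p 1, p 2, p 3} : Set Space) = {p 0, p 1, p 3, p 2} := by
      ext x; simp only [mem_insert_iff, mem_singleton_iff]; tauto
    have hs : tripleProduct (p 0) (p 1) (p 3) (p 2) = - tripleProduct (p 0) (p 1) (p 2) (p 3) := by
      simp only [tripleProduct_eq]; ring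
    have := setIntegral_lineDeriv_edge (p₀ := p 0) (p₁ := p 1) (p₂ := p 3) (p₃ := p 2)
      (by rw [hs]; simpa) hh
    rw [hs, abs_neg, ← h1, a1] at this
    exact this
  · have := setIntegral_lineDeriv_edge (p₀ := p 0) (p₁ := p 1) (p₂ := p 2) (p₃ := p 3) hp hh
    rw [a2] at this
    exact this

theorem integrableOn_lineDeriv {h : Space → ℝ} {K : ℝ≥0} (hh : LipschitzWith K h) (w : Space)
    {s : Set Space} (hs : Bornology.IsBounded s) : IntegrableOn (fun x => lineDeriv ℝ h x w) s :=
  Measure.integrableOn_of_bounded hs.measure_lt_top.ne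
    (measurable_lineDeriv hh.continuous).aestronglyMeasurable
    (ae_of_all _ fun _ => norm_lineDeriv_le_of_lipschitz ℝ hh)

/-- The divergence theorem on a tetrahedron, for the derivative of a Lipschitz function in a
direction that is given by the derivatives `c` of the barycentric coordinates. -/
theorem setIntegral_fderiv_tetrahedron {p : Fin 4 → Space}
    (hp : tripleProduct (p 0) (p 1) (p 2) (p 3) ≠ 0)
    {h : Space → ℝ} {K : ℝ≥0} (hh : LipschitzWith K h) (c : Fin 4 → ℝ) (hc : ∑ i, c i = 0) :
    ∫ x in convexHull ℝ (range p), fderiv ℝ h x (∑ i, c i • p i) =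
      -|tripleProduct (p 0) (p 1) (p 2) (p 3)| * ∑ i, c i * faceIntegral p i h := by
  have hb : Bornology.IsBounded (convexHull ℝ (range p)) :=
    isBounded_convexHull.2 (finite_range p).isBounded
  -- As the coefficients have sum zero, the direction is a combination of the edges at `p 0`, for
  -- which the formula is known.
  have hw : ∑ i, c i • p i = ∑ i, c i • (p i - p 0) := by
    simp only [smul_sub, Finset.sum_sub_distrib, ← Finset.sum_smul, hc, zero_smul, sub_zero]
  have hae : ∀ᵐ x ∂(volume.restrict (convexHull ℝ (range p))),
      fderiv ℝ h x (∑ i, c i • p i) = ∑ i, c i * lineDeriv ℝ h x (p i - p 0) := by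
    refine ae_restrict_of_ae ?_
    -- By Rademacher's theorem the line derivative is linear in the direction at almost every point.
    filter_upwards [hh.ae_differentiableAt (μ := volume)] with x hx
    simp only [hw, map_sum, map_smul, smul_eq_mul, hx.lineDeriv_eq_fderiv]
  rw [integral_congr_ae hae, integral_finsetSum _ fun i _ =>
    (integrableOn_lineDeriv hh _ hb).const_mul (c i)]
  simp only [integral_const_mul, setIntegral_lineDeriv_vertex hp hh]
  have : ∑ i, c i * faceIntegral p 0 h = 0 := by rw [← Finset.sum_mul, hc, zero_mul]
  rw [Finset.mul_sum]
  calc _ = ∑ i, (|tripleProduct (p 0) (p 1) (p 2) (p 3)| * (c i * faceIntegral p 0 h) -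
        |tripleProduct (p 0) (p 1) (p 2) (p 3)| * (c i * faceIntegral p i h)) := by
          congr 1; funext i; ring
    _ = _ := by
      rw [Finset.sum_sub_distrib, ← Finset.mul_sum, this, ← Finset.mul_sum]
      simp [Finset.mul_sum]

end BondVolume

/-! ### Normals of faces and barycentric coordinates -/

namespace BondVolume
open MeasureTheory Set Filter Topology
open scoped NNReal

theorem norm_areaVector_mul_inner_exteriorNormal {a b c d : Space} (w : Space) :
    ‖areaVector a b c‖ * inner ℝ (exteriorNormal a b c d) w =
      -(SignType.sign (tripleProduct a b c d) : ℝ) * inner ℝ (areaVector a b c) w := by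
  rw [exteriorNormal, inner_smul_left, inner_smul_left, tripleProduct]
  by_cases h : ‖areaVector a b c‖ = 0
  · have h' : areaVector a b c = 0 := norm_eq_zero.1 h
    simp [h']
  · simp
    field_simp

/-- The area vector is orthogonal to the edges of the face, so once a vertex of the face is
subtracted only the opposite vertex contributes. -/
theorem inner_areaVector_sum (p : Fin 4 → Space) (i : Fin 4) (c : Fin 4 → ℝ) (hc : ∑ j, c j = 0) :
    inner ℝ (areaVector (p (i.succAbove 0)) (p (i.succAbove 1)) (p (i.succAbove 2)))
      (∑ j, c j • p j) = c i *
      tripleProduct (p (i.succAbove 0)) (p (i.succAbove 1)) (p (i.succAbove 2)) (p i) := by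
  have hw : ∑ j, c j • p j = ∑ j, c j • (p j - p (i.succAbove 0)) := by
    simp only [smul_sub, Finset.sum_sub_distrib, ← Finset.sum_smul, hc, zero_smul, sub_zero]
  have key (j : Fin 4) : inner ℝ
      (areaVector (p (i.succAbove 0)) (p (i.succAbove 1)) (p (i.succAbove 2)))
      (p j - p (i.succAbove 0)) =
      tripleProduct (p (i.succAbove 0)) (p (i.succAbove 1)) (p (i.succAbove 2)) (p j) := rfl
  have h0 (a b c : Space) : tripleProduct a b c a = 0 := by simp only [tripleProduct_eq]; ring
  have h1 (a b c : Space) : tripleProduct a b c b = 0 := by simp only [tripleProduct_eq]; ring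
  have h2 (a b c : Space) : tripleProduct a b c c = 0 := by simp only [tripleProduct_eq]; ring
  rw [hw, inner_sum]
  simp only [inner_smul_right, key]
  rw [Fin.sum_univ_succAbove _ i, Fin.sum_univ_three, h0, h1, h2]
  ring

theorem abs_tripleProduct_face (p : Fin 4 → Space) (i : Fin 4) :
    |tripleProduct (p (i.succAbove 0)) (p (i.succAbove 1)) (p (i.succAbove 2)) (p i)| =
      |tripleProduct (p 0) (p 1) (p 2) (p 3)| := by
  fin_cases i
  · rw [← abs_neg]; congr 1
    change -tripleProduct (p 1) (p 2) (p 3) (p 0) = _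
    simp only [tripleProduct_eq]; ring
  · congr 1
    change tripleProduct (p 0) (p 2) (p 3) (p 1) = _
    simp only [tripleProduct_eq]; ring
  · rw [← abs_neg]; congr 1
    change -tripleProduct (p 0) (p 1) (p 3) (p 2) = _
    simp only [tripleProduct_eq]; ring
  · rfl

/-- Translates between two forms of a flux: the unit normal of `surfaceIntegral` on the left, and on
the right the coefficients from the divergence theorem on a tetrahedron. The sign in the exterior
normal turns the triple product into its absolute value. -/
theorem norm_areaVector_mul_inner_face (p : Fin 4 → Space) (i : Fin 4) (c : Fin 4 → ℝ)
    (hc : ∑ j, c j = 0) :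
    ‖areaVector (p (i.succAbove 0)) (p (i.succAbove 1)) (p (i.succAbove 2))‖ *
      inner ℝ (exteriorNormal (p (i.succAbove 0)) (p (i.succAbove 1)) (p (i.succAbove 2)) (p i))
        (∑ j, c j • p j) = -|tripleProduct (p 0) (p 1) (p 2) (p 3)| * c i := by
  rw [norm_areaVector_mul_inner_exteriorNormal, inner_areaVector_sum _ _ _ hc,
    ← abs_tripleProduct_face p i]
  set X := tripleProduct (p (i.succAbove 0)) (p (i.succAbove 1)) (p (i.succAbove 2)) (p i)
  linear_combination (-c i) * (sign_mul_self X)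

/-! ### Nondegenerate tetrahedra and interpolation -/

/-- The vertices of a nondegenerate tetrahedron as an affine basis. -/
noncomputable def tetBasis {p : Fin 4 → Space} (h : AffineIndependent ℝ p) :
    AffineBasis (Fin 4) ℝ Space :=
  ⟨p, h, h.affineSpan_eq_top_iff_card_eq_finrank_add_one.2 (by simp)⟩

theorem coe_tetBasis {p : Fin 4 → Space} (h : AffineIndependent ℝ p) : ⇑(tetBasis h) = p := rfl

theorem coord_tetBasis {p : Fin 4 → Space} (h : AffineIndependent ℝ p) {w : Fin 4 → ℝ}
    (hw : ∑ j, w j = 1) (j : Fin 4) : (tetBasis h).coord j (∑ i, w i • p i) = w j := by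
  have := (tetBasis h).coord_apply_combination_of_mem (Finset.mem_univ j) hw
  rwa [Finset.univ.affineCombination_eq_linear_combination _ _ hw] at this

theorem sum_coord_smul {p : Fin 4 → Space} (h : AffineIndependent ℝ p) (x : Space) :
    ∑ j, (tetBasis h).coord j x • p j = x :=
  (tetBasis h).linear_combination_coord_eq_self x

theorem affineMap_ext_of_tet {V : Type*} [AddCommGroup V] [Module ℝ V]
    {p : Fin 4 → Space} (h : AffineIndependent ℝ p)
    {A A' : Space →ᵃ[ℝ] V} (hA : ∀ j, A (p j) = A' (p j)) : A = A' :=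
  AffineMap.ext_on (tetBasis h).tot (by rintro _ ⟨j, rfl⟩; exact hA j)

variable {ε : ℝ}

theorem interp_apply {T : Tet} (h : AffineIndependent ℝ (fun j => pos ε (T j)))
    (y : Site → Space) (j : Fin 4) : interp ε T y (pos ε (T j)) = y (T j) := by
  have hex : ∃ A : Space →ᵃ[ℝ] Space, ∀ j, A (pos ε (T j)) = y (T j) := by
    let f (i : Fin 4) : Space →ᵃ[ℝ] Space :=
      (LinearMap.toSpanSingleton ℝ Space (y (T i))).toAffineMap.comp ((tetBasis h).coord i)
    refine ⟨f 0 + f 1 + f 2 + f 3, fun k => ?_⟩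
    have hk : pos ε (T k) = tetBasis h k := rfl
    have hc (i : Fin 4) : (tetBasis h).coord i (pos ε (T k)) = if i = k then 1 else 0 := by
      rw [hk, AffineBasis.coord_apply]
    have hs := Fin.sum_univ_four fun i => (if i = k then (1 : ℝ) else 0) • y (T i)
    simp only [ite_smul, one_smul, zero_smul, Finset.sum_ite_eq', Finset.mem_univ, if_true] at hs
    simp [f, hc, hs]
  rw [interp, dif_pos hex]
  exact hex.choose_spec j

theorem interp_eq {T : Tet} (h : AffineIndependent ℝ (fun j => pos ε (T j)))
    {y : Site → Space} {A : Space →ᵃ[ℝ] Space} (hA : ∀ j, A (pos ε (T j)) = y (T j)) :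
    interp ε T y = A :=
  affineMap_ext_of_tet h fun j => by rw [interp_apply h, hA]

theorem eqOn_convexHull_of_affine {V : Type*} [AddCommGroup V] [Module ℝ V]
    {A A' : Space →ᵃ[ℝ] V} {s : Set Space} (h : ∀ x ∈ s, A x = A' x) {x : Space}
    (hx : x ∈ convexHull ℝ s) : A x = A' x := by
  refine convexHull_min (s := s) (t := {x | A x = A' x}) h ?_ hx
  intro x hx y hy a b ha hb hab
  have e (B : Space →ᵃ[ℝ] V) : B (a • x + b • y) = a • B x + b • B y :=
    Convex.combo_affine_apply hab
  simp only [mem_ofPred_eq] at hx hy ⊢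
  rw [e, e, hx, hy]

/-- This is how conformity of meshes yields continuity: two affine functions that agree at the
common vertices agree on their convex hull. -/
theorem interp_eq_of_mem_common {T T' : Tet} (h : AffineIndependent ℝ (fun j => pos ε (T j)))
    (h' : AffineIndependent ℝ (fun j => pos ε (T' j))) (y : Site → Space) {x : Space}
    (hx : x ∈ convexHull ℝ (pos ε '' (range T ∩ range T'))) : interp ε T y x = interp ε T' y x := by
  refine eqOn_convexHull_of_affine ?_ hx
  rintro _ ⟨l, ⟨⟨j, rfl⟩, ⟨k, hk⟩⟩, rfl⟩
  rw [interp_apply h, ← hk, interp_apply h']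

theorem convex_hull (T : Tet) : Convex ℝ (hull ε T) := convex_convexHull ℝ _

theorem isCompact_hull (T : Tet) : IsCompact (hull ε T) :=
  Set.Finite.isCompact_convexHull (𝕜 := ℝ) (finite_range _)

theorem isClosed_hull (T : Tet) : IsClosed (hull ε T) := (isCompact_hull T).isClosed

theorem pos_mem_hull (T : Tet) (j : Fin 4) : pos ε (T j) ∈ hull ε T :=
  subset_convexHull _ _ ⟨j, rfl⟩

theorem interior_hull_nonempty {T : Tet} (h : AffineIndependent ℝ (fun j => pos ε (T j))) :
    (interior (hull ε T)).Nonempty :=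
  interior_convexHull_nonempty_iff_affineSpan_eq_top.2 (tetBasis h).tot

theorem hull_subset_closure_interior {T : Tet} (h : AffineIndependent ℝ (fun j => pos ε (T j))) :
    hull ε T ⊆ closure (interior (hull ε T)) := by
  rw [(convex_hull T : Convex ℝ (hull ε T)).closure_interior_eq_closure_of_nonempty_interior
    (interior_hull_nonempty h)]
  exact subset_closure

theorem mem_hull_iff {T : Tet} (h : AffineIndependent ℝ (fun j => pos ε (T j))) {x : Space} :
    x ∈ hull ε T ↔ ∀ j, 0 ≤ (tetBasis h).coord j x := by
  have := (tetBasis h).convexHull_eq_nonneg_coord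
  rw [coe_tetBasis] at this
  rw [hull, this]; rfl

theorem mem_interior_hull_iff {T : Tet} (h : AffineIndependent ℝ (fun j => pos ε (T j)))
    {x : Space} : x ∈ interior (hull ε T) ↔ ∀ j, 0 < (tetBasis h).coord j x := by
  have := (tetBasis h).interior_convexHull
  rw [coe_tetBasis] at this
  rw [hull, this]; rfl

/-! ### The type A decomposition of a box -/

/-- Coordinates in which the box of `l` and `η` is the unit cube. -/
noncomputable def boxCoord (ε : ℝ) (η l : Site) (x : Space) (i : Fin 3) : ℝ :=
  (x i / ε - l i) / η i

/-- The barycentric coordinates of the tetrahedra of the type A decomposition. -/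
noncomputable def boxBary (ε : ℝ) (η l : Site) (σ : Equiv.Perm (Fin 3)) (x : Space) : Fin 4 → ℝ :=
  ![1 - boxCoord ε η l x (σ 0), boxCoord ε η l x (σ 0) - boxCoord ε η l x (σ 1),
    boxCoord ε η l x (σ 1) - boxCoord ε η l x (σ 2), boxCoord ε η l x (σ 2)]

variable {η l : Site} {σ τ : Equiv.Perm (Fin 3)}

theorem typeATet_apply (j : Fin 4) (k : Fin 3) :
    typeATet η l σ j (σ k) = l (σ k) + if k.val < j.val then η (σ k) else 0 := by
  simp [typeATet]

theorem sum_boxBary (x : Space) : ∑ j, boxBary ε η l σ x j = 1 := by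
  simp [boxBary, Fin.sum_univ_four]

theorem pos_apply (l : Site) (i : Fin 3) : pos ε l i = ε * l i := rfl

/-- The weights telescope. In coordinate `σ k` exactly the vertices of index above `k` are shifted
by `ε * η (σ k)`, and their weights add up to the box coordinate of `σ k`. -/
theorem sum_boxBary_smul (hε : ε ≠ 0) (hη : ∀ i, η i ≠ 0) (x : Space) :
    ∑ j, boxBary ε η l σ x j • pos ε (typeATet η l σ j) = x := by
  ext c
  obtain ⟨k, rfl⟩ := σ.surjective c
  have h : (η (σ k) : ℝ) ≠ 0 := by exact_mod_cast hη _
  have hx : x (σ k) = ε * (l (σ k) + boxCoord ε η l x (σ k) * η (σ k)) := by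
    rw [boxCoord]; field_simp; ring
  rw [hx]
  simp only [Fin.sum_univ_four, PiLp.add_apply, PiLp.smul_apply, pos_apply, typeATet_apply,
    smul_eq_mul, boxBary]
  fin_cases k <;> simp <;> ring

theorem affineIndependent_typeA (hε : ε ≠ 0) (hη : ∀ i, η i ≠ 0) :
    AffineIndependent ℝ (fun j => pos ε (typeATet η l σ j)) := by
  rw [affineIndependent_iff_of_fintype]
  intro w hw hw'
  rw [Finset.univ.weightedVSub_eq_linear_combination hw] at hw'
  -- Coordinate `σ k` of the relation says that the weights of index above `k` have sum zero. These
  -- three tail sums and the total determine all weights.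
  have h (k : Fin 3) : ∑ j, w j * (if k.val < j.val then 1 else 0) = 0 := by
    have h1 : (η (σ k) : ℝ) ≠ 0 := by exact_mod_cast hη _
    have := congrArg (fun z : Space => z (σ k)) hw'
    simp only [Fin.sum_univ_four, PiLp.add_apply, PiLp.smul_apply, pos_apply, typeATet_apply,
      smul_eq_mul, PiLp.zero_apply] at this hw ⊢
    have h2 : ε * η (σ k) ≠ 0 := mul_ne_zero hε h1
    refine ((mul_eq_zero (a := ε * (η (σ k) : ℝ))).1 ?_).resolve_left h2
    push_cast at this
    fin_cases k <;> simp [-mul_eq_zero] at this ⊢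
    · linear_combination this - ε * (l (σ 0) : ℝ) * hw
    · linear_combination this - ε * (l (σ 1) : ℝ) * hw
    · linear_combination this - ε * (l (σ 2) : ℝ) * hw
  have h0 := h 0
  have h1 := h 1
  have h2 := h 2
  simp [Fin.sum_univ_four] at h0 h1 h2 hw
  intro i
  fin_cases i <;> simp <;> linarith

theorem coord_typeA (hε : ε ≠ 0) (hη : ∀ i, η i ≠ 0) (j : Fin 4) (x : Space) :
    (tetBasis (affineIndependent_typeA (l := l) (σ := σ) hε hη)).coord j x =
      boxBary ε η l σ x j := by
  conv_lhs => rw [← sum_boxBary_smul (l := l) (σ := σ) hε hη x]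
  exact coord_tetBasis _ (sum_boxBary x) j

theorem mem_hull_typeA (hε : ε ≠ 0) (hη : ∀ i, η i ≠ 0) {x : Space} :
    x ∈ hull ε (typeATet η l σ) ↔ ∀ j, 0 ≤ boxBary ε η l σ x j := by
  rw [mem_hull_iff (affineIndependent_typeA hε hη)]
  simp only [coord_typeA hε hη]

theorem mem_interior_hull_typeA (hε : ε ≠ 0) (hη : ∀ i, η i ≠ 0) {x : Space} :
    x ∈ interior (hull ε (typeATet η l σ)) ↔ ∀ j, 0 < boxBary ε η l σ x j := by
  rw [mem_interior_hull_iff (affineIndependent_typeA hε hη)]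
  simp only [coord_typeA hε hη]

end BondVolume

namespace BondVolume
open MeasureTheory Set Filter Topology
open scoped NNReal

variable {ε : ℝ} {η l : Site} {σ τ : Equiv.Perm (Fin 3)}

theorem eq_boxCoord (hε : ε ≠ 0) (hη : ∀ i, η i ≠ 0) (x : Space) (i : Fin 3) :
    x i = ε * (l i + boxCoord ε η l x i * η i) := by
  have h : (η i : ℝ) ≠ 0 := by exact_mod_cast hη i
  rw [boxCoord]; field_simp; ring

theorem coord_mem_Icc_iff (hε : 0 < ε) (hη : ∀ i, η i ≠ 0) (x : Space) (i : Fin 3) :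
    x i ∈ Icc (min (ε * (l i : ℝ)) (ε * ((l i + η i : ℤ) : ℝ)))
      (max (ε * (l i : ℝ)) (ε * ((l i + η i : ℤ) : ℝ))) ↔ boxCoord ε η l x i ∈ Icc (0 : ℝ) 1 := by
  rw [eq_boxCoord (l := l) hε.ne' hη x i]
  push_cast
  set y := boxCoord ε η l x i
  rcases lt_or_gt_of_ne (hη i) with h | h
  · have h' : (η i : ℝ) < 0 := by exact_mod_cast h
    have h2 : ε * ((l i : ℝ) + η i) ≤ ε * l i := by nlinarith
    rw [min_eq_right h2, max_eq_left h2, mem_Icc, mem_Icc, mul_le_mul_iff_right₀ hε,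
      mul_le_mul_iff_right₀ hε]
    constructor <;> rintro ⟨h3, h4⟩ <;> constructor <;> nlinarith
  · have h' : 0 < (η i : ℝ) := by exact_mod_cast h
    have h2 : ε * l i ≤ ε * ((l i : ℝ) + η i) := by nlinarith
    rw [min_eq_left h2, max_eq_right h2, mem_Icc, mem_Icc, mul_le_mul_iff_right₀ hε,
      mul_le_mul_iff_right₀ hε]
    constructor <;> rintro ⟨h3, h4⟩ <;> constructor <;> nlinarith

theorem closure_bondVolume (hε : 0 < ε) (hη : ∀ i, η i ≠ 0) :
    closure (bondVolume ε η l) = WithLp.ofLp ⁻¹' (Set.Icc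
      (fun i => min (ε * (l i : ℝ)) (ε * ((l i + η i : ℤ) : ℝ)))
      (fun i => max (ε * (l i : ℝ)) (ε * ((l i + η i : ℤ) : ℝ)))) := by
  let e := (PiLp.homeomorph 2 (fun _ : Fin 3 => ℝ))
  have h : bondVolume ε η l = e ⁻¹' (Set.pi univ fun i => Ioo
      (min (ε * (l i : ℝ)) (ε * ((l i + η i : ℤ) : ℝ)))
      (max (ε * (l i : ℝ)) (ε * ((l i + η i : ℤ) : ℝ)))) := by
    ext x; simp [bondVolume, e, -lt_inf_iff, -inf_lt_iff]; rfl
  rw [h, ← e.preimage_closure, closure_pi_set, ← pi_univ_Icc]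
  congr 2
  funext i
  apply closure_Ioo
  have h' : (η i : ℝ) ≠ 0 := by exact_mod_cast hη i
  push_cast
  intro hmin
  rw [inf_eq_sup] at hmin
  have := mul_left_cancel₀ hε.ne' hmin
  exact h' (by linarith)

theorem mem_closure_bondVolume_iff (hε : 0 < ε) (hη : ∀ i, η i ≠ 0) {x : Space} :
    x ∈ closure (bondVolume ε η l) ↔ ∀ i, boxCoord ε η l x i ∈ Icc (0 : ℝ) 1 := by
  rw [closure_bondVolume hε hη, mem_preimage, ← pi_univ_Icc]
  simp only [Set.mem_pi, mem_univ, forall_true_left]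
  exact forall_congr' fun i => coord_mem_Icc_iff hε hη x i

theorem isOpen_bondVolume : IsOpen (bondVolume ε η l) := by
  have : bondVolume ε η l = ⋂ i, {x : Space | x i ∈ Ioo
      (min (ε * (l i : ℝ)) (ε * ((l i + η i : ℤ) : ℝ)))
      (max (ε * (l i : ℝ)) (ε * ((l i + η i : ℤ) : ℝ)))} := by
    ext x; simp [bondVolume]
  rw [this]
  exact isOpen_iInter_of_finite fun i => isOpen_Ioo.preimage (by fun_prop)

theorem convex_bondVolume : Convex ℝ (bondVolume ε η l) := by
  intro x hx y hy a b ha hb hab i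
  exact convex_Ioo _ _ (hx i) (hy i) ha hb hab

theorem measureReal_closure_bondVolume (hε : 0 < ε) (hη : ∀ i, η i ≠ 0) :
    volume.real (closure (bondVolume ε η l)) = ε ^ 3 * |(η 0 * η 1 * η 2 : ℝ)| := by
  rw [closure_bondVolume hε hη, measureReal_def,
    (PiLp.volume_preserving_ofLp (Fin 3)).measure_preimage measurableSet_Icc.nullMeasurableSet,
    Real.volume_Icc_pi_toReal (fun i => min_le_max)]
  simp only [max_sub_min_eq_abs]
  have h (i : Fin 3) : |ε * ((l i + η i : ℤ) : ℝ) - ε * (l i : ℝ)| = ε * |(η i : ℝ)| := by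
    rw [← mul_sub, abs_mul, abs_of_pos hε]; simp
  simp only [h, Fin.prod_univ_three, abs_mul]
  ring

/-- The tetrahedron of `σ` consists of the points whose box coordinates lie in `[0, 1]` and do not
increase along `σ`. Sorting the coordinates of a point thus finds a tetrahedron that contains it. -/
theorem iUnion_hull_typeA (hε : 0 < ε) (hη : ∀ i, η i ≠ 0) :
    ⋃ σ, hull ε (typeATet η l σ) = closure (bondVolume ε η l) := by
  ext x
  simp only [mem_iUnion, mem_hull_typeA hε.ne' hη, mem_closure_bondVolume_iff hε hη]
  constructor
  · rintro ⟨σ, h⟩ i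
    have h0 := h 0
    have h1 := h 1
    have h2 := h 2
    have h3 := h 3
    simp [boxBary] at h0 h1 h2 h3
    obtain ⟨k, rfl⟩ := σ.surjective i
    fin_cases k <;> constructor <;> simp <;> linarith
  · intro h
    set y := boxCoord ε η l x with hy
    have hm := Tuple.monotone_sort (fun i => -y i)
    set σ := Tuple.sort (fun i => -y i)
    have h01 := hm (show (0 : Fin 3) ≤ 1 by decide)
    have h12 := hm (show (1 : Fin 3) ≤ 2 by decide)
    simp only [Function.comp] at h01 h12
    refine ⟨σ, fun j => ?_⟩
    have ha := (h (σ 0)).2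
    have hb := (h (σ 2)).1
    fin_cases j <;> simp [boxBary, ← hy] <;> linarith

theorem boxBary_pos_iff {x : Space} : (∀ j, 0 < boxBary ε η l σ x j) ↔
    boxCoord ε η l x (σ 0) < 1 ∧ boxCoord ε η l x (σ 1) < boxCoord ε η l x (σ 0) ∧
    boxCoord ε η l x (σ 2) < boxCoord ε η l x (σ 1) ∧ 0 < boxCoord ε η l x (σ 2) := by
  simp [boxBary, Fin.forall_fin_succ]

theorem boxBary_nonneg_iff {x : Space} : (∀ j, 0 ≤ boxBary ε η l σ x j) ↔
    boxCoord ε η l x (σ 0) ≤ 1 ∧ boxCoord ε η l x (σ 1) ≤ boxCoord ε η l x (σ 0) ∧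
    boxCoord ε η l x (σ 2) ≤ boxCoord ε η l x (σ 1) ∧ 0 ≤ boxCoord ε η l x (σ 2) := by
  simp [boxBary, Fin.forall_fin_succ]

/-- An order that arranges the same three values strictly is unique, because strictly monotone
functions with equal range coincide. -/
theorem perm_eq_of_strictAnti {y : Fin 3 → ℝ} (h1 : y (σ 1) < y (σ 0)) (h2 : y (σ 2) < y (σ 1))
    (g1 : y (τ 1) < y (τ 0)) (g2 : y (τ 2) < y (τ 1)) : σ = τ := by
  have hs (ρ : Equiv.Perm (Fin 3)) (h1 : y (ρ 1) < y (ρ 0)) (h2 : y (ρ 2) < y (ρ 1)) :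
      StrictMono fun i => -y (ρ i) := by
    rw [Fin.strictMono_iff_lt_succ]
    intro i
    fin_cases i <;> simpa
  have hσ := hs σ h1 h2
  have hτ := hs τ g1 g2
  have hr (ρ : Equiv.Perm (Fin 3)) : range (fun i => -y (ρ i)) = range fun i => -y i :=
    ρ.surjective.range_comp (fun i => -y i)
  have := (hσ.range_inj hτ).1 (by rw [hr, hr])
  have hinj : Function.Injective fun i => -y i := by
    intro a b hab
    obtain ⟨a, rfl⟩ := σ.surjective a
    obtain ⟨b, rfl⟩ := σ.surjective b
    rw [hσ.injective hab]
  ext i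
  exact congrArg Fin.val (hinj (congrFun this i))

theorem disjoint_interior_typeA (hε : ε ≠ 0) (hη : ∀ i, η i ≠ 0) (h : σ ≠ τ) :
    Disjoint (interior (hull ε (typeATet η l σ))) (interior (hull ε (typeATet η l τ))) := by
  rw [Set.disjoint_left]
  intro x hx hy
  rw [mem_interior_hull_typeA hε hη, boxBary_pos_iff] at hx hy
  exact h (perm_eq_of_strictAnti hx.2.1 hx.2.2.1 hy.2.1 hy.2.2.1)

/-- A positive weight at vertex `j` with `0 < j < 3` is a strict gap between the `j` largest box
coordinates and the others. The set of the `j` largest is then determined by `x`, and vertex `j`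
depends on `σ` only through this set. Vertices `0` and `3` do not depend on `σ` at all. -/
theorem typeATet_eq_of_boxBary_pos {x : Space} {j : Fin 4} (hσ : ∀ j, 0 ≤ boxBary ε η l σ x j)
    (hτ : ∀ j, 0 ≤ boxBary ε η l τ x j) (hj : boxBary ε η l σ x j ≠ 0) :
    typeATet η l σ j = typeATet η l τ j := by
  have hj' : 0 < boxBary ε η l σ x j := lt_of_le_of_ne (hσ j) hj.symm
  obtain ⟨a0, a1, a2, a3⟩ := boxBary_nonneg_iff.1 hσ
  obtain ⟨b0, b1, b2, b3⟩ := boxBary_nonneg_iff.1 hτ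
  set y := boxCoord ε η l x with hy
  suffices h : ∀ c, (σ.symm c).val < j.val ↔ (τ.symm c).val < j.val by
    funext c
    simp only [typeATet, h]
  have hc (ρ : Equiv.Perm (Fin 3)) (c : Fin 3) : c = ρ 0 ∨ c = ρ 1 ∨ c = ρ 2 := by
    obtain ⟨k, rfl⟩ := ρ.surjective c
    fin_cases k <;> simp
  fin_cases j
  · simp
  · simp [boxBary, ← hy] at hj'
    have h0 : τ 0 = σ 0 := by
      rcases hc σ (τ 0) with h | h | h
      · exact h
      all_goals
        rcases hc τ (σ 0) with g | g | g
        · exact g.symm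
        · rw [g] at hj' a1; rw [h] at b1; linarith
        · rw [g] at hj' a1; rw [h] at b1; linarith
    intro c
    have e (ρ : Equiv.Perm (Fin 3)) : (ρ.symm c).val < 1 ↔ c = ρ 0 := by
      rw [← Equiv.symm_apply_eq, Fin.ext_iff]
      exact Nat.lt_one_iff
    simp only [e, h0]
  · simp [boxBary, ← hy] at hj'
    have h0 : τ 2 = σ 2 := by
      rcases hc σ (τ 2) with h | h | h
      · rcases hc τ (σ 2) with g | g | g
        · rw [g] at hj' a2; rw [h] at b2; linarith
        · rw [g] at hj' a2; rw [h] at b2; linarith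
        · exact g.symm
      · rcases hc τ (σ 2) with g | g | g
        · rw [g] at hj' a2; rw [h] at b2; linarith
        · rw [g] at hj' a2; rw [h] at b2; linarith
        · exact g.symm
      · exact h
    intro c
    have e (ρ : Equiv.Perm (Fin 3)) : (ρ.symm c).val < 2 ↔ c ≠ ρ 2 := by
      rw [Ne, ← Equiv.symm_apply_eq, Fin.ext_iff]
      have := (ρ.symm c).isLt
      simp
      omega
    simp only [e, h0]
  · intro c
    have e (ρ : Equiv.Perm (Fin 3)) : (ρ.symm c).val < 3 := (ρ.symm c).isLt
    simp [e]

/-- The type A decomposition is conforming. -/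
theorem typeA_inter_subset (hε : ε ≠ 0) (hη : ∀ i, η i ≠ 0) :
    hull ε (typeATet η l σ) ∩ hull ε (typeATet η l τ) ⊆
      convexHull ℝ (pos ε '' (range (typeATet η l σ) ∩ range (typeATet η l τ))) := by
  rintro x ⟨hσ, hτ⟩
  rw [mem_hull_typeA hε hη] at hσ hτ
  -- Vertices of weight zero need not be common to the two tetrahedra. Replacing them by vertex `0`,
  -- which is common, does not change the sum.
  have hz : ∑ j, boxBary ε η l σ x j •
      (if boxBary ε η l σ x j = 0 then pos ε (typeATet η l σ 0)
        else pos ε (typeATet η l σ j)) = x := by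
    conv_rhs => rw [← sum_boxBary_smul (l := l) (σ := σ) hε hη x]
    refine Finset.sum_congr rfl fun j _ => ?_
    split_ifs with h
    · simp [h]
    · rfl
  rw [← hz]
  refine (convex_convexHull ℝ _).sum_mem (fun j _ => hσ j) (sum_boxBary x) fun j _ => ?_
  apply subset_convexHull
  have h0 : typeATet η l σ 0 = typeATet η l τ 0 := by
    funext c; simp [typeATet]
  split_ifs with h
  · exact ⟨_, ⟨⟨0, rfl⟩, ⟨0, h0.symm⟩⟩, rfl⟩
  · exact ⟨_, ⟨⟨j, rfl⟩, ⟨j, (typeATet_eq_of_boxBary_pos hσ hτ h).symm⟩⟩, rfl⟩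

end BondVolume

namespace BondVolume
open MeasureTheory Set Filter Topology
open scoped NNReal

variable {ε : ℝ} {η l : Site} {σ τ : Equiv.Perm (Fin 3)}

theorem perm_fin_three_cases (σ : Equiv.Perm (Fin 3)) :
    (σ 0 = 0 ∧ σ 1 = 1 ∧ σ 2 = 2) ∨ (σ 0 = 0 ∧ σ 1 = 2 ∧ σ 2 = 1) ∨
    (σ 0 = 1 ∧ σ 1 = 0 ∧ σ 2 = 2) ∨ (σ 0 = 1 ∧ σ 1 = 2 ∧ σ 2 = 0) ∨
    (σ 0 = 2 ∧ σ 1 = 0 ∧ σ 2 = 1) ∨ (σ 0 = 2 ∧ σ 1 = 1 ∧ σ 2 = 0) := by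
  revert σ; decide

theorem abs_tripleProduct_typeA (hε : 0 < ε) :
    |tripleProduct (pos ε (typeATet η l σ 0)) (pos ε (typeATet η l σ 1))
      (pos ε (typeATet η l σ 2)) (pos ε (typeATet η l σ 3))| =
      ε ^ 3 * |(η 0 * η 1 * η 2 : ℝ)| := by
  have h (j : Fin 4) (k : Fin 3) (c : Fin 3) (hc : σ k = c) :
      pos ε (typeATet η l σ j) c = ε * (l c + if k.val < j.val then (η c : ℝ) else 0) := by
    subst hc
    rw [pos_apply, typeATet_apply]
    push_cast
    rfl
  have hp : |ε ^ 3| = ε ^ 3 := abs_of_pos (by positivity)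
  rw [← hp, ← abs_mul, tripleProduct_eq]
  rcases perm_fin_three_cases σ with ⟨h0, h1, h2⟩ | ⟨h0, h1, h2⟩ | ⟨h0, h1, h2⟩ | ⟨h0, h1, h2⟩ |
    ⟨h0, h1, h2⟩ | ⟨h0, h1, h2⟩
  all_goals
    simp only [fun j => h j _ _ h0, fun j => h j _ _ h1, fun j => h j _ _ h2]
    simp [-abs_mul]
    congr 1
    ring

theorem prod_ne_zero_of_site (hη : ∀ i, η i ≠ 0) : (η 0 * η 1 * η 2 : ℝ) ≠ 0 := by
  have h (i : Fin 3) : (η i : ℝ) ≠ 0 := by exact_mod_cast hη i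
  exact mul_ne_zero (mul_ne_zero (h 0) (h 1)) (h 2)

theorem tripleProduct_typeA_ne_zero (hε : 0 < ε) (hη : ∀ i, η i ≠ 0) :
    tripleProduct (pos ε (typeATet η l σ 0)) (pos ε (typeATet η l σ 1))
      (pos ε (typeATet η l σ 2)) (pos ε (typeATet η l σ 3)) ≠ 0 := by
  rw [← abs_pos, abs_tripleProduct_typeA hε]
  have := prod_ne_zero_of_site hη
  positivity

/-! ### Volumes -/

/-- The intersection lies in the two frontiers, and the frontier of a convex set is a null set. -/
theorem volume_inter_eq_zero {s t : Set Space} (hs : Convex ℝ s) (ht : Convex ℝ t)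
    (h : Disjoint (interior s) (interior t)) : volume (s ∩ t) = 0 := by
  refine measure_mono_null (t := frontier s ∪ frontier t) ?_
    (measure_union_null (hs.addHaar_frontier volume) (ht.addHaar_frontier volume))
  rintro x ⟨h1, h2⟩
  by_cases h3 : x ∈ interior s
  · exact Or.inr ⟨subset_closure h2, fun h4 => Set.disjoint_left.1 h h3 h4⟩
  · exact Or.inl ⟨subset_closure h1, h3⟩

theorem measurableSet_hull (T : Tet) : MeasurableSet (hull ε T) := (isClosed_hull T).measurableSet

theorem volume_hull_lt_top (T : Tet) : volume (hull ε T) < ⊤ := (isCompact_hull T).measure_lt_top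

theorem measureReal_hull_typeA_eq (hε : 0 < ε) (hη : ∀ i, η i ≠ 0) :
    volume.real (hull ε (typeATet η l σ)) =
      ε ^ 3 * |(η 0 * η 1 * η 2 : ℝ)| * volume.real simplex := by
  have := setIntegral_tetrahedron _ _ _ _
    (tripleProduct_typeA_ne_zero (l := l) (σ := σ) hε hη) (fun _ => 1)
  rw [abs_tripleProduct_typeA hε,
    ← range_fin_four (fun j => pos ε (typeATet η l σ j))] at this
  simpa [hull] using this

theorem sum_measureReal_typeA (hε : 0 < ε) (hη : ∀ i, η i ≠ 0) :
    ∑ σ, volume.real (hull ε (typeATet η l σ)) = ε ^ 3 * |(η 0 * η 1 * η 2 : ℝ)| := by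
  have hu : ⋃ σ, hull ε (typeATet η l σ) =
      ⋃ σ ∈ (Finset.univ : Finset (Equiv.Perm (Fin 3))), hull ε (typeATet η l σ) := by simp
  rw [← measureReal_closure_bondVolume (l := l) hε hη, ← iUnion_hull_typeA hε hη, hu,
    measureReal_biUnion_finset₀ _ _ fun σ _ => (volume_hull_lt_top _).ne]
  · intro σ _ τ _ h
    exact volume_inter_eq_zero (convex_hull _) (convex_hull _) (disjoint_interior_typeA hε.ne' hη h)
  · exact fun σ _ => (measurableSet_hull _).nullMeasurableSet

/-- The six tetrahedra of the unit cube all have the volume of `simplex`, and together they fill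
volume one. -/
theorem measureReal_simplex : volume.real simplex = 1 / 6 := by
  have h1 := sum_measureReal_typeA (ε := 1) (η := fun _ => 1) (l := 0) one_pos (by simp)
  simp only [measureReal_hull_typeA_eq (ε := 1) (η := fun _ => 1) (l := 0) one_pos (by simp)] at h1
  simp [Fintype.card_perm, Nat.factorial] at h1
  linarith

theorem measureReal_hull_typeA (hε : 0 < ε) (hη : ∀ i, η i ≠ 0) :
    volume.real (hull ε (typeATet η l σ)) = ε ^ 3 * |(η 0 * η 1 * η 2 : ℝ)| / 6 := by
  rw [measureReal_hull_typeA_eq hε hη, measureReal_simplex]; ring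

theorem typeATet_injective (hη : ∀ i, η i ≠ 0) :
    Function.Injective fun p : Site × Equiv.Perm (Fin 3) => typeATet η p.1 p.2 := by
  rintro ⟨l, σ⟩ ⟨m, τ⟩ h
  simp only at h
  have hl : l = m := by
    have := congrFun h 0
    funext c
    have := congrFun this c
    simpa [typeATet] using this
  subst hl
  have hj (j : Fin 4) (c : Fin 3) : (σ.symm c).val < j.val ↔ (τ.symm c).val < j.val := by
    have := congrFun (congrFun h j) c
    simp only [typeATet, add_right_inj] at this
    split_ifs at this with h1 h2 h2
    · exact iff_of_true h1 h2
    · exact absurd this (hη c)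
    · exact absurd this.symm (hη c)
    · exact iff_of_false h1 h2
  have : σ.symm = τ.symm := by
    ext c
    have h1 := hj 1 c
    have h2 := hj 2 c
    have := (σ.symm c).isLt
    have := (τ.symm c).isLt
    simp at h1 h2
    have e1 : (σ.symm c = 0 ↔ (σ.symm c).val = 0) := Fin.ext_iff
    have e2 : (τ.symm c = 0 ↔ (τ.symm c).val = 0) := Fin.ext_iff
    omega
  have h2 : σ = τ := by
    have := congrArg Equiv.symm this
    simpa using this
  rw [h2]

end BondVolume

namespace BondVolume
open MeasureTheory Set Filter Topology
open scoped NNReal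

variable {ε : ℝ}

/-! ### The lattice tetrahedra and their neighbours -/

/-- The tetrahedra of the type A decomposition of the lattice. -/
def lat (p : Site × Equiv.Perm (Fin 3)) : Tet := typeATet (fun _ => 1) p.1 p.2

/-- The barycentric coordinates of a lattice tetrahedron. -/
noncomputable def bary (ε : ℝ) (p : Site × Equiv.Perm (Fin 3)) (x : Space) : Fin 4 → ℝ :=
  boxBary ε (fun _ => 1) p.1 p.2 x

theorem one_site_ne_zero (i : Fin 3) : (fun _ => 1 : Site) i ≠ 0 := by simp

theorem lat_injective : Function.Injective lat := typeATet_injective one_site_ne_zero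

theorem affineIndependent_lat (hε : ε ≠ 0) (p : Site × Equiv.Perm (Fin 3)) :
    AffineIndependent ℝ (fun j => pos ε (lat p j)) :=
  affineIndependent_typeA hε one_site_ne_zero

theorem coord_lat (hε : ε ≠ 0) (p : Site × Equiv.Perm (Fin 3)) (j : Fin 4) (x : Space) :
    (tetBasis (affineIndependent_lat hε p)).coord j x = bary ε p x j :=
  coord_typeA hε one_site_ne_zero j x

theorem mem_hull_lat (hε : ε ≠ 0) {p : Site × Equiv.Perm (Fin 3)} {x : Space} :
    x ∈ hull ε (lat p) ↔ ∀ j, 0 ≤ bary ε p x j := mem_hull_typeA hε one_site_ne_zero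

theorem mem_interior_hull_lat (hε : ε ≠ 0) {p : Site × Equiv.Perm (Fin 3)} {x : Space} :
    x ∈ interior (hull ε (lat p)) ↔ ∀ j, 0 < bary ε p x j :=
  mem_interior_hull_typeA hε one_site_ne_zero

theorem bary_vertex (hε : ε ≠ 0) (p : Site × Equiv.Perm (Fin 3)) (j k : Fin 4) :
    bary ε p (pos ε (lat p k)) j = if j = k then 1 else 0 := by
  rw [← coord_lat hε]
  exact AffineBasis.coord_apply _ j k

theorem bary_lineMap (hε : ε ≠ 0) (p : Site × Equiv.Perm (Fin 3)) (x y : Space) (s : ℝ)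
    (j : Fin 4) : bary ε p (AffineMap.lineMap x y s) j =
      bary ε p x j + s * (bary ε p y j - bary ε p x j) := by
  simp only [← coord_lat hε, AffineMap.apply_lineMap]
  rw [AffineMap.lineMap_apply]
  simp [add_comm]

theorem continuous_bary (hε : ε ≠ 0) (p : Site × Equiv.Perm (Fin 3)) (j : Fin 4) :
    Continuous fun x => bary ε p x j := by
  simp only [← coord_lat hε]
  exact ((tetBasis (affineIndependent_lat hε p)).coord j).continuous_of_finiteDimensional

/-- The lattice tetrahedron on the other side of the face opposite to the vertex `i`, and its
vertex opposite to that face. -/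
def neighbor (p : Site × Equiv.Perm (Fin 3)) (i : Fin 4) : (Site × Equiv.Perm (Fin 3)) × Fin 4 :=
  match i with
  | 0 => ((p.1 + Pi.single (p.2 0) 1, p.2 * finRotate 3), 3)
  | 1 => ((p.1, p.2 * Equiv.swap 0 1), 1)
  | 2 => ((p.1, p.2 * Equiv.swap 1 2), 2)
  | 3 => ((p.1 - Pi.single (p.2 2) 1, p.2 * (finRotate 3)⁻¹), 0)

theorem neighbor_neighbor (p : Site × Equiv.Perm (Fin 3)) (i : Fin 4) :
    neighbor (neighbor p i).1 (neighbor p i).2 = (p, i) := by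
  obtain ⟨m, σ⟩ := p
  have h2 : (finRotate 3) 2 = 0 := by decide
  have h3 : (finRotate 3)⁻¹ 0 = 2 := by decide
  fin_cases i
  · simp [neighbor, h2]
  · simp [neighbor, mul_assoc]
  · simp [neighbor, mul_assoc]
  · simp only [neighbor, Equiv.Perm.mul_apply, h3]
    simp

theorem lat_apply (p : Site × Equiv.Perm (Fin 3)) (j : Fin 4) (k : Fin 3) :
    lat p j (p.2 k) = p.1 (p.2 k) + if k.val < j.val then 1 else 0 := typeATet_apply j k

/-- The vertices of the common face appear in the same order in both tetrahedra. Hence the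
parametrizations of the face from both sides are literally equal, see `facePoint_neighbor`. -/
theorem lat_neighbor (p : Site × Equiv.Perm (Fin 3)) (i : Fin 4) (k : Fin 3) :
    lat (neighbor p i).1 ((neighbor p i).2.succAbove k) = lat p (i.succAbove k) := by
  obtain ⟨m, σ⟩ := p
  have key (j : Fin 4) (τ : Equiv.Perm (Fin 3)) (m' : Site) (j' : Fin 4)
      (h : ∀ a : Fin 3, m' (σ a) + (if (τ⁻¹ a).val < j'.val then 1 else 0) =
        m (σ a) + if a.val < j.val then 1 else 0) : lat (m', σ * τ) j' = lat (m, σ) j := by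
    funext c
    obtain ⟨a, rfl⟩ := σ.surjective c
    have h1 := lat_apply (m, σ) j a
    have h2 := lat_apply (m', σ * τ) j' (τ⁻¹ a)
    simp only [Equiv.Perm.mul_apply, show τ (τ⁻¹ a) = a from τ.apply_symm_apply a] at h1 h2
    rw [h1, h2, h]
  fin_cases i
  · refine key _ _ _ _ fun a => ?_
    have e : ∀ a : Fin 3, ((finRotate 3)⁻¹ a) = ![2, 0, 1] a := by decide
    fin_cases a <;> simp only [e] <;> fin_cases k <;> simp [neighbor, Fin.succAbove]
  · refine key _ _ _ _ fun a => ?_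
    have e : ∀ a : Fin 3, ((Equiv.swap (0 : Fin 3) 1)⁻¹ a) = ![1, 0, 2] a := by decide
    fin_cases a <;> simp only [e] <;> fin_cases k <;> simp [neighbor, Fin.succAbove]
  · refine key _ _ _ _ fun a => ?_
    have e : ∀ a : Fin 3, ((Equiv.swap (1 : Fin 3) 2)⁻¹ a) = ![0, 2, 1] a := by decide
    fin_cases a <;> simp only [e] <;> fin_cases k <;> simp [neighbor, Fin.succAbove]
  · refine key _ _ _ _ fun a => ?_
    have e : ∀ a : Fin 3, ((finRotate 3)⁻¹⁻¹ a) = ![1, 2, 0] a := by decide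
    fin_cases a <;> simp only [e] <;> fin_cases k <;> simp [neighbor, Fin.succAbove]

theorem boxCoord_one (m : Site) (x : Space) (i : Fin 3) :
    boxCoord ε (fun _ => 1) m x i = x i / ε - m i := by simp [boxCoord]

/-- Both coordinates vanish on the plane of the common face and measure the height above it from
opposite sides. -/
theorem bary_neighbor (p : Site × Equiv.Perm (Fin 3)) (i : Fin 4) (x : Space) :
    bary ε (neighbor p i).1 x (neighbor p i).2 = -bary ε p x i := by
  obtain ⟨m, σ⟩ := p
  have e : (-1 : Fin 3) = 2 := by decide
  have e' : ∀ a : Fin 3, ((finRotate 3) a) = ![1, 2, 0] a := by decide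
  fin_cases i
  · simp [neighbor, bary, boxBary, boxCoord_one, e']; ring
  · simp [neighbor, bary, boxBary]
  · simp [neighbor, bary, boxBary]
  · simp [neighbor, bary, boxBary, boxCoord_one, e]; ring

theorem bary_neighbor_succAbove (p : Site × Equiv.Perm (Fin 3)) (i : Fin 4) {x : Space}
    (hx : bary ε p x i = 0) (k : Fin 3) :
    bary ε (neighbor p i).1 x ((neighbor p i).2.succAbove k) = bary ε p x (i.succAbove k) := by
  obtain ⟨m, σ⟩ := p
  have e : (-1 : Fin 3) = 2 := by decide
  have e' : ∀ a : Fin 3, ((finRotate 3) a) = ![1, 2, 0] a := by decide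
  have hs : Equiv.swap (0 : Fin 3) 1 2 = 2 := by decide
  have hs' : Equiv.swap (1 : Fin 3) 2 0 = 0 := by decide
  have h01 : σ 0 ≠ σ 1 := by simp
  have h02 : σ 0 ≠ σ 2 := by simp
  have h12 : σ 1 ≠ σ 2 := by simp
  fin_cases i
  · fin_cases k <;>
      simp [neighbor, bary, boxBary, boxCoord_one, e', Fin.succAbove, h01.symm, h02.symm] at hx ⊢ <;> linarith
  · fin_cases k <;>
      simp [neighbor, bary, boxBary, Fin.succAbove, hs] at hx ⊢ <;> linarith
  · fin_cases k <;>
      simp [neighbor, bary, boxBary, Fin.succAbove, hs'] at hx ⊢ <;> linarith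
  · fin_cases k <;>
      simp [neighbor, bary, boxBary, boxCoord_one, e, Fin.succAbove, h02, h12] at hx ⊢ <;> linarith

/-- The points in the relative interior of the face opposite to the vertex `i`. -/
def openFace (ε : ℝ) (p : Site × Equiv.Perm (Fin 3)) (i : Fin 4) : Set Space :=
  {x | bary ε p x i = 0 ∧ ∀ k : Fin 3, 0 < bary ε p x (i.succAbove k)}

theorem openFace_neighbor (p : Site × Equiv.Perm (Fin 3)) (i : Fin 4) {x : Space}
    (hx : x ∈ openFace ε p i) : x ∈ openFace ε (neighbor p i).1 (neighbor p i).2 := by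
  refine ⟨by rw [bary_neighbor, hx.1, neg_zero], fun k => ?_⟩
  rw [bary_neighbor_succAbove p i hx.1]
  exact hx.2 k

theorem openFace_subset_hull (hε : ε ≠ 0) (p : Site × Equiv.Perm (Fin 3)) (i : Fin 4) :
    openFace ε p i ⊆ hull ε (lat p) := by
  rintro x ⟨h0, h⟩
  rw [mem_hull_lat hε]
  intro j
  rcases Fin.eq_self_or_eq_succAbove i j with rfl | ⟨k, rfl⟩
  · rw [h0]
  · exact (h k).le

theorem eventually_mem_interior_lat (hε : ε ≠ 0) {p : Site × Equiv.Perm (Fin 3)} {i : Fin 4}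
    {x : Space} (hx : x ∈ openFace ε p i) :
    ∀ᶠ z in 𝓝 x, 0 < bary ε p z i → z ∈ interior (hull ε (lat p)) := by
  have h : ∀ᶠ z in 𝓝 x, ∀ k : Fin 3, 0 < bary ε p z (i.succAbove k) :=
    eventually_all.2 fun k => (continuous_bary hε p _).continuousAt.eventually (lt_mem_nhds (hx.2 k))
  filter_upwards [h] with z hz h0
  rw [mem_interior_hull_lat hε]
  intro j
  rcases Fin.eq_self_or_eq_succAbove i j with rfl | ⟨k, rfl⟩
  · exact h0
  · exact hz k

theorem eventually_mem_interior_neighbor (hε : ε ≠ 0) {p : Site × Equiv.Perm (Fin 3)} {i : Fin 4}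
    {x : Space} (hx : x ∈ openFace ε p i) :
    ∀ᶠ z in 𝓝 x, bary ε p z i < 0 → z ∈ interior (hull ε (lat (neighbor p i).1)) := by
  filter_upwards [eventually_mem_interior_lat hε (openFace_neighbor p i hx)] with z hz h
  exact hz (by rw [bary_neighbor]; linarith)

/-- Near a point of a common face there are only the two tetrahedra. -/
theorem eventually_mem_hull_or (hε : ε ≠ 0) {p : Site × Equiv.Perm (Fin 3)} {i : Fin 4}
    {x : Space} (hx : x ∈ openFace ε p i) :
    ∀ᶠ z in 𝓝 x, z ∈ hull ε (lat p) ∨ z ∈ hull ε (lat (neighbor p i).1) := by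
  have h : ∀ᶠ z in 𝓝 x, ∀ k : Fin 3, 0 < bary ε p z (i.succAbove k) :=
    eventually_all.2 fun k => (continuous_bary hε p _).continuousAt.eventually (lt_mem_nhds (hx.2 k))
  filter_upwards [eventually_mem_interior_lat hε hx, eventually_mem_interior_neighbor hε hx, h]
    with z h1 h2 h3
  rcases lt_trichotomy (bary ε p z i) 0 with h | h | h
  · exact Or.inr (interior_subset (h2 h))
  · exact Or.inl (openFace_subset_hull hε p i ⟨h, h3⟩)
  · exact Or.inl (interior_subset (h1 h))

theorem eventually_lineMap {x : Space} (y : Space) {P : Space → Prop} (h : ∀ᶠ z in 𝓝 x, P z) :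
    ∀ᶠ s in 𝓝[>] (0 : ℝ), P (AffineMap.lineMap x y s) := by
  have : Tendsto (fun s : ℝ => AffineMap.lineMap x y s) (𝓝[>] 0) (𝓝 x) := by
    have hc : Continuous fun s : ℝ => (AffineMap.lineMap x y s : Space) :=
      AffineMap.lineMap_continuous
    have := hc.tendsto 0
    simp only [AffineMap.lineMap_apply_zero] at this
    exact this.mono_left nhdsWithin_le_nhds
  exact this.eventually h

/-- The centre of a face. -/
theorem openFace_nonempty (hε : ε ≠ 0) (p : Site × Equiv.Perm (Fin 3)) (i : Fin 4) :
    (openFace ε p i).Nonempty := by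
  let w : Fin 4 → ℝ := fun j => if j = i then 0 else 1 / 3
  have hw : ∑ j, w j = 1 := by
    rw [Fin.sum_univ_succAbove _ i]
    simp [w, Fin.succAbove_ne]
  refine ⟨∑ j, w j • pos ε (lat p j), ?_, fun k => ?_⟩
  · rw [← coord_lat hε, coord_tetBasis _ hw]; simp [w]
  · rw [← coord_lat hε, coord_tetBasis _ hw]; simp [w, Fin.succAbove_ne]

/-- An interior point determines its tetrahedron: the cell by integer parts, the permutation by the
strict order of the fractional parts. -/
theorem disjoint_interior_lat (hε : ε ≠ 0) {p q : Site × Equiv.Perm (Fin 3)} (h : p ≠ q) :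
    Disjoint (interior (hull ε (lat p))) (interior (hull ε (lat q))) := by
  rw [Set.disjoint_left]
  intro x hx hy
  rw [mem_interior_hull_lat hε, bary, boxBary_pos_iff] at hx hy
  have hc (r : Site × Equiv.Perm (Fin 3)) (hr : boxCoord ε (fun _ => 1) r.1 x (r.2 0) < 1 ∧
      boxCoord ε (fun _ => 1) r.1 x (r.2 1) < boxCoord ε (fun _ => 1) r.1 x (r.2 0) ∧
      boxCoord ε (fun _ => 1) r.1 x (r.2 2) < boxCoord ε (fun _ => 1) r.1 x (r.2 1) ∧
      0 < boxCoord ε (fun _ => 1) r.1 x (r.2 2)) (i : Fin 3) : ⌊x i / ε⌋ = r.1 i := by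
    rw [Int.floor_eq_iff]
    have : 0 < boxCoord ε (fun _ => 1) r.1 x i ∧ boxCoord ε (fun _ => 1) r.1 x i < 1 := by
      obtain ⟨k, rfl⟩ := r.2.surjective i
      obtain ⟨h1, h2, h3, h4⟩ := hr
      fin_cases k <;> constructor <;> simp <;> linarith
    rw [boxCoord_one] at this
    constructor <;> linarith
  have h1 : p.1 = q.1 := by
    funext i
    rw [← hc p hx, ← hc q hy]
  rw [h1] at hx
  exact h (Prod.ext h1 (perm_eq_of_strictAnti hx.2.1 hx.2.2.1 hy.2.1 hy.2.2.1))

/-- Used repeatedly to push a common point of tetrahedra into their interiors, where disjointness is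
known. -/
theorem inter_interior_nonempty {s u : Set Space} (hu : IsOpen u)
    (hs : s ⊆ closure (interior s)) (h : (u ∩ s).Nonempty) : (u ∩ interior s).Nonempty := by
  obtain ⟨x, hxu, hxs⟩ := h
  exact mem_closure_iff.1 (hs hxs) u hu hxu

/-- A lattice tetrahedron that contains a face of another one is the latter or its neighbour. -/
theorem eq_or_eq_neighbor (hε : ε ≠ 0) {p q : Site × Equiv.Perm (Fin 3)} {i : Fin 4}
    {x : Space} (hx : x ∈ openFace ε p i) (hq : x ∈ hull ε (lat q)) :
    q = p ∨ q = (neighbor p i).1 := by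
  obtain ⟨u, hu, huo, hxu⟩ := eventually_nhds_iff.1 (eventually_mem_hull_or hε hx)
  have h1 := inter_interior_nonempty huo
    (hull_subset_closure_interior (affineIndependent_lat hε q)) ⟨x, hxu, hq⟩
  by_contra hne
  push Not at hne
  have key (r : Site × Equiv.Perm (Fin 3)) (hr : q ≠ r) :
      Disjoint (interior (hull ε (lat q))) (hull ε (lat r)) := by
    rw [Set.disjoint_iff_inter_eq_empty, ← Set.not_nonempty_iff_eq_empty]
    intro h
    obtain ⟨z, hz, hz'⟩ := inter_interior_nonempty isOpen_interior
      (hull_subset_closure_interior (affineIndependent_lat hε r)) h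
    exact Set.disjoint_left.1 (disjoint_interior_lat hε hr) hz hz'
  obtain ⟨z, hzu, hz⟩ := h1
  rcases hu z hzu with h | h
  · exact Set.disjoint_left.1 (key p hne.1) hz h
  · exact Set.disjoint_left.1 (key _ hne.2) hz h

theorem neighbor_ne (hε : ε ≠ 0) (p : Site × Equiv.Perm (Fin 3)) (i : Fin 4) :
    (neighbor p i).1 ≠ p := by
  intro h
  obtain ⟨z, hz⟩ := interior_hull_nonempty (affineIndependent_lat hε p)
  have h1 := mem_interior_hull_lat hε |>.1 hz
  have h2 := bary_neighbor (ε := ε) p i z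
  rw [h] at h2
  have := h1 i
  have := h1 (neighbor p i).2
  linarith

end BondVolume

namespace BondVolume
open MeasureTheory Set Filter Topology
open scoped NNReal

namespace Geometry

/-! ### The two regions -/

variable {G : Geometry} {R : Finset Site}

theorem IsAdmissible.ε_pos (hG : G.IsAdmissible R) : 0 < G.ε :=
  one_div_pos.2 (by exact_mod_cast hG.k_pos)

theorem ε_mul_k (hG : G.IsAdmissible R) : G.ε * G.k = 1 := by
  have : (G.k : ℝ) ≠ 0 := by exact_mod_cast hG.k_pos.ne'
  rw [ε]; field_simp

theorem mem_latticeTets {T : Tet} :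
    T ∈ G.latticeTets ↔ ∃ p : Site × Equiv.Perm (Fin 3), p.1 ∈ G.periodSites ∧ lat p = T := by
  simp [latticeTets, typeA, lat]

theorem lat_mem_latticeTets {p : Site × Equiv.Perm (Fin 3)} :
    lat p ∈ G.latticeTets ↔ p.1 ∈ G.periodSites := by
  rw [mem_latticeTets]
  constructor
  · rintro ⟨q, hq, h⟩
    rwa [← lat_injective h]
  · exact fun h => ⟨p, h, rfl⟩

/-- The union of a set of tetrahedra. -/
def union (G : Geometry) (S : Finset Tet) : Set Space := ⋃ T ∈ S, hull G.ε T

theorem isClosed_union (S : Finset Tet) : IsClosed (G.union S) :=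
  S.finite_toSet.isClosed_biUnion fun _ _ => isClosed_hull _

theorem mem_union {S : Finset Tet} {x : Space} : x ∈ G.union S ↔ ∃ T ∈ S, x ∈ hull G.ε T := by
  simp [union]

theorem hull_subset_union {S : Finset Tet} {T : Tet} (h : T ∈ S) : hull G.ε T ⊆ G.union S :=
  fun _ hx => mem_union.2 ⟨T, h, hx⟩

theorem region_eq (S : Finset Tet) : G.region S = interior (G.union S) := by
  rw [region, ← union, (isClosed_union S).closure_eq]

theorem closure_region (hε : G.ε ≠ 0) {S : Finset Tet} (hS : S ⊆ G.latticeTets) :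
    closure (G.region S) = G.union S := by
  rw [region_eq]
  apply Subset.antisymm
  · exact closure_minimal interior_subset (isClosed_union S)
  · intro x hx
    obtain ⟨T, hT, hxT⟩ := mem_union.1 hx
    obtain ⟨p, -, rfl⟩ := mem_latticeTets.1 (hS hT)
    exact closure_mono (interior_mono (hull_subset_union hT))
      (hull_subset_closure_interior (affineIndependent_lat hε p) hxT)

/-- A common point could be moved into the interior of a tetrahedron of `S'` and from there into the
interior of one of `S`, so that two different lattice tetrahedra would have overlapping interiors.
-/
theorem disjoint_interior_union (hε : G.ε ≠ 0) {S S' : Finset Tet} (hS : S ⊆ G.latticeTets)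
    (hS' : S' ⊆ G.latticeTets) (h : Disjoint S S') :
    Disjoint (interior (G.union S)) (G.union S') := by
  rw [Set.disjoint_left]
  intro x hx hx'
  obtain ⟨T', hT', hxT'⟩ := mem_union.1 hx'
  obtain ⟨p, -, rfl⟩ := mem_latticeTets.1 (hS' hT')
  obtain ⟨z, hz, hzp⟩ := inter_interior_nonempty isOpen_interior
    (hull_subset_closure_interior (affineIndependent_lat hε p)) ⟨x, hx, hxT'⟩
  obtain ⟨T, hT, hzT⟩ := mem_union.1 (interior_subset hz)
  obtain ⟨q, -, rfl⟩ := mem_latticeTets.1 (hS hT)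
  obtain ⟨w, hw, hwq⟩ := inter_interior_nonempty isOpen_interior
    (hull_subset_closure_interior (affineIndependent_lat hε q)) ⟨z, hzp, hzT⟩
  have hpq : p ≠ q := by
    rintro rfl
    exact Finset.disjoint_left.1 h hT hT'
  exact Set.disjoint_left.1 (disjoint_interior_lat hε hpq) hw hwq

theorem interior_lat_subset_Ωa {p : Site × Equiv.Perm (Fin 3)} (hp : lat p ∈ G.atomistic) :
    interior (hull G.ε (lat p)) ⊆ G.Ωa := by
  rw [Ωa, region_eq]
  exact interior_mono (hull_subset_union hp)

theorem interior_domain (G : Geometry) : interior G.domain =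
    {x : Space | ∀ i, -(G.M i : ℝ) + 1 < x i ∧ x i < G.M i} := by
  let e := (PiLp.homeomorph 2 (fun _ : Fin 3 => ℝ))
  have h : G.domain = e ⁻¹' (Set.pi univ fun i => Icc (-(G.M i : ℝ) + 1) (G.M i : ℝ)) := by
    ext x; simp only [domain, mem_preimage, mem_univ_pi, mem_ofPred_eq]; rfl
  rw [h, ← e.preimage_interior, interior_pi_set finite_univ]
  ext x
  simp [e]
  rfl

variable (hG : G.IsAdmissible R)
include hG

theorem closure_Ωa : closure G.Ωa = G.union G.atomistic :=
  closure_region hG.ε_pos.ne' hG.atomistic_subset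

theorem closure_Ωstar : closure G.Ωstar = G.union G.continuum :=
  closure_region hG.ε_pos.ne' Finset.sdiff_subset

theorem Γ_eq : G.Γ = G.union G.atomistic ∩ G.union G.continuum := by
  rw [Γ, closure_Ωa hG, closure_Ωstar hG]

theorem disjoint_Ωa : Disjoint G.Ωa (G.union G.continuum) := by
  rw [Ωa, region_eq]
  exact disjoint_interior_union hG.ε_pos.ne' hG.atomistic_subset Finset.sdiff_subset
    Finset.disjoint_sdiff

theorem disjoint_Ωa_Γ : Disjoint G.Ωa G.Γ := by
  rw [Γ_eq hG]
  exact (disjoint_Ωa hG).mono_right inter_subset_right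

theorem mem_periodSites {m : Site} {x : Space} (hx : x ∈ interior G.domain)
    (h1 : ∀ i, (m i : ℝ) ≤ x i / G.ε) (h2 : ∀ i, x i / G.ε < m i + 1) : m ∈ G.periodSites := by
  rw [interior_domain] at hx
  have hε := hG.ε_pos
  have hk := ε_mul_k hG
  rw [periodSites, Fintype.mem_piFinset]
  intro i
  obtain ⟨ha, hb⟩ := hx i
  have g1 := h1 i
  have g2 := h2 i
  have hxk : x i / G.ε = x i * G.k := by
    rw [div_eq_iff hε.ne', mul_assoc, mul_comm (G.k : ℝ), hk, mul_one]
  have hk' : (0 : ℝ) < G.k := by exact_mod_cast hG.k_pos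
  rw [hxk] at g1 g2
  rw [Finset.mem_Ico]
  constructor
  -- The lower bound is an integer strictly below `m i + 1`, hence at most `m i`; strictness comes
  -- from `x i / ε < m i + 1`.
  · apply Int.lt_add_one_iff.1
    have : (-(G.M i : ℝ) + 1) * G.k < m i + 1 := by nlinarith
    exact_mod_cast this
  · have : (m i : ℝ) < G.M i * G.k := by nlinarith
    exact_mod_cast this

theorem interior_domain_subset :
    interior G.domain ⊆ G.union G.atomistic ∪ G.union G.continuum := by
  intro x hx
  set m : Site := fun i => ⌊x i / G.ε⌋ with hm
  have hmp : m ∈ G.periodSites := mem_periodSites hG hx (fun i => Int.floor_le _)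
    fun i => Int.lt_floor_add_one _
  have hc : x ∈ closure (bondVolume G.ε (fun _ => 1) m) := by
    rw [mem_closure_bondVolume_iff hG.ε_pos one_site_ne_zero]
    intro i
    rw [boxCoord_one]
    have h1 := Int.floor_le (x i / G.ε)
    have h2 := Int.lt_floor_add_one (x i / G.ε)
    constructor <;> simp only [hm] <;> linarith
  rw [← iUnion_hull_typeA hG.ε_pos one_site_ne_zero, mem_iUnion] at hc
  obtain ⟨σ, hσ⟩ := hc
  have hl : lat (m, σ) ∈ G.latticeTets := lat_mem_latticeTets.2 hmp
  by_cases ha : lat (m, σ) ∈ G.atomistic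
  · exact Or.inl (hull_subset_union ha hσ)
  · exact Or.inr (hull_subset_union (Finset.mem_sdiff.2 ⟨hl, ha⟩) hσ)

theorem floor_of_mem_interior_lat {p : Site × Equiv.Perm (Fin 3)} {x : Space}
    (hx : x ∈ interior (hull G.ε (lat p))) (i : Fin 3) :
    (p.1 i : ℝ) < x i / G.ε ∧ x i / G.ε < p.1 i + 1 := by
  rw [mem_interior_hull_lat hG.ε_pos.ne', bary, boxBary_pos_iff] at hx
  have : 0 < boxCoord G.ε (fun _ => 1) p.1 x i ∧ boxCoord G.ε (fun _ => 1) p.1 x i < 1 := by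
    obtain ⟨k, rfl⟩ := p.2.surjective i
    obtain ⟨h1, h2, h3, h4⟩ := hx
    fin_cases k <;> constructor <;> simp <;> linarith
  rw [boxCoord_one] at this
  constructor <;> linarith

/-- All neighbours of the tetrahedra in the atomistic region are contained in the domain. -/
theorem neighbor_mem_latticeTets {p : Site × Equiv.Perm (Fin 3)} (hp : lat p ∈ G.atomistic)
    (i : Fin 4) : lat (neighbor p i).1 ∈ G.latticeTets := by
  have hε := hG.ε_pos.ne'
  obtain ⟨x, hx⟩ := openFace_nonempty hε p i
  have hxd : x ∈ interior G.domain := hG.closure_subset (by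
    rw [closure_Ωa hG]
    exact hull_subset_union hp (openFace_subset_hull hε p i hx))
  -- A short move from the centre of the face towards `y` leads into the interior of the neighbour
  -- without leaving the interior of `Ω`. Rounding such a point gives the lower corner of the
  -- neighbour's cell.
  obtain ⟨y, hy⟩ := interior_hull_nonempty (affineIndependent_lat hε (neighbor p i).1)
  have h1 := eventually_lineMap y (isOpen_interior.mem_nhds hxd)
  have h2 := eventually_lineMap y (eventually_mem_interior_neighbor hε hx)
  obtain ⟨s, ⟨hs1, hs2⟩, hs0⟩ := ((h1.and h2).and self_mem_nhdsWithin).exists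
  have hneg : bary G.ε p (AffineMap.lineMap x y s) i < 0 := by
    rw [bary_lineMap hε, hx.1]
    have := (mem_interior_hull_lat hε).1 hy (neighbor p i).2
    rw [bary_neighbor] at this
    have hs0 : (0 : ℝ) < s := hs0
    nlinarith
  have h3 := floor_of_mem_interior_lat hG (hs2 hneg)
  exact lat_mem_latticeTets.2 (mem_periodSites hG hs1 (fun i => (h3 i).1.le) fun i => (h3 i).2)

theorem neighbor_mem_continuum {p : Site × Equiv.Perm (Fin 3)} (hp : lat p ∈ G.atomistic)
    {i : Fin 4} (h : lat (neighbor p i).1 ∉ G.atomistic) :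
    lat (neighbor p i).1 ∈ G.continuum :=
  Finset.mem_sdiff.2 ⟨neighbor_mem_latticeTets hG hp i, h⟩

theorem openFace_subset_Ωa {p : Site × Equiv.Perm (Fin 3)} (hp : lat p ∈ G.atomistic)
    {i : Fin 4} (h : lat (neighbor p i).1 ∈ G.atomistic) : openFace G.ε p i ⊆ G.Ωa := by
  intro x hx
  rw [Ωa, region_eq, mem_interior_iff_mem_nhds]
  filter_upwards [eventually_mem_hull_or hG.ε_pos.ne' hx] with z hz
  rcases hz with hz | hz
  · exact hull_subset_union hp hz
  · exact hull_subset_union h hz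

theorem interior_lat_meets_B {η l : Site} {p : Site × Equiv.Perm (Fin 3)}
    (hp : hull G.ε (lat p) ⊆ closure (G.B η l)) : (G.B η l ∩ hull G.ε (lat p)).Nonempty := by
  obtain ⟨y, hy⟩ := interior_hull_nonempty (affineIndependent_lat hG.ε_pos.ne' p)
  obtain ⟨z, hz, hzB⟩ := mem_closure_iff.1 (hp (interior_subset hy)) _ isOpen_interior hy
  exact ⟨z, hzB, interior_subset hz⟩

theorem closure_B_subset_domain {η l : Site} (hη : η ∈ R) {p : Site × Equiv.Perm (Fin 3)}
    (hpa : lat p ∈ G.atomistic) (hp : hull G.ε (lat p) ⊆ closure (G.B η l)) :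
    closure (G.B η l) ⊆ interior G.domain := by
  obtain ⟨z, hzB, hz⟩ := interior_lat_meets_B hG hp
  refine hG.distance η hη l ⟨z, subset_closure hzB, ?_⟩
  rw [closure_Ωa hG]
  exact hull_subset_union hpa hz

/-- A bond volume with a part in the atomistic region is of atomistic type or belongs to the
interface. -/
theorem isAtomistic_or_isInterfacial {η l : Site} (hη : η ∈ R)
    {p : Site × Equiv.Perm (Fin 3)} (hpa : lat p ∈ G.atomistic)
    (hp : hull G.ε (lat p) ⊆ closure (G.B η l)) : G.IsAtomistic η l ∨ G.IsInterfacial η l := by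
  by_cases h1 : (G.B η l ∩ G.Γ).Nonempty
  · exact Or.inr (Or.inl h1)
  have hdom := closure_B_subset_domain hG hη hpa hp
  have hcov := hdom.trans (interior_domain_subset hG)
  obtain ⟨z, hzB, hz⟩ := interior_lat_meets_B hG hp
  -- The open box is connected and covered by two closed sets. If it met both, it would meet their
  -- intersection `Γ`.
  have h2 : ¬ (G.B η l ∩ G.union G.continuum).Nonempty := by
    intro h
    have := isPreconnected_closed_iff.1 (convex_bondVolume (ε := G.ε) (η := η) (l := l)).isPreconnected
      _ _ (isClosed_union _) (isClosed_union _) (subset_closure.trans hcov)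
      ⟨z, hzB, hull_subset_union hpa hz⟩ h
    rw [← Γ_eq hG] at this
    exact h1 this
  have h3 : G.B η l ⊆ G.union G.atomistic := fun x hx =>
    (hcov (subset_closure hx)).resolve_right fun h => h2 ⟨x, hx, h⟩
  by_cases h4 : (closure (G.B η l) ∩ G.Γ).Nonempty
  · refine Or.inr (Or.inr ⟨?_, h4⟩)
    rw [Ωa, region_eq]
    exact interior_maximal h3 isOpen_bondVolume
  · refine Or.inl fun x hx => ?_
    have hxa : x ∈ G.union G.atomistic := closure_minimal h3 (isClosed_union _) hx
    have hxs : x ∉ G.union G.continuum := fun h => h4 ⟨x, hx, by rw [Γ_eq hG]; exact ⟨hxa, h⟩⟩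
    rw [Ωa, region_eq, mem_interior_iff_mem_nhds]
    filter_upwards [isOpen_interior.mem_nhds (hdom hx),
      (isClosed_union G.continuum).isOpen_compl.mem_nhds hxs] with w h5 h6
    exact (interior_domain_subset hG h5).resolve_right h6

theorem not_isAtomistic_of_isInterfacial {η l : Site} (h : G.IsInterfacial η l) :
    ¬ G.IsAtomistic η l := by
  intro ha
  have hd := Set.disjoint_left.1 (disjoint_Ωa_Γ hG)
  rcases h with ⟨x, hx, hx'⟩ | ⟨-, x, hx, hx'⟩
  · exact hd (ha (subset_closure hx)) hx'
  · exact hd (ha hx) hx'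

theorem pos_mem_closure_B {η : Site} (l : Site) (hη : ∀ i, η i ≠ 0) :
    pos G.ε l ∈ closure (G.B η l) := by
  rw [B, mem_closure_bondVolume_iff hG.ε_pos hη]
  intro i
  have : boxCoord G.ε η l (pos G.ε l) i = 0 := by
    have := hG.ε_pos.ne'
    rw [boxCoord, pos_apply]
    field_simp
    simp
  rw [this]
  simp

theorem mem_sites_of_closure_B_subset {η l : Site} (hη : ∀ i, η i ≠ 0)
    (h : closure (G.B η l) ⊆ interior G.domain) : l ∈ G.sites := by
  have hp := h (pos_mem_closure_B hG l hη)
  rw [interior_domain] at hp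
  rw [sites, Fintype.mem_piFinset]
  intro i
  obtain ⟨h1, h2⟩ := hp i
  rw [pos_apply] at h1 h2
  have hk := ε_mul_k hG
  have hk' : (0 : ℝ) < G.k := by exact_mod_cast hG.k_pos
  have e : G.ε * l i * G.k = l i := by rw [mul_right_comm, hk, one_mul]
  rw [Finset.mem_Icc]
  constructor
  · have : (-(G.M i : ℝ) + 1) * G.k ≤ l i := by nlinarith
    exact_mod_cast this
  · have : (l i : ℝ) ≤ G.M i * G.k := by nlinarith
    exact_mod_cast this

end Geometry
end BondVolume

namespace BondVolume
open MeasureTheory Set Filter Topology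
open scoped NNReal

/-! ### Gluing affine functions -/

/-- A local bound for the increments at every point, with one constant, integrates along segments in
the convex set. -/
theorem lipschitzOnWith_of_eventually {U : Set Space} (hU : Convex ℝ U) {f : Space → ℝ} {C : ℝ≥0}
    (hf : ∀ x ∈ U, ∀ᶠ z in 𝓝[U] x, |f z - f x| ≤ C * ‖z - x‖) : LipschitzOnWith C f U := by
  have key : ∀ x ∈ U, ∀ y ∈ U, f y - f x ≤ C * ‖y - x‖ := by
    intro x hx y hy
    set γ : ℝ → Space := fun t => AffineMap.lineMap x y t with hγ
    have hγc : Continuous γ := AffineMap.lineMap_continuous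
    have hγU : ∀ t ∈ Icc (0 : ℝ) 1, γ t ∈ U := fun t ht => hU.lineMap_mem hx hy ht
    have hnorm : ∀ s t, ‖γ s - γ t‖ = |s - t| * ‖y - x‖ := by
      intro s t
      simp only [hγ, AffineMap.lineMap_apply, vsub_eq_sub, vadd_eq_add]
      rw [add_sub_add_right_eq_sub, ← sub_smul, norm_smul, Real.norm_eq_abs]
    have hloc : ∀ t ∈ Icc (0 : ℝ) 1, ∀ᶠ s in 𝓝[Icc 0 1] t,
        |f (γ s) - f (γ t)| ≤ C * ‖y - x‖ * |s - t| := by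
      intro t ht
      have : Tendsto γ (𝓝[Icc 0 1] t) (𝓝[U] (γ t)) :=
        tendsto_nhdsWithin_of_tendsto_nhds_of_eventually_within _
          (hγc.continuousAt.mono_left nhdsWithin_le_nhds)
          (eventually_mem_nhdsWithin.mono fun s hs => hγU s hs)
      filter_upwards [this.eventually (hf _ (hγU t ht))] with s hs
      rw [hnorm] at hs
      linarith
    have hcont : ContinuousOn (fun t => f (γ t)) (Icc 0 1) := by
      intro t ht
      rw [ContinuousWithinAt, tendsto_iff_dist_tendsto_zero]
      refine squeeze_zero' (Eventually.of_forall fun _ => dist_nonneg)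
        (g := fun s => C * ‖y - x‖ * |s - t|) ?_ ?_
      · filter_upwards [hloc t ht] with s hs
        rwa [Real.dist_eq]
      · have : Continuous fun s : ℝ => C * ‖y - x‖ * |s - t| := by fun_prop
        have := (this.tendsto t).mono_left (nhdsWithin_le_nhds (s := Icc 0 1))
        simpa using this
    -- Comparison of `f` along the segment with the affine function of slope `C * ‖y - x‖`; only
    -- upper bounds for right slopes are needed, no differentiability.
    have := image_le_of_liminf_slope_right_le_deriv_boundary hcont
      (B := fun t => f x + C * ‖y - x‖ * t) (B' := fun _ => C * ‖y - x‖)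
      (by simp [hγ]) (by fun_prop)
      (fun t _ => by
        simpa using (((hasDerivAt_id t).const_mul (C * ‖y - x‖)).const_add (f x)).hasDerivWithinAt)
      (by
        intro t ht r hr
        have h1 : ∀ᶠ s in 𝓝[>] t, |f (γ s) - f (γ t)| ≤ C * ‖y - x‖ * |s - t| := by
          have := (hloc t ⟨ht.1, ht.2.le⟩)
          exact this.filter_mono (nhdsWithin_le_of_mem (Icc_mem_nhdsGT_of_mem ht))
        refine Eventually.frequently ?_
        filter_upwards [h1, self_mem_nhdsWithin] with s hs hst
        have hst : t < s := hst
        have hpos : 0 < s - t := sub_pos.2 hst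
        rw [slope_def_field, div_lt_iff₀ hpos]
        have h2 := (le_abs_self _).trans hs
        rw [abs_of_pos hpos] at h2
        nlinarith)
      (right_mem_Icc.2 zero_le_one)
    simp [hγ] at this
    linarith
  refine LipschitzOnWith.of_dist_le_mul fun x hx y hy => ?_
  rw [Real.dist_eq, dist_eq_norm, abs_le]
  have h1 := key x hx y hy
  have h2 := key y hy x hx
  rw [norm_sub_rev] at h1
  constructor <;> linarith

theorem exists_affine_bound (a : Space →ᵃ[ℝ] ℝ) : ∃ K : ℝ≥0, ∀ x y, |a y - a x| ≤ K * ‖y - x‖ := by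
  refine ⟨‖LinearMap.toContinuousLinearMap a.linear‖₊, fun x y => ?_⟩
  have h : a y - a x = LinearMap.toContinuousLinearMap a.linear (y - x) := by
    simpa using (a.linearMap_vsub y x).symm
  rw [h, ← Real.norm_eq_abs]
  exact ContinuousLinearMap.le_opNorm _ _

/-- Affine functions that are given on closed sets and agree on the intersections can be glued to
a Lipschitz function on a convex set. -/
theorem exists_lipschitz_glue {ι : Type*} (s : Finset ι) (C : ι → Set Space)
    (hC : ∀ i, IsClosed (C i)) (a : ι → Space →ᵃ[ℝ] ℝ) {U : Set Space} (hU : Convex ℝ U)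
    (hcov : ∀ x ∈ U, ∃ i ∈ s, x ∈ C i)
    (hagree : ∀ x ∈ U, ∀ i ∈ s, ∀ j ∈ s, x ∈ C i → x ∈ C j → a i x = a j x) :
    ∃ h : Space → ℝ, (∃ K, LipschitzWith K h) ∧ ∀ x ∈ U, ∀ i ∈ s, x ∈ C i → h x = a i x := by
  classical
  rcases U.eq_empty_or_nonempty with rfl | ⟨x₀, hx₀⟩
  · exact ⟨0, ⟨0, LipschitzWith.const 0⟩, by simp⟩
  have : Nonempty ι := ⟨(hcov x₀ hx₀).choose⟩
  choose! c hc hc' using hcov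
  choose K hK using fun i => exists_affine_bound (a i)
  have hf : ∀ x ∈ U, ∀ i ∈ s, x ∈ C i → a (c x) x = a i x := fun x hx i hi hxi =>
    hagree x hx _ (hc x hx) i hi (hc' x hx) hxi
  -- The sum of the constants serves as a common bound for them. Since the sets are closed and
  -- finitely many, every set that contains a point near `x` also contains `x`, so both values can
  -- be computed with the same affine function.
  have hL : LipschitzOnWith (∑ i ∈ s, K i) (fun x => a (c x) x) U := by
    refine lipschitzOnWith_of_eventually hU fun x hx => ?_
    have h1 : ∀ᶠ z in 𝓝[U] x, ∀ i ∈ s, z ∈ C i → x ∈ C i := by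
      refine nhdsWithin_le_nhds ((Finset.eventually_all s).2 fun i _ => ?_)
      by_cases h : x ∈ C i
      · exact Eventually.of_forall fun _ _ => h
      · filter_upwards [(hC i).isOpen_compl.mem_nhds h] with z hz hz'
        exact absurd hz' hz
    filter_upwards [h1, self_mem_nhdsWithin] with z hz hzU
    have hxi := hz _ (hc z hzU) (hc' z hzU)
    rw [hf x hx _ (hc z hzU) hxi]
    refine (hK _ _ _).trans ?_
    gcongr
    exact_mod_cast Finset.single_le_sum (f := K) (fun i _ => zero_le) (hc z hzU)
  obtain ⟨h, hh, heq⟩ := hL.extend_real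
  exact ⟨h, ⟨_, hh⟩, fun x hx i hi hxi => by rw [← heq hx]; exact hf x hx i hi hxi⟩

namespace Geometry

/-! ### The decompositions of the bond volumes -/

variable {G : Geometry} {R : Finset Site} {η : Site} {𝒯 : Site → Finset Tet} {l : Site}

theorem Conforming.symm {T T' : Tet} (h : G.Conforming T T') : G.Conforming T' T := by
  unfold Conforming at *
  rwa [inter_comm, inter_comm (range T')]

variable (hG : G.IsAdmissible R) (hη : ∀ i, η i ≠ 0) (hM : G.IsInterfaceMesh η 𝒯)

theorem bondMesh_of_isAtomistic (h : G.IsAtomistic η l) : G.bondMesh η 𝒯 l = typeA η l := if_pos h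

include hG in
theorem bondMesh_of_isInterfacial (h : G.IsInterfacial η l) : G.bondMesh η 𝒯 l = 𝒯 l :=
  if_neg (not_isAtomistic_of_isInterfacial hG h)

include hG hη hM

theorem bondMesh_nondegenerate (hl : G.IsAtomistic η l ∨ G.IsInterfacial η l) {T : Tet}
    (hT : T ∈ G.bondMesh η 𝒯 l) : AffineIndependent ℝ (fun j => pos G.ε (T j)) := by
  rcases hl with hl | hl
  · rw [bondMesh_of_isAtomistic hl, typeA] at hT
    obtain ⟨σ, -, rfl⟩ := Finset.mem_image.1 hT
    exact affineIndependent_typeA hG.ε_pos.ne' hη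
  · rw [bondMesh_of_isInterfacial hG hl] at hT
    exact hM.nondegenerate l hl T hT

theorem bondMesh_cover (hl : G.IsAtomistic η l ∨ G.IsInterfacial η l) :
    ⋃ T ∈ G.bondMesh η 𝒯 l, hull G.ε T = closure (G.B η l) := by
  rcases hl with hl | hl
  · rw [bondMesh_of_isAtomistic hl, typeA, B, ← iUnion_hull_typeA hG.ε_pos hη]
    simp
  · rw [bondMesh_of_isInterfacial hG hl]
    exact hM.cover l hl

theorem bondMesh_disjoint (hl : G.IsAtomistic η l ∨ G.IsInterfacial η l) {T T' : Tet}
    (hT : T ∈ G.bondMesh η 𝒯 l) (hT' : T' ∈ G.bondMesh η 𝒯 l) (hne : T ≠ T') :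
    Disjoint (interior (hull G.ε T)) (interior (hull G.ε T')) := by
  rcases hl with hl | hl
  · rw [bondMesh_of_isAtomistic hl, typeA] at hT hT'
    obtain ⟨σ, -, rfl⟩ := Finset.mem_image.1 hT
    obtain ⟨τ, -, rfl⟩ := Finset.mem_image.1 hT'
    exact disjoint_interior_typeA hG.ε_pos.ne' hη fun h => hne (by rw [h])
  · rw [bondMesh_of_isInterfacial hG hl] at hT hT'
    exact hM.disjoint l hl T hT T' hT' hne

theorem bondMesh_one_side (hl : G.IsAtomistic η l ∨ G.IsInterfacial η l) {T : Tet}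
    (hT : T ∈ G.bondMesh η 𝒯 l) :
    hull G.ε T ⊆ closure G.Ωa ∨ hull G.ε T ⊆ closure G.Ωstar := by
  rcases hl with hl | hl
  · refine Or.inl ?_
    have : hull G.ε T ⊆ closure (G.B η l) := by
      rw [← bondMesh_cover hG hη hM (Or.inl hl)]
      exact subset_biUnion_of_mem (u := fun T => hull G.ε T) hT
    exact this.trans (hl.trans subset_closure)
  · rw [bondMesh_of_isInterfacial hG hl] at hT
    exact hM.one_side l hl T hT

theorem bondMesh_conforming (hl : G.IsAtomistic η l ∨ G.IsInterfacial η l) {T T' : Tet}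
    (hT : T ∈ G.bondMesh η 𝒯 l) (hT' : T' ∈ G.bondMesh η 𝒯 l) : G.Conforming T T' := by
  rcases hl with hl | hl
  · rw [bondMesh_of_isAtomistic hl, typeA] at hT hT'
    obtain ⟨σ, -, rfl⟩ := Finset.mem_image.1 hT
    obtain ⟨τ, -, rfl⟩ := Finset.mem_image.1 hT'
    exact sdiff_subset.trans (typeA_inter_subset hG.ε_pos.ne' hη)
  · rw [bondMesh_of_isInterfacial hG hl] at hT hT'
    exact hM.conforming l hl T hT T' hT'

omit hG hη hM in
theorem mem_atomisticElements {𝒮 : Finset Tet} {S : Tet} :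
    S ∈ G.atomisticElements 𝒮 ↔ S ∈ 𝒮 ∧ hull G.ε S ⊆ closure G.Ωa := by
  simp [atomisticElements]

/-- The points of the bond volume in `Ω_a` are covered by the elements in `Ω_a`. -/
theorem exists_element (hl : G.IsAtomistic η l ∨ G.IsInterfacial η l) {x : Space}
    (hx : x ∈ closure (G.B η l)) (hxa : x ∈ G.Ωa) :
    ∃ S ∈ G.atomisticElements (G.bondMesh η 𝒯 l), x ∈ hull G.ε S := by
  rw [← bondMesh_cover hG hη hM hl] at hx
  simp only [mem_iUnion, exists_prop] at hx
  obtain ⟨S, hS, hxS⟩ := hx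
  refine ⟨S, mem_atomisticElements.2 ⟨hS, ?_⟩, hxS⟩
  refine (bondMesh_one_side hG hη hM hl hS).resolve_right fun h => ?_
  have := h hxS
  rw [closure_Ωstar hG] at this
  exact Set.disjoint_left.1 (disjoint_Ωa hG) hxa this

end Geometry
end BondVolume

/-! ### Traces of the interpolants on lattice tetrahedra -/

namespace BondVolume
open MeasureTheory Set Filter Topology
open scoped NNReal

/-- A linear functional applied to the affine interpolant. -/
noncomputable def scalarInterp (ε : ℝ) (g : Space →L[ℝ] ℝ) (v : Site → Space) (S : Tet) :
    Space →ᵃ[ℝ] ℝ := g.toLinearMap.toAffineMap.comp (interp ε S v)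

theorem scalarInterp_apply (ε : ℝ) (g : Space →L[ℝ] ℝ) (v : Site → Space) (S : Tet) (x : Space) :
    scalarInterp ε g v S x = g (interp ε S v x) := rfl

theorem scalarInterp_linear (ε : ℝ) (g : Space →L[ℝ] ℝ) (v : Site → Space) (S : Tet) (w : Space) :
    (scalarInterp ε g v S).linear w = g ((interp ε S v).linear w) := rfl

theorem hasFDerivAt_affine (a : Space →ᵃ[ℝ] ℝ) (x : Space) :
    HasFDerivAt a (LinearMap.toContinuousLinearMap a.linear) x := by
  have h : (a : Space → ℝ) = fun z => LinearMap.toContinuousLinearMap a.linear z + a 0 := by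
    funext z
    simpa using congrFun a.decomp z
  rw [h]
  exact (LinearMap.toContinuousLinearMap a.linear).hasFDerivAt.add_const _

namespace Geometry

variable {G : Geometry} {R : Finset Site} {η : Site} {𝒯 : Site → Finset Tet} {l : Site}
  {g : Space →L[ℝ] ℝ} {v : Site → Space} {p : Site × Equiv.Perm (Fin 3)} {h : Space → ℝ}

/-- `h` is a Lipschitz function which coincides on the interior of the lattice tetrahedron `p`
with the piecewise affine interpolant on the bond volume of `l`. -/
def IsTrace (G : Geometry) (η : Site) (𝒯 : Site → Finset Tet) (g : Space →L[ℝ] ℝ)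
    (v : Site → Space) (l : Site) (p : Site × Equiv.Perm (Fin 3)) (h : Space → ℝ) : Prop :=
  (∃ K, LipschitzWith K h) ∧ ∀ x ∈ interior (hull G.ε (lat p)),
    ∀ S ∈ G.atomisticElements (G.bondMesh η 𝒯 l), x ∈ hull G.ε S → h x = scalarInterp G.ε g v S x

variable (hG : G.IsAdmissible R) (hη : ∀ i, η i ≠ 0) (hM : G.IsInterfaceMesh η 𝒯)
  (hl : G.IsAtomistic η l ∨ G.IsInterfacial η l)

include hG hη hM

/-- Points of `Ω_a` do not lie on `Γ`, so conformity puts a common point of the elements into the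
hull of their common vertices. -/
theorem scalarInterp_eq_of_conforming {l' : Site} (hl : G.IsAtomistic η l ∨ G.IsInterfacial η l)
    (hl' : G.IsAtomistic η l' ∨ G.IsInterfacial η l') {S S' : Tet}
    (hS : S ∈ G.bondMesh η 𝒯 l) (hS' : S' ∈ G.bondMesh η 𝒯 l') (hc : G.Conforming S S')
    {x : Space} (hx : x ∈ hull G.ε S) (hx' : x ∈ hull G.ε S') (hxa : x ∈ G.Ωa) :
    scalarInterp G.ε g v S x = scalarInterp G.ε g v S' x := by
  rw [scalarInterp_apply, scalarInterp_apply, interp_eq_of_mem_common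
    (bondMesh_nondegenerate hG hη hM hl hS) (bondMesh_nondegenerate hG hη hM hl' hS') v
    (hc ⟨⟨hx, hx'⟩, Set.disjoint_left.1 (disjoint_Ωa_Γ hG) hxa⟩)]

include hl

/-- Gluing takes place on the open tetrahedron: it is convex and contained in `Ω_a`, hence away from
`Γ`, where hanging nodes could make the interpolant multivalued. -/
theorem exists_isTrace (hp : lat p ∈ G.atomistic) (hpB : hull G.ε (lat p) ⊆ closure (G.B η l)) :
    ∃ h, IsTrace G η 𝒯 g v l p h := by
  have hsub := interior_lat_subset_Ωa hp
  obtain ⟨h, hK, hh⟩ := exists_lipschitz_glue (G.atomisticElements (G.bondMesh η 𝒯 l))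
    (fun S => hull G.ε S) (fun S => isClosed_hull S) (fun S => scalarInterp G.ε g v S)
    (U := interior (hull G.ε (lat p))) (convex_hull _).interior
    (fun x hx => exists_element hG hη hM hl (hpB (interior_subset hx)) (hsub hx))
    (fun x hx S hS S' hS' hxS hxS' => by
      rw [mem_atomisticElements] at hS hS'
      exact scalarInterp_eq_of_conforming hG hη hM hl hl hS.1 hS'.1
        (bondMesh_conforming hG hη hM hl hS.1 hS'.1) hxS hxS' (hsub hx))
  exact ⟨h, hK, hh⟩

/-- Up to the boundary, a trace takes the values of an element. -/
theorem IsTrace.exists_eq (hh : IsTrace G η 𝒯 g v l p h) (hp : lat p ∈ G.atomistic)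
    (hpB : hull G.ε (lat p) ⊆ closure (G.B η l)) {x : Space} (hx : x ∈ hull G.ε (lat p)) :
    ∃ S ∈ G.atomisticElements (G.bondMesh η 𝒯 l), x ∈ hull G.ε S ∧
      h x = scalarInterp G.ε g v S x := by
  obtain ⟨⟨K, hK⟩, hh⟩ := hh
  -- The points where the claim holds form a closed set, as there are finitely many elements. It
  -- contains the interior of the tetrahedron, hence its closure.
  let C : Set Space := ⋃ S ∈ G.atomisticElements (G.bondMesh η 𝒯 l),
    hull G.ε S ∩ {z | h z = scalarInterp G.ε g v S z}
  have hC : IsClosed C := Set.Finite.isClosed_biUnion (Finset.finite_toSet _) fun S _ =>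
    (isClosed_hull S).inter (isClosed_eq hK.continuous
      (scalarInterp G.ε g v S).continuous_of_finiteDimensional)
  have hsub : interior (hull G.ε (lat p)) ⊆ C := by
    intro z hz
    obtain ⟨S, hS, hzS⟩ := exists_element hG hη hM hl (hpB (interior_subset hz))
      (interior_lat_subset_Ωa hp hz)
    exact mem_biUnion hS ⟨hzS, hh z hz S hS hzS⟩
  have := closure_minimal hsub hC
    (hull_subset_closure_interior (affineIndependent_lat hG.ε_pos.ne' p) hx)
  simp only [C, mem_iUnion, exists_prop] at this
  obtain ⟨S, hS, h1, h2⟩ := this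
  exact ⟨S, hS, h1, h2⟩

/-- Interior points of an element in `Ω_a` that is attached to an interface face. -/
theorem exists_interior_point {i : Fin 4} (hpc : lat (neighbor p i).1 ∈ G.continuum)
    {S : Tet} (hS : S ∈ G.atomisticElements (G.bondMesh η 𝒯 l)) {x : Space}
    (hx : x ∈ openFace G.ε p i) (hxS : x ∈ hull G.ε S) :
    ∃ y ∈ interior (hull G.ε S), 0 < bary G.ε p y i := by
  have hε := hG.ε_pos.ne'
  rw [mem_atomisticElements] at hS
  have hSa : interior (hull G.ε S) ⊆ G.Ωa := by
    rw [Ωa, region_eq, ← closure_Ωa hG]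
    exact interior_mono hS.2
  -- If `y` were on the other side of the face, points of the segment from `x` to `y` close to `x`
  -- would lie both in `Ω_a` and in the neighbour, which belongs to `Ω_*`.
  have hnn : ∀ y ∈ interior (hull G.ε S), 0 ≤ bary G.ε p y i := by
    intro y hy
    by_contra hneg
    push Not at hneg
    obtain ⟨s, hs, hs0, hs1⟩ := ((eventually_lineMap y
      (eventually_mem_interior_neighbor hε hx)).and (Ioo_mem_nhdsGT one_pos)).exists
    have hin : AffineMap.lineMap x y s ∈ interior (hull G.ε S) := by
      have := (convex_hull (ε := G.ε) S).openSegment_self_interior_subset_interior hxS hy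
      exact this ((openSegment_eq_image_lineMap ℝ x y) ▸ ⟨s, ⟨hs0, hs1⟩, rfl⟩)
    have hb : bary G.ε p (AffineMap.lineMap x y s) i < 0 := by
      rw [bary_lineMap hε, hx.1]; nlinarith
    exact Set.disjoint_left.1 (disjoint_Ωa hG) (hSa hin)
      (hull_subset_union hpc (interior_subset (hs hb)))
  obtain ⟨y, hy⟩ := interior_hull_nonempty (bondMesh_nondegenerate hG hη hM hl hS.1)
  -- move away from the plane of the face
  obtain ⟨s, hs, hs0⟩ := ((eventually_lineMap (pos G.ε (lat p i))
    (isOpen_interior.mem_nhds hy)).and (Ioo_mem_nhdsGT one_pos)).exists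
  refine ⟨_, hs, ?_⟩
  rw [bary_lineMap hε, bary_vertex hε, if_pos rfl]
  have := hnn y hy
  nlinarith [hs0.1, hs0.2]

omit hη hM hl in
theorem eventually_lineMap_mem_interior {i : Fin 4}
    {S : Tet} {x y : Space}
    (hx : x ∈ openFace G.ε p i) (hxS : x ∈ hull G.ε S) (hy : y ∈ interior (hull G.ε S))
    (hyp : 0 < bary G.ε p y i) : ∀ᶠ s in 𝓝[>] (0 : ℝ),
      AffineMap.lineMap x y s ∈ interior (hull G.ε S) ∧
      AffineMap.lineMap x y s ∈ interior (hull G.ε (lat p)) := by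
  have hε := hG.ε_pos.ne'
  filter_upwards [eventually_lineMap y (eventually_mem_interior_lat hε hx),
    Ioo_mem_nhdsGT one_pos] with s hs hs01
  constructor
  · have := (convex_hull (ε := G.ε) S).openSegment_self_interior_subset_interior hxS hy
    exact this ((openSegment_eq_image_lineMap ℝ x y) ▸ ⟨s, hs01, rfl⟩)
  · apply hs
    rw [bary_lineMap hε, hx.1]
    nlinarith [hs01.1]

/-- On interface faces, a trace takes the values of all elements. -/
theorem IsTrace.eq_of_mem (hh : IsTrace G η 𝒯 g v l p h) {i : Fin 4}
    (hpc : lat (neighbor p i).1 ∈ G.continuum)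
    {S : Tet} (hS : S ∈ G.atomisticElements (G.bondMesh η 𝒯 l)) {x : Space}
    (hx : x ∈ openFace G.ε p i) (hxS : x ∈ hull G.ε S) : h x = scalarInterp G.ε g v S x := by
  obtain ⟨y, hy, hyp⟩ := exists_interior_point hG hη hM hl hpc hS hx hxS
  obtain ⟨⟨K, hK⟩, hh⟩ := hh
  have h1 := eventually_lineMap_mem_interior hG hx hxS hy hyp
  have hlm : Tendsto (fun s : ℝ => (AffineMap.lineMap x y s : Space)) (𝓝[>] 0) (𝓝 x) := by
    rw [tendsto_def]
    intro s hs
    exact eventually_lineMap y hs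
  have t1 := (hK.continuous.tendsto x).comp hlm
  have t2 := ((scalarInterp G.ε g v S).continuous_of_finiteDimensional.tendsto x).comp hlm
  refine tendsto_nhds_unique (t1.congr' ?_) t2
  filter_upwards [h1] with s hs
  exact hh _ hs.2 S hS (interior_subset hs.1)

end Geometry
end BondVolume

/-! ### Parametrization of faces; almost unique elements on interface faces -/

namespace BondVolume
open MeasureTheory Set Filter Topology
open scoped NNReal

variable {ε : ℝ}

/-- The affine parametrization of a face of a lattice tetrahedron. -/
noncomputable def facePoint (ε : ℝ) (p : Site × Equiv.Perm (Fin 3)) (i : Fin 4) (q : ℝ × ℝ) :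
    Space :=
  pos ε (lat p (i.succAbove 0)) +
    q.1 • (pos ε (lat p (i.succAbove 1)) - pos ε (lat p (i.succAbove 0))) +
    q.2 • (pos ε (lat p (i.succAbove 2)) - pos ε (lat p (i.succAbove 0)))

theorem continuous_facePoint (p : Site × Equiv.Perm (Fin 3)) (i : Fin 4) :
    Continuous (facePoint ε p i) := by
  unfold facePoint
  fun_prop

theorem facePoint_eq_sum (p : Site × Equiv.Perm (Fin 3)) (i : Fin 4) (w : Fin 4 → ℝ)
    (hw : ∑ j, w j = 1) (hi : w i = 0) :
    facePoint ε p i (w (i.succAbove 1), w (i.succAbove 2)) = ∑ j, w j • pos ε (lat p j) := by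
  rw [Fin.sum_univ_succAbove _ i, Fin.sum_univ_three] at hw ⊢
  rw [hi] at hw ⊢
  have : w (i.succAbove 0) = 1 - w (i.succAbove 1) - w (i.succAbove 2) := by linarith
  rw [facePoint, this]
  module

theorem facePoint_bary (hε : ε ≠ 0) {p : Site × Equiv.Perm (Fin 3)} {i : Fin 4} {x : Space}
    (hx : bary ε p x i = 0) :
    facePoint ε p i (bary ε p x (i.succAbove 1), bary ε p x (i.succAbove 2)) = x := by
  have h := sum_coord_smul (affineIndependent_lat hε p) x
  simp only [coord_lat hε] at h
  rw [facePoint_eq_sum p i (bary ε p x) (sum_boxBary x) hx, h]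

theorem exists_weights_facePoint (p : Site × Equiv.Perm (Fin 3)) (i : Fin 4) (q : ℝ × ℝ) :
    ∃ w : Fin 4 → ℝ, ∑ j, w j = 1 ∧ w i = 0 ∧ w (i.succAbove 0) = 1 - q.1 - q.2 ∧
      w (i.succAbove 1) = q.1 ∧ w (i.succAbove 2) = q.2 ∧
      facePoint ε p i q = ∑ j, w j • pos ε (lat p j) := by
  let w : Fin 4 → ℝ := i.insertNth (α := fun _ => ℝ) 0 ![1 - q.1 - q.2, q.1, q.2]
  have hi : w i = 0 := Fin.insertNth_apply_same _ _ _
  have hs (k : Fin 3) : w (i.succAbove k) = ![1 - q.1 - q.2, q.1, q.2] k :=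
    Fin.insertNth_apply_succAbove _ _ _ _
  have h1 : w (i.succAbove 1) = q.1 := hs 1
  have h2 : w (i.succAbove 2) = q.2 := hs 2
  have hsum : ∑ j, w j = 1 := by
    rw [Fin.sum_univ_succAbove _ i, Fin.sum_univ_three, hi, hs, hs, hs]
    simp
    ring
  refine ⟨w, hsum, hi, hs 0, h1, h2, ?_⟩
  rw [← facePoint_eq_sum p i w hsum hi, h1, h2]

theorem bary_facePoint (hε : ε ≠ 0) (p : Site × Equiv.Perm (Fin 3)) (i : Fin 4) (q : ℝ × ℝ) :
    bary ε p (facePoint ε p i q) i = 0 ∧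
    bary ε p (facePoint ε p i q) (i.succAbove 0) = 1 - q.1 - q.2 ∧
    bary ε p (facePoint ε p i q) (i.succAbove 1) = q.1 ∧
    bary ε p (facePoint ε p i q) (i.succAbove 2) = q.2 := by
  obtain ⟨w, hw, hi, h0, h1, h2, he⟩ := exists_weights_facePoint (ε := ε) p i q
  rw [he]
  simp only [← coord_lat hε, coord_tetBasis _ hw]
  exact ⟨hi, h0, h1, h2⟩

theorem facePoint_mem_openFace (hε : ε ≠ 0) (p : Site × Equiv.Perm (Fin 3)) (i : Fin 4)
    {q : ℝ × ℝ} (h1 : 0 < q.1) (h2 : 0 < q.2) (h3 : q.1 + q.2 < 1) :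
    facePoint ε p i q ∈ openFace ε p i := by
  obtain ⟨hi, g0, g1, g2⟩ := bary_facePoint hε p i q
  refine ⟨hi, fun k => ?_⟩
  fin_cases k
  · change 0 < bary ε p (facePoint ε p i q) (i.succAbove 0)
    rw [g0]; linarith
  · change 0 < bary ε p (facePoint ε p i q) (i.succAbove 1)
    rwa [g1]
  · change 0 < bary ε p (facePoint ε p i q) (i.succAbove 2)
    rwa [g2]

theorem ae_triangle : ∀ᵐ q ∂(volume.restrict triangle), 0 < q.1 ∧ 0 < q.2 ∧ q.1 + q.2 < 1 := by
  rw [ae_restrict_iff' measurableSet_triangle]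
  have n1 : ∀ᵐ q : ℝ × ℝ, q.1 ≠ 0 := by
    have : {q : ℝ × ℝ | ¬ q.1 ≠ 0} = {0} ×ˢ univ := by ext; simp
    rw [ae_iff, this, Measure.volume_eq_prod, Measure.prod_prod]; simp
  have n2 : ∀ᵐ q : ℝ × ℝ, q.2 ≠ 0 := by
    have : {q : ℝ × ℝ | ¬ q.2 ≠ 0} = univ ×ˢ {0} := by ext; simp
    rw [ae_iff, this, Measure.volume_eq_prod, Measure.prod_prod]; simp
  have n3 : ∀ᵐ q : ℝ × ℝ, 1 - q.1 - q.2 ≠ 0 :=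
    -- The area-preserving reflection carries the line of the hypotenuse to a coordinate axis.
    measurePreserving_reflect_fst.quasiMeasurePreserving.ae n1
  filter_upwards [n1, n2, n3] with q h1 h2 h3 ⟨g1, g2, g3⟩
  refine ⟨lt_of_le_of_ne g1 h1.symm, lt_of_le_of_ne g2 h2.symm, lt_of_le_of_ne g3 fun h => h3 ?_⟩
  linarith

theorem ae_facePoint_mem_openFace (hε : ε ≠ 0) (p : Site × Equiv.Perm (Fin 3)) (i : Fin 4) :
    ∀ᵐ q ∂(volume.restrict triangle), facePoint ε p i q ∈ openFace ε p i := by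
  filter_upwards [ae_triangle] with q hq
  exact facePoint_mem_openFace hε p i hq.1 hq.2.1 hq.2.2

theorem convex_preimage_facePoint (p : Site × Equiv.Perm (Fin 3)) (i : Fin 4) {s : Set Space}
    (hs : Convex ℝ s) : Convex ℝ (facePoint ε p i ⁻¹' s) := by
  intro x hx y hy a b ha hb hab
  have := hs hx hy ha hb hab
  rw [mem_preimage]
  convert this using 1
  have hb' : b = 1 - a := by linarith
  subst hb'
  simp only [facePoint, Prod.fst_add, Prod.smul_fst, Prod.snd_add, Prod.smul_snd, smul_eq_mul]
  module

namespace Geometry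

variable {G : Geometry} {R : Finset Site} {η : Site} {𝒯 : Site → Finset Tet} {l : Site}
  {g : Space →L[ℝ] ℝ} {v : Site → Space} {p : Site × Equiv.Perm (Fin 3)} {h : Space → ℝ}

variable (hG : G.IsAdmissible R) (hη : ∀ i, η i ≠ 0) (hM : G.IsInterfaceMesh η 𝒯)
  (hl : G.IsAtomistic η l ∨ G.IsInterfacial η l)

include hG hη hM hl

/-- On a face between two tetrahedra in `Ω_a` the traces from both sides agree. -/
theorem IsTrace.eq_neighbor {l' : Site} (hl' : G.IsAtomistic η l' ∨ G.IsInterfacial η l')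
    {i : Fin 4} {h' : Space → ℝ} (hh : IsTrace G η 𝒯 g v l p h)
    (hh' : IsTrace G η 𝒯 g v l' (neighbor p i).1 h')
    (hp : lat p ∈ G.atomistic) (hp' : lat (neighbor p i).1 ∈ G.atomistic)
    (hpB : hull G.ε (lat p) ⊆ closure (G.B η l))
    (hpB' : hull G.ε (lat (neighbor p i).1) ⊆ closure (G.B η l'))
    (hc : ∀ S ∈ G.bondMesh η 𝒯 l, ∀ S' ∈ G.bondMesh η 𝒯 l', G.Conforming S S')
    {x : Space} (hx : x ∈ openFace G.ε p i) : h x = h' x := by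
  have hε := hG.ε_pos.ne'
  obtain ⟨S, hS, hxS, e⟩ := hh.exists_eq hG hη hM hl hp hpB (openFace_subset_hull hε p i hx)
  obtain ⟨S', hS', hxS', e'⟩ := hh'.exists_eq hG hη hM hl' hp' hpB'
    (openFace_subset_hull hε _ _ (openFace_neighbor p i hx))
  rw [mem_atomisticElements] at hS hS'
  rw [e, e']
  exact scalarInterp_eq_of_conforming hG hη hM hl hl' hS.1 hS'.1 (hc _ hS.1 _ hS'.1) hxS hxS'
    (openFace_subset_Ωa hG hp hp' hx)

/-- The elements that meet at an interface face overlap there only in a null set. -/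
theorem notMem_of_mem_interior {i : Fin 4} (hpc : lat (neighbor p i).1 ∈ G.continuum)
    {S S' : Tet} (hS : S ∈ G.atomisticElements (G.bondMesh η 𝒯 l))
    (hS' : S' ∈ G.atomisticElements (G.bondMesh η 𝒯 l)) (hne : S ≠ S') {q : ℝ × ℝ}
    (hx : facePoint G.ε p i q ∈ openFace G.ε p i) :
    q ∉ interior (facePoint G.ε p i ⁻¹' (hull G.ε S ∩ hull G.ε S')) := by
  intro hq
  have hε := hG.ε_pos.ne'
  set x := facePoint G.ε p i q with hxdef
  have hxSS := interior_subset hq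
  obtain ⟨y, hy, hyp⟩ := exists_interior_point hG hη hM hl hpc hS hx hxSS.1
  obtain ⟨y', hy', hyp'⟩ := exists_interior_point hG hη hM hl hpc hS' hx hxSS.2
  -- Seen from the plane of the face, the point `lineMap x y s` has `s * c` times the height of
  -- `y'`. So the line from `y'` through it meets the plane at `k s`, and `k s` tends to `x`. If the
  -- face near `x` belongs to `S'`, then `k s` does, and by convexity so does the point `lineMap x y
  -- s`, which is interior to `S`. The interiors of `S` and `S'` would then overlap.
  set c := bary G.ε p y i / bary G.ε p y' i with hc
  have hcpos : 0 < c := div_pos hyp hyp'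
  let k : ℝ → Space := fun s => AffineMap.lineMap y' (AffineMap.lineMap x y s : Space) (1 - s * c)⁻¹
  have hk : Tendsto k (𝓝[>] 0) (𝓝 x) := by
    have h1 : ContinuousAt k 0 := by
      have h2 : ContinuousAt (fun s : ℝ => (1 - s * c)⁻¹) 0 :=
        ContinuousAt.inv₀ (by fun_prop) (by simp)
      have h3 : k = fun s => (1 - s * c)⁻¹ • (s • (y - x) + x - y') + y' := by
        funext s
        simp [k, AffineMap.lineMap_apply]
      rw [h3]
      fun_prop
    have h2 := h1.tendsto
    have h3 : k 0 = x := by simp [k]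
    rw [h3] at h2
    exact h2.mono_left nhdsWithin_le_nhds
  -- Points of the plane close to `x` are face points whose parameters are close to `q`, hence in
  -- the open set of parameters under consideration.
  have hK : ∀ᶠ z in 𝓝 x, bary G.ε p z i = 0 → z ∈ hull G.ε S' := by
    have h1 : ContinuousAt (fun z => (bary G.ε p z (i.succAbove 1), bary G.ε p z (i.succAbove 2)))
        x := ((continuous_bary hε p _).prodMk (continuous_bary hε p _)).continuousAt
    obtain ⟨-, -, e1, e2⟩ := bary_facePoint hε p i q
    have h2 : ∀ᶠ z in 𝓝 x, (bary G.ε p z (i.succAbove 1), bary G.ε p z (i.succAbove 2)) ∈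
        interior (facePoint G.ε p i ⁻¹' (hull G.ε S ∩ hull G.ε S')) := by
      refine h1.eventually (isOpen_interior.mem_nhds ?_)
      simp only [hxdef, e1, e2]
      exact hq
    filter_upwards [h2] with z hz hz0
    have := interior_subset hz
    rw [mem_preimage, facePoint_bary hε hz0] at this
    exact this.2
  have hs2 : ∀ᶠ s in 𝓝[>] (0 : ℝ), s * c < 1 := by
    have : Continuous fun s : ℝ => s * c := by fun_prop
    have h2 := this.tendsto 0
    rw [zero_mul] at h2
    exact (h2.mono_left nhdsWithin_le_nhds).eventually (gt_mem_nhds one_pos)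
  obtain ⟨s, ⟨⟨⟨h1, hzT⟩, h2⟩, h3⟩, h4⟩ := (((eventually_lineMap_mem_interior hG hx hxSS.1 hy
    hyp).and (hk.eventually hK)).and hs2 |>.and self_mem_nhdsWithin).exists
  have h4 : 0 < s := h4
  have hr : 1 - s * c ≠ 0 := by linarith
  have hk0 : bary G.ε p (k s) i = 0 := by
    simp only [k, bary_lineMap hε, hx.1]
    have : bary G.ε p y i = c * bary G.ε p y' i := by rw [hc]; field_simp
    rw [this]
    field_simp
    ring
  have hz : AffineMap.lineMap x y s ∈ hull G.ε S' := by
    have h5 := (convex_hull (ε := G.ε) S').lineMap_mem (h2 hk0) (interior_subset hy')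
      (t := s * c) ⟨by positivity, h3.le⟩
    convert h5 using 1
    set z : Space := AffineMap.lineMap x y s
    have hks : k s = (1 - s * c)⁻¹ • (z - y') + y' := AffineMap.lineMap_apply y' z _
    rw [AffineMap.lineMap_apply, vsub_eq_sub, vadd_eq_add, hks]
    have : z = (1 - s * c) • (1 - s * c)⁻¹ • (z - y') + y' := by
      rw [smul_smul, mul_inv_cancel₀ hr, one_smul]; abel
    generalize (1 - s * c)⁻¹ • (z - y') = w at this ⊢
    rw [this]
    module
  have hnd {S : Tet} (hS : S ∈ G.atomisticElements (G.bondMesh η 𝒯 l)) :=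
    bondMesh_nondegenerate hG hη hM hl (mem_atomisticElements.1 hS).1
  obtain ⟨w, hw, hw'⟩ := inter_interior_nonempty isOpen_interior
    (hull_subset_closure_interior (hnd hS')) ⟨_, h1, hz⟩
  exact Set.disjoint_left.1 (bondMesh_disjoint hG hη hM hl (mem_atomisticElements.1 hS).1
    (mem_atomisticElements.1 hS').1 hne) hw hw'

/-- Almost every point of an interface face lies in exactly one element in `Ω_a`. -/
theorem ae_existsUnique_element {i : Fin 4} (hp : lat p ∈ G.atomistic)
    (hpB : hull G.ε (lat p) ⊆ closure (G.B η l)) (hpc : lat (neighbor p i).1 ∈ G.continuum) :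
    ∀ᵐ q ∂(volume.restrict triangle), facePoint G.ε p i q ∈ openFace G.ε p i ∧
      ∃! S, S ∈ G.atomisticElements (G.bondMesh η 𝒯 l) ∧ facePoint G.ε p i q ∈ hull G.ε S := by
  have hε := hG.ε_pos.ne'
  -- The parameters of points in two given elements form a planar convex set. It has null frontier,
  -- and its interior is excluded by `notMem_of_mem_interior`.
  have h1 : ∀ S S' : Tet, ∀ᵐ q ∂(volume.restrict triangle),
      q ∉ frontier (facePoint G.ε p i ⁻¹' (hull G.ε S ∩ hull G.ε S')) := fun S S' =>
    ae_restrict_of_ae (measure_eq_zero_iff_ae_notMem.1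
      ((convex_preimage_facePoint p i ((convex_hull S).inter (convex_hull S'))).addHaar_frontier _))
  have h2 : ∀ᵐ q ∂(volume.restrict triangle),
      ∀ S ∈ G.atomisticElements (G.bondMesh η 𝒯 l), ∀ S' ∈ G.atomisticElements (G.bondMesh η 𝒯 l),
      q ∉ frontier (facePoint G.ε p i ⁻¹' (hull G.ε S ∩ hull G.ε S')) := by
    rw [Filter.eventually_all_finset]
    intro S _
    rw [Filter.eventually_all_finset]
    exact fun S' _ => h1 S S'
  filter_upwards [ae_facePoint_mem_openFace hε p i, h2] with q hq hfr
  refine ⟨hq, ?_⟩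
  -- Any trace will do: only the existence of an element at the boundary point is used, not the
  -- values.
  obtain ⟨h, hh⟩ := exists_isTrace (g := 0) (v := 0) hG hη hM hl hp hpB
  obtain ⟨S, hS, hqS, -⟩ := hh.exists_eq hG hη hM hl hp hpB (openFace_subset_hull hε p i hq)
  refine ⟨S, ⟨hS, hqS⟩, ?_⟩
  rintro S' ⟨hS', hqS'⟩
  by_contra hne
  have := notMem_of_mem_interior hG hη hM hl hpc hS hS' (Ne.symm hne) hq
  exact hfr S hS S' hS' ⟨subset_closure ⟨hqS, hqS'⟩, this⟩

end Geometry
end BondVolume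

/-! ### Fluxes through the faces of lattice tetrahedra -/

namespace BondVolume
open MeasureTheory Set Filter Topology
open scoped NNReal

variable {ε : ℝ} {η : Site}

/-- The derivatives of the barycentric coordinates of a lattice tetrahedron in direction `η`. -/
noncomputable def dirCoef (ε : ℝ) (η : Site) (σ : Equiv.Perm (Fin 3)) : Fin 4 → ℝ :=
  ![-(η (σ 0) : ℝ) / ε, ((η (σ 0) : ℝ) - η (σ 1)) / ε, ((η (σ 1) : ℝ) - η (σ 2)) / ε, η (σ 2) / ε]

theorem sum_dirCoef (σ : Equiv.Perm (Fin 3)) : ∑ j, dirCoef ε η σ j = 0 := by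
  simp [dirCoef, Fin.sum_univ_four]
  ring

theorem sum_dirCoef_smul (hε : ε ≠ 0) (p : Site × Equiv.Perm (Fin 3)) :
    ∑ j, dirCoef ε η p.2 j • pos ε (lat p j) = pos 1 η := by
  ext c
  obtain ⟨k, rfl⟩ := p.2.surjective c
  simp only [Fin.sum_univ_four, PiLp.add_apply, PiLp.smul_apply, pos_apply, lat_apply,
    smul_eq_mul, dirCoef]
  fin_cases k <;> simp <;> field_simp <;> ring

theorem dirCoef_neighbor (p : Site × Equiv.Perm (Fin 3)) (i : Fin 4) :
    dirCoef ε η (neighbor p i).1.2 (neighbor p i).2 = -dirCoef ε η p.2 i := by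
  have e : (-1 : Fin 3) = 2 := by decide
  have e' : ∀ a : Fin 3, ((finRotate 3) a) = ![1, 2, 0] a := by decide
  fin_cases i
  · simp [neighbor, dirCoef, e']; ring
  · simp [neighbor, dirCoef]; ring
  · simp [neighbor, dirCoef]; ring
  · simp [neighbor, dirCoef, e]; ring

theorem facePoint_neighbor (p : Site × Equiv.Perm (Fin 3)) (i : Fin 4) (q : ℝ × ℝ) :
    facePoint ε (neighbor p i).1 (neighbor p i).2 q = facePoint ε p i q := by
  simp only [facePoint, lat_neighbor]

/-- The integral of `h` times the normal component of `η` over a face of a lattice tetrahedron. -/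
noncomputable def flux (ε : ℝ) (η : Site) (p : Site × Equiv.Perm (Fin 3)) (i : Fin 4)
    (h : Space → ℝ) : ℝ :=
  -(ε ^ 3 * dirCoef ε η p.2 i) * ∫ q in triangle, h (facePoint ε p i q)

theorem flux_congr (hε : ε ≠ 0) {p : Site × Equiv.Perm (Fin 3)} {i : Fin 4} {h h' : Space → ℝ}
    (hh : ∀ x ∈ openFace ε p i, h x = h' x) : flux ε η p i h = flux ε η p i h' := by
  rw [flux, flux]
  congr 1
  refine integral_congr_ae ?_
  filter_upwards [ae_facePoint_mem_openFace hε p i] with q hq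
  exact hh _ hq

/-- The coefficients in direction `η` are opposite on the two sides and the parametrizations
coincide, so equal traces give cancelling fluxes. -/
theorem flux_neighbor (hε : ε ≠ 0) {p : Site × Equiv.Perm (Fin 3)} {i : Fin 4} {h h' : Space → ℝ}
    (hh : ∀ x ∈ openFace ε p i, h x = h' x) :
    flux ε η (neighbor p i).1 (neighbor p i).2 h' = -flux ε η p i h := by
  rw [flux_congr hε hh]
  simp only [flux, dirCoef_neighbor, facePoint_neighbor]
  ring

theorem abs_tripleProduct_lat (hε : 0 < ε) (p : Site × Equiv.Perm (Fin 3)) :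
    |tripleProduct (pos ε (lat p 0)) (pos ε (lat p 1)) (pos ε (lat p 2)) (pos ε (lat p 3))| =
      ε ^ 3 := by
  have := abs_tripleProduct_typeA (η := fun _ => 1) (l := p.1) (σ := p.2) hε
  simpa [lat] using this

/-- The divergence theorem on a lattice tetrahedron. -/
theorem setIntegral_fderiv_lat (hε : 0 < ε) (p : Site × Equiv.Perm (Fin 3)) {h : Space → ℝ}
    {K : ℝ≥0} (hh : LipschitzWith K h) :
    ∫ x in hull ε (lat p), fderiv ℝ h x (pos 1 η) = ∑ i, flux ε η p i h := by
  have := setIntegral_fderiv_tetrahedron (p := fun j => pos ε (lat p j))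
    (tripleProduct_typeA_ne_zero (l := p.1) (σ := p.2) hε one_site_ne_zero) hh
    (dirCoef ε η p.2) (sum_dirCoef _)
  rw [sum_dirCoef_smul hε.ne', abs_tripleProduct_lat hε] at this
  rw [hull, this, Finset.mul_sum]
  refine Finset.sum_congr rfl fun i _ => ?_
  rw [flux, faceIntegral, triangleIntegral]
  simp only [facePoint]
  ring

theorem measureReal_hull_lat (hε : 0 < ε) (p : Site × Equiv.Perm (Fin 3)) :
    volume.real (hull ε (lat p)) = ε ^ 3 / 6 := by
  have := measureReal_hull_typeA (l := p.1) (σ := p.2) hε one_site_ne_zero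
  simpa [lat] using this

theorem affine_lipschitzWith (a : Space →ᵃ[ℝ] ℝ) : ∃ K, LipschitzWith K a := by
  obtain ⟨K, hK⟩ := exists_affine_bound a
  refine ⟨K, LipschitzWith.of_dist_le_mul fun x y => ?_⟩
  rw [Real.dist_eq, dist_eq_norm]
  exact hK y x

/-- The divergence theorem on a lattice tetrahedron for an affine function. -/
theorem sum_flux_affine (hε : 0 < ε) (p : Site × Equiv.Perm (Fin 3)) (a : Space →ᵃ[ℝ] ℝ) :
    ∑ i, flux ε η p i a = ε ^ 3 / 6 * a.linear (pos 1 η) := by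
  obtain ⟨K, hK⟩ := affine_lipschitzWith a
  rw [← setIntegral_fderiv_lat hε p hK]
  simp only [(hasFDerivAt_affine a _).fderiv, setIntegral_const, smul_eq_mul]
  rw [measureReal_hull_lat hε]
  simp

namespace Geometry

variable {G : Geometry} {R : Finset Site} {𝒯 : Site → Finset Tet} {l : Site}
  {g : Space →L[ℝ] ℝ} {v : Site → Space} {p : Site × Equiv.Perm (Fin 3)} {h : Space → ℝ}

variable (hG : G.IsAdmissible R) (hη : ∀ i, η i ≠ 0) (hM : G.IsInterfaceMesh η 𝒯)
  (hl : G.IsAtomistic η l ∨ G.IsInterfacial η l)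

include hG hη hM hl

/-- Away from the null frontiers, a point lies in the interior of exactly one element, and `h`
equals the affine function of that element nearby. Elements and lattice tetrahedra need not be
nested, hence the volumes of intersections. -/
theorem IsTrace.setIntegral_fderiv (hh : IsTrace G η 𝒯 g v l p h) (hp : lat p ∈ G.atomistic)
    (hpB : hull G.ε (lat p) ⊆ closure (G.B η l)) (w : Space) :
    ∫ x in hull G.ε (lat p), fderiv ℝ h x w =
      ∑ S ∈ G.atomisticElements (G.bondMesh η 𝒯 l),
        volume.real (hull G.ε S ∩ hull G.ε (lat p)) * (scalarInterp G.ε g v S).linear w := by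
  have hfr : ∀ T : Tet, ∀ᵐ x ∂(volume.restrict (hull G.ε (lat p))), x ∉ frontier (hull G.ε T) :=
    fun T => ae_restrict_of_ae (measure_eq_zero_iff_ae_notMem.1
      ((convex_hull T).addHaar_frontier _))
  have hfr' : ∀ᵐ x ∂(volume.restrict (hull G.ε (lat p))),
      ∀ S ∈ G.atomisticElements (G.bondMesh η 𝒯 l), x ∉ frontier (hull G.ε S) := by
    rw [Filter.eventually_all_finset]
    exact fun S _ => hfr S
  have hae : ∀ᵐ x ∂(volume.restrict (hull G.ε (lat p))), fderiv ℝ h x w =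
      ∑ S ∈ G.atomisticElements (G.bondMesh η 𝒯 l),
        (hull G.ε S).indicator (fun _ => (scalarInterp G.ε g v S).linear w) x := by
    filter_upwards [hfr (lat p), hfr', ae_restrict_mem (measurableSet_hull _)] with x h1 h2 h3
    have hmem {T : Tet} (hT : x ∈ hull G.ε T) (hf : x ∉ frontier (hull G.ε T)) :
        x ∈ interior (hull G.ε T) := by
      by_contra hn
      exact hf ⟨subset_closure hT, hn⟩
    have hxp := hmem h3 h1
    obtain ⟨S, hS, hxS⟩ := exists_element hG hη hM hl (hpB h3) (interior_lat_subset_Ωa hp hxp)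
    have hxS' := hmem hxS (h2 S hS)
    rw [Finset.sum_eq_single_of_mem S hS, indicator_of_mem hxS]
    · have : h =ᶠ[𝓝 x] scalarInterp G.ε g v S := by
        filter_upwards [isOpen_interior.mem_nhds hxp, isOpen_interior.mem_nhds hxS'] with z hz hz'
        exact hh.2 z hz S hS (interior_subset hz')
      rw [this.fderiv_eq, (hasFDerivAt_affine _ x).fderiv]
      rfl
    · intro S' hS' hne
      apply indicator_of_notMem
      intro hx'
      exact Set.disjoint_left.1 (bondMesh_disjoint hG hη hM hl (mem_atomisticElements.1 hS').1
        (mem_atomisticElements.1 hS).1 hne) (hmem hx' (h2 S' hS')) hxS'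
  rw [integral_congr_ae hae, integral_finsetSum]
  · refine Finset.sum_congr rfl fun S _ => ?_
    rw [integral_indicator (measurableSet_hull S), Measure.restrict_restrict (measurableSet_hull S),
      setIntegral_const, smul_eq_mul]
  · intro S _
    refine IntegrableOn.integrable_indicator ?_ (measurableSet_hull S)
    refine (integrableOn_const ?_)
    rw [Measure.restrict_apply (measurableSet_hull S)]
    exact (measure_mono inter_subset_left).trans_lt (volume_hull_lt_top S) |>.ne

/-- The derivative of the interface term on a face, summed over the elements. -/
theorem IsTrace.sum_surfaceIntegral (hh : IsTrace G η 𝒯 g v l p h) (hp : lat p ∈ G.atomistic)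
    (hpB : hull G.ε (lat p) ⊆ closure (G.B η l)) {i : Fin 4}
    (hpc : lat (neighbor p i).1 ∈ G.continuum) (a : Space →ᵃ[ℝ] ℝ) :
    ∑ S ∈ G.atomisticElements (G.bondMesh η 𝒯 l),
      surfaceIntegral (pos G.ε (lat p (i.succAbove 0))) (pos G.ε (lat p (i.succAbove 1)))
        (pos G.ε (lat p (i.succAbove 2))) ((hull G.ε S).indicator fun x =>
          inner ℝ (exteriorNormal (pos G.ε (lat p (i.succAbove 0)))
            (pos G.ε (lat p (i.succAbove 1))) (pos G.ε (lat p (i.succAbove 2)))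
            (pos G.ε (lat p i))) (pos 1 η) * (scalarInterp G.ε g v S x - a x)) =
      flux G.ε η p i h - flux G.ε η p i a := by
  have hε := hG.ε_pos
  set ν := inner ℝ (exteriorNormal (pos G.ε (lat p (i.succAbove 0)))
            (pos G.ε (lat p (i.succAbove 1))) (pos G.ε (lat p (i.succAbove 2)))
            (pos G.ε (lat p i))) (pos 1 η) with hν
  have hn := norm_areaVector_mul_inner_face (fun j => pos G.ε (lat p j)) i
    (dirCoef G.ε η p.2) (sum_dirCoef _)
  rw [sum_dirCoef_smul hε.ne', abs_tripleProduct_lat hε, ← hν] at hn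
  obtain ⟨K, hK⟩ := hh.1
  have hint (f : Space → ℝ) (hf : Continuous f) :
      Integrable (fun q => f (facePoint G.ε p i q)) (volume.restrict triangle) :=
    (hf.comp (continuous_facePoint p i)).continuousOn.integrableOn_compact isCompact_triangle
  -- Almost everywhere a single element contributes, and there its interpolant equals the trace `h`,
  -- so the sum over elements disappears.
  have hae : ∀ᵐ q ∂(volume.restrict triangle),
      ∑ S ∈ G.atomisticElements (G.bondMesh η 𝒯 l), (hull G.ε S).indicator
        (fun x => ν * (scalarInterp G.ε g v S x - a x)) (facePoint G.ε p i q) =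
      ν * (h (facePoint G.ε p i q) - a (facePoint G.ε p i q)) := by
    filter_upwards [ae_existsUnique_element hG hη hM hl hp hpB hpc] with q ⟨hq, S, ⟨hS, hqS⟩, hu⟩
    rw [Finset.sum_eq_single_of_mem S hS, indicator_of_mem hqS,
      hh.eq_of_mem hG hη hM hl hpc hS hq hqS]
    intro S' hS' hne
    exact indicator_of_notMem (fun h' => hne (hu S' ⟨hS', h'⟩)) _
  have hi (S : Tet) : Integrable (fun q => (hull G.ε S).indicator
        (fun x => ν * (scalarInterp G.ε g v S x - a x)) (facePoint G.ε p i q))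
        (volume.restrict triangle) := by
    have := (hint (fun x => ν * (scalarInterp G.ε g v S x - a x))
      (continuous_const.mul ((scalarInterp G.ε g v S).continuous_of_finiteDimensional.sub
        a.continuous_of_finiteDimensional))).indicator
      ((measurableSet_hull (ε := G.ε) S).preimage (continuous_facePoint (ε := G.ε) p i).measurable)
    exact this
  calc _ = ‖areaVector (pos G.ε (lat p (i.succAbove 0))) (pos G.ε (lat p (i.succAbove 1)))
        (pos G.ε (lat p (i.succAbove 2)))‖ * ∫ q in triangle,
        ∑ S ∈ G.atomisticElements (G.bondMesh η 𝒯 l), (hull G.ε S).indicator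
        (fun x => ν * (scalarInterp G.ε g v S x - a x)) (facePoint G.ε p i q) := by
        rw [integral_finsetSum _ fun S _ => hi S, Finset.mul_sum]
        rfl
    _ = _ := by
      rw [integral_congr_ae hae, integral_const_mul, integral_sub (hint h hK.continuous)
        (hint a a.continuous_of_finiteDimensional), ← mul_assoc, hn, flux, flux]
      ring

end Geometry
end BondVolume

namespace BondVolume
open MeasureTheory Set Filter Topology
open scoped NNReal

theorem pos_one_eq {ε : ℝ} (hε : ε ≠ 0) (η l : Site) :
    pos 1 η = ε⁻¹ • (pos ε (l + η) - pos ε l) := by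
  ext c
  simp [pos_apply]
  field_simp
  ring

/-! ### The bond volumes that contain a given lattice cell -/

/-- The cell with lower corner `m` is contained in the box of `l` and `η`. -/
def InBox (η l m : Site) : Prop :=
  ∀ i, min (l i) (l i + η i) ≤ m i ∧ m i + 1 ≤ max (l i) (l i + η i)

/-- The lower corners of representatives of the classes of bond volumes which tile the space. -/
noncomputable def bondClasses (η : Site) : Finset Site := Fintype.piFinset fun i => Finset.Ico 0 |η i|

/-- The bond volume in the class of `c` which contains the cell with lower corner `m`. -/
def cellBond (η c m : Site) : Site :=
  fun i => m i - (m i - c i) % η i + if η i < 0 then -η i else 0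

variable {η : Site}

theorem inBox_cellBond (hη : ∀ i, η i ≠ 0) (c m : Site) : InBox η (cellBond η c m) m := by
  intro i
  have h1 := Int.emod_nonneg (m i - c i) (hη i)
  have h2 := Int.emod_lt_abs (m i - c i) (hη i)
  simp only [cellBond]
  set r := (m i - c i) % η i
  rcases lt_or_gt_of_ne (hη i) with h | h
  · rw [abs_of_neg h] at h2
    rw [if_pos h]
    constructor
    · exact (min_le_right _ _).trans (by omega)
    · exact le_trans (by omega) (le_max_left _ _)
  · rw [abs_of_pos h] at h2
    rw [if_neg (by omega)]
    constructor
    · exact (min_le_left _ _).trans (by omega)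
    · exact le_trans (by omega) (le_max_right _ _)

theorem cellBond_emod {c : Site} (hc : c ∈ bondClasses η) (m : Site) :
    (fun i => cellBond η c m i % η i) = c := by
  funext i
  have h := Fintype.mem_piFinset.1 hc i
  rw [Finset.mem_Ico] at h
  have h1 : cellBond η c m i = c i + η i * ((m i - c i) / η i + if η i < 0 then -1 else 0) := by
    have := Int.emod_add_mul_ediv (m i - c i) (η i)
    simp only [cellBond]
    split_ifs <;> linarith
  rw [h1, Int.add_mul_emod_self_left, ← Int.emod_abs, Int.emod_eq_of_lt h.1 h.2]

theorem emod_mem_bondClasses (hη : ∀ i, η i ≠ 0) (l : Site) :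
    (fun i => l i % η i) ∈ bondClasses η := by
  rw [bondClasses, Fintype.mem_piFinset]
  exact fun i => Finset.mem_Ico.2 ⟨Int.emod_nonneg _ (hη i), Int.emod_lt_abs _ (hη i)⟩

theorem cellBond_of_inBox (hη : ∀ i, η i ≠ 0) {l m : Site} (h : InBox η l m) :
    cellBond η (fun i => l i % η i) m = l := by
  funext i
  obtain ⟨h1, h2⟩ := h i
  simp only [cellBond]
  have e0 : (m i - l i % η i) % η i = (m i - l i) % η i := by
    rw [Int.sub_emod, Int.emod_emod_of_dvd _ dvd_rfl, ← Int.sub_emod]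
  rw [e0]
  rcases lt_or_gt_of_ne (hη i) with h | h
  · rw [min_eq_right (by omega)] at h1
    rw [max_eq_left (by omega)] at h2
    have e : (m i - l i) % η i = m i - l i - η i := by
      have : m i - l i = (m i - l i - η i) + η i * 1 := by ring
      rw [this, Int.add_mul_emod_self_left, ← Int.emod_abs, Int.emod_eq_of_lt (by omega)
        (by rw [abs_of_neg h]; omega)]
      ring
    rw [e, if_pos h]
    ring
  · rw [min_eq_left (by omega)] at h1
    rw [max_eq_right (by omega)] at h2
    rw [Int.emod_eq_of_lt (by omega) (by omega), if_neg (by omega)]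
    ring

/-- Each class tiles the space by boxes made of whole cells, so a cell lies in exactly one box of
each class. The class is the residue of the site modulo `η`. -/
theorem sum_inBox (hη : ∀ i, η i ≠ 0) (m : Site) (s : Finset Site)
    (hs : ∀ l, l ∈ s ↔ InBox η l m) (f : Site → ℝ) :
    ∑ l ∈ s, f l = ∑ c ∈ bondClasses η, f (cellBond η c m) := by
  refine Finset.sum_nbij' (fun l i => l i % η i) (fun c => cellBond η c m) ?_ ?_ ?_ ?_ ?_
  · exact fun l _ => emod_mem_bondClasses hη l
  · exact fun c _ => (hs _).2 (inBox_cellBond hη c m)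
  · exact fun l hl => cellBond_of_inBox hη ((hs l).1 hl)
  · exact fun c hc => cellBond_emod hc m
  · intro l hl
    rw [cellBond_of_inBox hη ((hs l).1 hl)]

theorem card_bondClasses : ((bondClasses η).card : ℝ) = |(η 0 * η 1 * η 2 : ℝ)| := by
  have h (i : Fin 3) : ((|η i|.toNat : ℕ) : ℝ) = |(η i : ℝ)| := by
    rw [← Int.cast_natCast, Int.toNat_of_nonneg (abs_nonneg _), Int.cast_abs]
  simp [bondClasses, Fintype.card_piFinset, Fin.prod_univ_three, abs_mul, h]

/-- Bond volumes of the same class that contain adjacent cells coincide or share a face. -/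
theorem cellBond_add_single (hη : ∀ i, η i ≠ 0) (c m : Site) (k : Fin 3) :
    cellBond η c (m + Pi.single k 1) = cellBond η c m ∨
    cellBond η c (m + Pi.single k 1) = cellBond η c m + Pi.single k (η k) ∨
    cellBond η c m = cellBond η c (m + Pi.single k 1) + Pi.single k (η k) := by
  have hne (j : Fin 3) (hj : j ≠ k) : cellBond η c (m + Pi.single k 1) j = cellBond η c m j := by
    simp [cellBond, hj]
  suffices h : cellBond η c (m + Pi.single k 1) k = cellBond η c m k ∨
      cellBond η c (m + Pi.single k 1) k = cellBond η c m k + η k ∨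
      cellBond η c m k = cellBond η c (m + Pi.single k 1) k + η k by
    rcases h with h | h | h
    · left; funext j
      by_cases hj : j = k
      · subst hj; exact h
      · exact hne j hj
    · right; left; funext j
      by_cases hj : j = k
      · subst hj; simpa using h
      · simpa [hj] using hne j hj
    · right; right; funext j
      by_cases hj : j = k
      · subst hj; simpa using h
      · simpa [hj] using (hne j hj).symm
  simp only [cellBond, Pi.add_apply, Pi.single_eq_same]
  set a := m k - c k with ha
  have e : m k + 1 - c k = a + 1 := by omega
  rw [e]
  have h1 := Int.emod_nonneg a (hη k)
  have h2 := Int.emod_lt_abs a (hη k)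
  have hd := Int.emod_add_mul_ediv a (η k)
  -- Stepping to the next cell either raises the remainder by one and stays in the box, or wraps it
  -- to zero and enters the adjacent box; the sign of `η k` decides which of the two sites is the
  -- shifted one.
  by_cases h3 : a % η k + 1 < |η k|
  · left
    have : (a + 1) % η k = a % η k + 1 := by
      have h4 : a + 1 = (a % η k + 1) + η k * (a / η k) := by linarith
      rw [h4, Int.add_mul_emod_self_left, ← Int.emod_abs, Int.emod_eq_of_lt (by omega) h3]
    rw [this]; ring
  · have h5 : a % η k + 1 = |η k| := by omega
    have : (a + 1) % η k = 0 := by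
      apply Int.emod_eq_zero_of_dvd
      have h4 : a + 1 = |η k| + η k * (a / η k) := by linarith
      rw [h4]
      exact dvd_add ((dvd_abs _ _).2 dvd_rfl) (dvd_mul_right _ _)
    right
    rw [this]
    rcases lt_or_gt_of_ne (hη k) with h | h
    · right
      rw [abs_of_neg h] at h5
      omega
    · left
      rw [abs_of_pos h] at h5
      omega

namespace Geometry

variable {G : Geometry} {R : Finset Site} {𝒯 : Site → Finset Tet} {l : Site}
  {g : Space →L[ℝ] ℝ} {v : Site → Space} {p : Site × Equiv.Perm (Fin 3)} {h : Space → ℝ}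

variable (hG : G.IsAdmissible R) (hη : ∀ i, η i ≠ 0)

include hG hη

/-- The faces of the box lie in lattice planes, which do not cut open lattice tetrahedra. So overlap
with the box forces containment of the cell. -/
theorem inBox_of_inter (h : (interior (hull G.ε (lat p)) ∩ closure (G.B η l)).Nonempty) :
    InBox η l p.1 := by
  obtain ⟨x, hx, hxB⟩ := h
  have hε := hG.ε_pos
  intro i
  obtain ⟨h1, h2⟩ := floor_of_mem_interior_lat hG hx i
  rw [B, closure_bondVolume hε hη, mem_preimage, mem_Icc] at hxB
  have h3 := hxB.1 i
  have h4 := hxB.2 i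
  simp only at h3 h4
  rw [← mul_min_of_nonneg _ _ hε.le] at h3
  rw [← mul_max_of_nonneg _ _ hε.le] at h4
  rw [lt_div_iff₀ hε] at h1
  rw [div_lt_iff₀ hε] at h2
  have h5 : min (l i : ℝ) ((l i + η i : ℤ) : ℝ) < p.1 i + 1 := by nlinarith
  have h6 : (p.1 i : ℝ) < max (l i : ℝ) ((l i + η i : ℤ) : ℝ) := by nlinarith
  have h7 : min (l i) (l i + η i) < p.1 i + 1 := by exact_mod_cast h5
  have h8 : p.1 i < max (l i) (l i + η i) := by exact_mod_cast h6
  omega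

theorem hull_subset_closure_B_iff :
    hull G.ε (lat p) ⊆ closure (G.B η l) ↔ InBox η l p.1 := by
  have hε := hG.ε_pos
  constructor
  · intro h
    obtain ⟨y, hy⟩ := interior_hull_nonempty (affineIndependent_lat hε.ne' p)
    exact inBox_of_inter hG hη ⟨y, hy, h (interior_subset hy)⟩
  · intro h
    refine convexHull_min ?_ convex_bondVolume.closure
    rintro _ ⟨j, rfl⟩
    rw [B, closure_bondVolume hε hη, mem_preimage, mem_Icc, Pi.le_def, Pi.le_def, ← forall_and]
    intro i
    obtain ⟨k, rfl⟩ := p.2.surjective i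
    obtain ⟨h1, h2⟩ := h (p.2 k)
    rw [← mul_min_of_nonneg _ _ hε.le, ← mul_max_of_nonneg _ _ hε.le, pos_apply,
      mul_le_mul_iff_right₀ hε, mul_le_mul_iff_right₀ hε, lat_apply]
    have h3 : min (l (p.2 k)) (l (p.2 k) + η (p.2 k)) ≤
        p.1 (p.2 k) + if k.val < j.val then 1 else 0 := by split_ifs <;> omega
    have h4 : (p.1 (p.2 k) + if k.val < j.val then 1 else 0) ≤
        max (l (p.2 k)) (l (p.2 k) + η (p.2 k)) := by split_ifs <;> omega
    constructor
    · exact_mod_cast h3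
    · exact_mod_cast h4

open Classical in
/-- The indices of the lattice tetrahedra in the atomistic region. -/
noncomputable def _root_.BondVolume.Geometry.atomisticIdx (G : Geometry) :
    Finset (Site × Equiv.Perm (Fin 3)) :=
  (G.periodSites ×ˢ Finset.univ).filter fun p => lat p ∈ G.atomistic

omit hη in
theorem mem_atomisticIdx : p ∈ G.atomisticIdx ↔ lat p ∈ G.atomistic := by
  simp only [atomisticIdx, Finset.mem_filter, Finset.mem_product, Finset.mem_univ, and_true,
    and_iff_right_iff_imp]
  exact fun h => lat_mem_latticeTets.1 (hG.atomistic_subset h)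

omit hη in
theorem sum_atomistic (f : Tet → ℝ) : ∑ T ∈ G.atomistic, f T = ∑ p ∈ G.atomisticIdx, f (lat p) := by
  refine (Finset.sum_nbij lat (fun p hp => (mem_atomisticIdx hG).1 hp) lat_injective.injOn ?_
    fun _ _ => rfl).symm
  intro T hT
  obtain ⟨p, -, rfl⟩ := mem_latticeTets.1 (hG.atomistic_subset hT)
  exact ⟨p, (mem_atomisticIdx hG).2 hT, rfl⟩

open Classical in
/-- An element in `Ω_a` is decomposed by the lattice tetrahedra in the bond volume. -/
theorem sum_measureReal_inter (hM : G.IsInterfaceMesh η 𝒯)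
    (hl : G.IsAtomistic η l ∨ G.IsInterfacial η l) {S : Tet}
    (hS : S ∈ G.atomisticElements (G.bondMesh η 𝒯 l)) :
    ∑ p ∈ G.atomisticIdx with hull G.ε (lat p) ⊆ closure (G.B η l),
      volume.real (hull G.ε S ∩ hull G.ε (lat p)) = volume.real (hull G.ε S) := by
  have hε := hG.ε_pos.ne'
  rw [mem_atomisticElements] at hS
  have hSB : hull G.ε S ⊆ closure (G.B η l) := by
    rw [← bondMesh_cover hG hη hM hl]
    exact subset_biUnion_of_mem (u := fun T => hull G.ε T) hS.1
  have hSa : hull G.ε S ⊆ ⋃ p ∈ G.atomisticIdx, hull G.ε (lat p) := by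
    refine hS.2.trans ?_
    rw [closure_Ωa hG]
    intro x hx
    obtain ⟨T, hT, hxT⟩ := mem_union.1 hx
    obtain ⟨p, -, rfl⟩ := mem_latticeTets.1 (hG.atomistic_subset hT)
    exact mem_biUnion ((mem_atomisticIdx hG).2 hT) hxT
  have hu : hull G.ε S = ⋃ p ∈ G.atomisticIdx, hull G.ε S ∩ hull G.ε (lat p) := by
    rw [← inter_iUnion₂]
    exact (inter_eq_left.2 hSa).symm
  conv_rhs => rw [hu]
  rw [measureReal_biUnion_finset₀ _ _ fun p _ =>
    ((measure_mono inter_subset_left).trans_lt (volume_hull_lt_top S)).ne]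
  · rw [Finset.sum_filter]
    refine Finset.sum_congr rfl fun p _ => ?_
    split_ifs with hp
    · rfl
    -- A tetrahedron outside the bond volume meets it, and hence `S`, only in its own frontier.
    · symm
      rw [measureReal_def, ENNReal.toReal_eq_zero_iff]
      left
      refine measure_mono_null ?_ ((convex_hull (ε := G.ε) (lat p)).addHaar_frontier volume)
      rintro x ⟨hxS, hxp⟩
      refine ⟨subset_closure hxp, fun hxi => hp ?_⟩
      exact (hull_subset_closure_B_iff hG hη).2 (inBox_of_inter hG hη ⟨x, hxi, hSB hxS⟩)
  · intro p _ q _ hpq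
    refine measure_mono_null (inter_subset_inter inter_subset_right inter_subset_right)
      (volume_inter_eq_zero (convex_hull _) (convex_hull _) (disjoint_interior_lat hε hpq))
  · exact fun p _ => ((measurableSet_hull S).inter (measurableSet_hull _)).nullMeasurableSet

/-- The derivative of the energy of the part of the bond volume of `l` in `Ω_a`. -/
noncomputable def _root_.BondVolume.Geometry.bulkSum (G : Geometry) (η : Site)
    (𝒯 : Site → Finset Tet) (g : Space →L[ℝ] ℝ) (v : Site → Space) (l : Site) : ℝ :=
  ∑ S ∈ G.atomisticElements (G.bondMesh η 𝒯 l),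
    volume.real (hull G.ε S) * (scalarInterp G.ε g v S).linear (pos 1 η)

open Classical in
-- The integral over the elements is regrouped by lattice tetrahedra, on which the divergence
-- theorem applies to the traces.
theorem bulkSum_eq (hM : G.IsInterfaceMesh η 𝒯)
    (hl : G.IsAtomistic η l ∨ G.IsInterfacial η l) (H : Site × Equiv.Perm (Fin 3) → Space → ℝ)
    (hH : ∀ p, lat p ∈ G.atomistic → hull G.ε (lat p) ⊆ closure (G.B η l) →
      IsTrace G η 𝒯 g v l p (H p)) :
    G.bulkSum η 𝒯 g v l = ∑ p ∈ G.atomisticIdx with hull G.ε (lat p) ⊆ closure (G.B η l),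
      ∑ i, flux G.ε η p i (H p) := by
  have h1 : ∀ p ∈ G.atomisticIdx.filter (fun p => hull G.ε (lat p) ⊆ closure (G.B η l)),
      ∑ i, flux G.ε η p i (H p) = ∑ S ∈ G.atomisticElements (G.bondMesh η 𝒯 l),
        volume.real (hull G.ε S ∩ hull G.ε (lat p)) *
          (scalarInterp G.ε g v S).linear (pos 1 η) := by
    intro p hp
    rw [Finset.mem_filter, mem_atomisticIdx hG] at hp
    have ht := hH p hp.1 hp.2
    obtain ⟨K, hK⟩ := ht.1
    rw [← setIntegral_fderiv_lat hG.ε_pos p hK, ht.setIntegral_fderiv hG hη hM hl hp.1 hp.2]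
  rw [Finset.sum_congr rfl h1, Finset.sum_comm, bulkSum]
  refine Finset.sum_congr rfl fun S hS => ?_
  rw [← Finset.sum_mul, sum_measureReal_inter hG hη hM hl hS]

/-- For bond volumes of atomistic type, the element energies add up to the energy of the bond. -/
theorem bulkSum_of_isAtomistic (hM : G.IsInterfaceMesh η 𝒯) (hl : G.IsAtomistic η l) :
    G.bulkSum η 𝒯 g v l =
      |(η 0 * η 1 * η 2 : ℝ)| * (G.ε ^ 3 * g (diffQuot G.ε η v l)) := by
  have hε := hG.ε_pos
  have hel : G.atomisticElements (G.bondMesh η 𝒯 l) = Finset.univ.image (typeATet η l) := by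
    rw [bondMesh_of_isAtomistic hl]
    ext S
    rw [mem_atomisticElements, typeA, and_iff_left_iff_imp]
    intro hS
    have : hull G.ε S ⊆ closure (G.B η l) := by
      rw [← bondMesh_cover hG hη hM (Or.inl hl), bondMesh_of_isAtomistic hl]
      exact subset_biUnion_of_mem (u := fun T => hull G.ε T) hS
    exact this.trans (hl.trans subset_closure)
  have hinj : Function.Injective (typeATet η l) := fun σ τ h =>
    (Prod.ext_iff.1 (typeATet_injective hη (a₁ := (l, σ)) (a₂ := (l, τ)) h)).2
  rw [bulkSum, hel, Finset.sum_image hinj.injOn]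
  -- Vertices `0` and `3` of every type A tetrahedron are the ends of the bond, so the derivative
  -- along `η` is the same on all six.
  have hlin (σ : Equiv.Perm (Fin 3)) :
      (scalarInterp G.ε g v (typeATet η l σ)).linear (pos 1 η) = g (diffQuot G.ε η v l) := by
    have hnd := affineIndependent_typeA (ε := G.ε) (l := l) (σ := σ) hε.ne' hη
    have h0 := interp_apply hnd v 0
    have h3 := interp_apply hnd v 3
    have e0 : typeATet η l σ 0 = l := by funext c; simp [typeATet]
    have e3 : typeATet η l σ 3 = l + η := by
      funext c
      have : (σ.symm c).val < 3 := (σ.symm c).isLt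
      simp [typeATet, this]
    rw [e0] at h0
    rw [e3] at h3
    have hp := pos_one_eq hG.ε_pos.ne' η l
    rw [scalarInterp_linear, diffQuot, hp, map_smul, ← h0, ← h3]
    congr 2
    exact (interp G.ε (typeATet η l σ) v).linearMap_vsub _ _
  simp only [hlin]
  rw [← Finset.sum_mul, sum_measureReal_typeA hε hη]
  ring

end Geometry
end BondVolume

namespace BondVolume
open MeasureTheory Set Filter Topology
open scoped NNReal

namespace Geometry

variable {G : Geometry} {R : Finset Site} {η : Site} {𝒯 : Site → Finset Tet} {l : Site}
  {g : Space →L[ℝ] ℝ} {v : Site → Space} {p : Site × Equiv.Perm (Fin 3)}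

/-! ### Summation of the fluxes -/

/-- The indices of the faces between the two regions. -/
noncomputable def interfaceIdx (G : Geometry) :
    Finset ((Site × Equiv.Perm (Fin 3)) × Fin 4) :=
  (G.atomisticIdx ×ˢ Finset.univ).filter fun q => lat (neighbor q.1 q.2).1 ∉ G.atomistic

open Classical in
/-- The sites of the bond volumes that contribute to the energy. -/
noncomputable def bondSites (G : Geometry) (η : Site) : Finset Site :=
  G.sites.filter fun l => G.IsAtomistic η l ∨ G.IsInterfacial η l

/-- A trace function, if there is one. -/
noncomputable def trace (G : Geometry) (η : Site) (𝒯 : Site → Finset Tet) (g : Space →L[ℝ] ℝ)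
    (v : Site → Space) (l : Site) (p : Site × Equiv.Perm (Fin 3)) : Space → ℝ :=
  open Classical in if h : ∃ h, IsTrace G η 𝒯 g v l p h then h.choose else 0

/-- The derivative of the jump terms. -/
noncomputable def jumpSum (G : Geometry) (η : Site) (𝒯 : Site → Finset Tet) (g : Space →L[ℝ] ℝ)
    (v : Site → Space) (l : Site) : ℝ :=
  ∑ f ∈ G.interfaceFaces η l, ∑ S ∈ G.atomisticElements (G.bondMesh η 𝒯 l),
    surfaceIntegral (pos G.ε (f.1 (f.2.2.succAbove 0))) (pos G.ε (f.1 (f.2.2.succAbove 1)))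
      (pos G.ε (f.1 (f.2.2.succAbove 2))) ((hull G.ε S).indicator fun x =>
        inner ℝ (exteriorNormal (pos G.ε (f.1 (f.2.2.succAbove 0)))
          (pos G.ε (f.1 (f.2.2.succAbove 1))) (pos G.ε (f.1 (f.2.2.succAbove 2)))
          (pos G.ε (f.1 f.2.2))) (pos 1 η) *
        (scalarInterp G.ε g v S x - scalarInterp G.ε g v f.2.1 x))

variable (hG : G.IsAdmissible R)

include hG

theorem mem_interfaceIdx {q : (Site × Equiv.Perm (Fin 3)) × Fin 4} :
    q ∈ G.interfaceIdx ↔ lat q.1 ∈ G.atomistic ∧ lat (neighbor q.1 q.2).1 ∉ G.atomistic := by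
  simp [interfaceIdx, mem_atomisticIdx hG]

/-- Fluxes through the faces inside the atomistic region cancel. -/
theorem sum_flux_eq (H : Site × Equiv.Perm (Fin 3) → Space → ℝ)
    (hH : ∀ p i, lat p ∈ G.atomistic → lat (neighbor p i).1 ∈ G.atomistic →
      ∀ x ∈ openFace G.ε p i, H p x = H (neighbor p i).1 x) :
    ∑ p ∈ G.atomisticIdx, ∑ i, flux G.ε η p i (H p) =
      ∑ q ∈ G.interfaceIdx, flux G.ε η q.1 q.2 (H q.1) := by
  have hε := hG.ε_pos.ne'
  rw [← Finset.sum_product' _ _ fun p i => flux G.ε η p i (H p),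
    ← Finset.sum_filter_add_sum_filter_not _
    fun q : (Site × Equiv.Perm (Fin 3)) × Fin 4 => lat (neighbor q.1 q.2).1 ∈ G.atomistic,
    interfaceIdx, add_eq_right]
  have hmem : ∀ q : (Site × Equiv.Perm (Fin 3)) × Fin 4,
      q ∈ (G.atomisticIdx ×ˢ Finset.univ).filter
        (fun q => lat (neighbor q.1 q.2).1 ∈ G.atomistic) ↔
      lat q.1 ∈ G.atomistic ∧ lat (neighbor q.1 q.2).1 ∈ G.atomistic := by
    intro q
    simp [mem_atomisticIdx hG]
  -- Passing to the neighbour pairs the two sides of each inner face, and the two fluxes of a pair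
  -- cancel.
  refine Finset.sum_involution (fun q _ => neighbor q.1 q.2) ?_ ?_ ?_ ?_
  · intro q hq
    obtain ⟨h1, h2⟩ := (hmem q).1 hq
    rw [flux_neighbor hε (hH q.1 q.2 h1 h2), add_neg_cancel]
  · intro q _ _ h
    exact neighbor_ne hε q.1 q.2 (congrArg Prod.fst h)
  · intro q hq
    obtain ⟨h1, h2⟩ := (hmem q).1 hq
    refine (hmem _).2 ⟨h2, ?_⟩
    rw [neighbor_neighbor]
    exact h1
  · exact fun q _ => neighbor_neighbor q.1 q.2

/-- The affine interpolants on lattice tetrahedra that share a face coincide on it. -/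
theorem scalarInterp_lat_neighbor (g : Space →L[ℝ] ℝ) (v : Site → Space) {i : Fin 4} {x : Space}
    (hx : x ∈ openFace G.ε p i) :
    scalarInterp G.ε g v (lat p) x = scalarInterp G.ε g v (lat (neighbor p i).1) x := by
  have hε := hG.ε_pos.ne'
  rw [scalarInterp_apply, scalarInterp_apply, interp_eq_of_mem_common
    (affineIndependent_lat hε p) (affineIndependent_lat hε (neighbor p i).1) v]
  rw [← facePoint_bary hε hx.1]
  obtain ⟨w, hw1, hwi, hw0, hwb, hwc, hw⟩ := exists_weights_facePoint (ε := G.ε) p i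
    (bary G.ε p x (i.succAbove 1), bary G.ε p x (i.succAbove 2))
  have hb : ∀ k, 0 < bary G.ε p x (i.succAbove k) := hx.2
  have hq : facePoint G.ε p i (bary G.ε p x (i.succAbove 1), bary G.ε p x (i.succAbove 2)) = x :=
    facePoint_bary hε hx.1
  have h0 := (bary_facePoint hε p i
    (bary G.ε p x (i.succAbove 1), bary G.ε p x (i.succAbove 2))).2.1
  rw [hq] at h0
  rw [hw, Fin.sum_univ_succAbove _ i, hwi, zero_smul, zero_add]
  rw [Fin.sum_univ_succAbove _ i, hwi, zero_add] at hw1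
  refine (convex_convexHull ℝ _).sum_mem (fun k _ => ?_) hw1 fun k _ => subset_convexHull ℝ _ ?_
  · fin_cases k
    · simpa only [Fin.zero_eta, hw0, ← h0] using (hb 0).le
    · simpa only [Fin.mk_one, hwb] using (hb 1).le
    · exact hwc ▸ (hb 2).le
  · exact ⟨_, ⟨⟨_, rfl⟩, ⟨_, lat_neighbor p i k⟩⟩, rfl⟩

/-- The faces between the regions carry the total flux out of the atomistic region. -/
theorem sum_interface_flux (g : Space →L[ℝ] ℝ) (v : Site → Space) (η : Site) :
    ∑ q ∈ G.interfaceIdx,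
      flux G.ε η q.1 q.2 (scalarInterp G.ε g v (lat (neighbor q.1 q.2).1)) =
    G.ε ^ 3 / 6 * ∑ T ∈ G.atomistic, (scalarInterp G.ε g v T).linear (pos 1 η) := by
  have hε := hG.ε_pos
  -- Since the lattice interpolant is continuous, its values on `Γ` may be taken from inside `Ω_a`.
  -- The cancellation of inner fluxes is then used backwards.
  have h1 : ∀ q ∈ G.interfaceIdx,
      flux G.ε η q.1 q.2 (scalarInterp G.ε g v (lat (neighbor q.1 q.2).1)) =
      flux G.ε η q.1 q.2 (scalarInterp G.ε g v (lat q.1)) := fun q _ =>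
    flux_congr hε.ne' fun x hx => (scalarInterp_lat_neighbor hG g v hx).symm
  rw [Finset.sum_congr rfl h1,
    ← sum_flux_eq hG (fun p => (scalarInterp G.ε g v (lat p) : Space → ℝ))
    fun p i _ _ x hx => scalarInterp_lat_neighbor hG g v hx, sum_atomistic hG, Finset.mul_sum]
  exact Finset.sum_congr rfl fun p _ => sum_flux_affine hε p _

open Classical in
-- The centre of a face lies in every lattice tetrahedron that has the three vertices of the face.
-- Only the neighbour qualifies besides the tetrahedron itself, so `T'` is determined by the face.
theorem sum_interfaceFaces (f : Tet × Tet × Fin 4 → ℝ) :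
    ∑ q ∈ G.interfaceFaces η l, f q =
      ∑ q ∈ G.interfaceIdx with hull G.ε (lat q.1) ⊆ closure (G.B η l),
        f (lat q.1, lat (neighbor q.1 q.2).1, q.2) := by
  have hε := hG.ε_pos.ne'
  symm
  refine Finset.sum_nbij (fun q => (lat q.1, lat (neighbor q.1 q.2).1, q.2)) ?_ ?_ ?_
    fun _ _ => rfl
  · intro q hq
    rw [Finset.mem_filter, mem_interfaceIdx hG] at hq
    obtain ⟨⟨h1, h2⟩, h3⟩ := hq
    simp only [interfaceFaces, Finset.mem_filter, Finset.mem_product, Finset.mem_univ, and_true]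
    refine ⟨⟨h1, neighbor_mem_continuum hG h1 h2⟩, h3, fun j hj => ?_⟩
    obtain ⟨k, rfl⟩ := Fin.exists_succAbove_eq hj
    exact ⟨_, lat_neighbor q.1 q.2 k⟩
  · intro q _ q' _ h
    simp only [Prod.mk.injEq] at h
    exact Prod.ext (lat_injective h.1) h.2.2
  · rintro ⟨T, T', i⟩ hf
    simp only [interfaceFaces, Finset.coe_filter, Finset.mem_product, Finset.mem_univ, and_true,
      mem_ofPred_eq] at hf
    obtain ⟨⟨hT, hT'⟩, hB, hv⟩ := hf
    obtain ⟨p, -, rfl⟩ := mem_latticeTets.1 (hG.atomistic_subset hT)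
    rw [continuum, Finset.mem_sdiff] at hT'
    obtain ⟨q, -, rfl⟩ := mem_latticeTets.1 hT'.1
    have hx := facePoint_mem_openFace hε p i (q := (1 / 3, 1 / 3)) (by norm_num) (by norm_num)
      (by norm_num)
    have hxq : facePoint G.ε p i (1 / 3, 1 / 3) ∈ hull G.ε (lat q) := by
      have e : facePoint G.ε p i (1 / 3, 1 / 3) =
          ∑ k : Fin 3, (1 / 3 : ℝ) • pos G.ε (lat p (i.succAbove k)) := by
        simp only [facePoint, Fin.sum_univ_three]
        module
      rw [e]
      refine (convex_hull (lat q)).sum_mem (fun _ _ => by norm_num) (by simp) fun k _ => ?_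
      obtain ⟨j, hj⟩ := hv _ (Fin.succAbove_ne i k)
      rw [← hj]
      exact pos_mem_hull _ _
    rcases eq_or_eq_neighbor hε hx hxq with rfl | rfl
    · exact absurd hT hT'.2
    · refine ⟨(p, i), ?_, rfl⟩
      rw [Finset.mem_coe, Finset.mem_filter, mem_interfaceIdx hG]
      exact ⟨⟨hT, hT'.2⟩, hB⟩

omit hG in
theorem isTrace_trace (h : ∃ h, IsTrace G η 𝒯 g v l p h) :
    IsTrace G η 𝒯 g v l p (G.trace η 𝒯 g v l p) := by
  rw [trace, dif_pos h]
  exact h.choose_spec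

variable (hη : η ∈ R) (h0 : ∀ i, η i ≠ 0)

include hη h0

theorem mem_bondSites (hp : lat p ∈ G.atomistic) (hB : hull G.ε (lat p) ⊆ closure (G.B η l)) :
    l ∈ G.bondSites η := by
  classical
  exact Finset.mem_filter.2 ⟨mem_sites_of_closure_B_subset hG h0
    (closure_B_subset_domain hG hη hp hB), isAtomistic_or_isInterfacial hG hη hp hB⟩

open Classical in
-- Exchange of summations. The conditions in `bondSites` are automatic for a bond volume that
-- contains a lattice tetrahedron of `Ω_a`; this uses the distance of `Ω_a` from the boundary of
-- `Ω`.
theorem sum_bondSites {α : Type*} (s : Finset α) (π : α → Site × Equiv.Perm (Fin 3))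
    (hs : ∀ a ∈ s, lat (π a) ∈ G.atomistic) (f : Site → α → ℝ) :
    ∑ l ∈ G.bondSites η, ∑ a ∈ s with hull G.ε (lat (π a)) ⊆ closure (G.B η l), f l a =
      ∑ c ∈ bondClasses η, ∑ a ∈ s, f (cellBond η c (π a).1) a := by
  simp only [Finset.sum_filter]
  rw [Finset.sum_comm, Finset.sum_comm (s := bondClasses η)]
  refine Finset.sum_congr rfl fun a ha => ?_
  rw [← Finset.sum_filter]
  refine sum_inBox h0 (π a).1 _ (fun l => ?_) fun l => f l a
  rw [Finset.mem_filter, ← hull_subset_closure_B_iff hG h0 (p := π a), and_iff_right_iff_imp]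
  exact mem_bondSites hG hη h0 (hs a ha)

omit hη in
theorem hull_subset_cellBond (c : Site) (p : Site × Equiv.Perm (Fin 3)) :
    hull G.ε (lat p) ⊆ closure (G.B η (cellBond η c p.1)) :=
  (hull_subset_closure_B_iff hG h0).2 (inBox_cellBond h0 c p.1)

variable (hM : G.IsInterfaceMesh η 𝒯)

include hM

omit hη in
/-- Bond volumes which coincide or share a face are compatible. -/
theorem conforming_of_shift {l l' : Site} (hl : G.IsAtomistic η l ∨ G.IsInterfacial η l)
    (hl' : G.IsAtomistic η l' ∨ G.IsInterfacial η l') {k : Fin 3}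
    (h : l' = l ∨ l' = l + Pi.single k (η k) ∨ l = l' + Pi.single k (η k)) :
    ∀ S ∈ G.bondMesh η 𝒯 l, ∀ S' ∈ G.bondMesh η 𝒯 l', G.Conforming S S' := by
  intro S hS S' hS'
  rcases h with rfl | rfl | rfl
  · exact bondMesh_conforming hG h0 hM hl hS hS'
  · exact hM.compatible l k hl hl' S hS S' hS'
  · exact (hM.compatible l' k hl' hl S' hS' S hS).symm

omit hG hη hM in
theorem cellBond_neighbor (c : Site) (p : Site × Equiv.Perm (Fin 3)) (i : Fin 4) :
    ∃ k, cellBond η c (neighbor p i).1.1 = cellBond η c p.1 ∨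
      cellBond η c (neighbor p i).1.1 = cellBond η c p.1 + Pi.single k (η k) ∨
      cellBond η c p.1 = cellBond η c (neighbor p i).1.1 + Pi.single k (η k) := by
  fin_cases i
  · exact ⟨p.2 0, cellBond_add_single h0 c p.1 (p.2 0)⟩
  · exact ⟨0, Or.inl rfl⟩
  · exact ⟨0, Or.inl rfl⟩
  · refine ⟨p.2 2, ?_⟩
    have h := cellBond_add_single h0 c (p.1 - Pi.single (p.2 2) 1) (p.2 2)
    rw [sub_add_cancel] at h
    rcases h with h | h | h
    · exact Or.inl h.symm
    · exact Or.inr (Or.inr h)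
    · exact Or.inr (Or.inl h)

/-- Within one class the bond volumes of neighbouring tetrahedra are equal or share a face, which is
where the compatibility of meshes enters. -/
theorem trace_neighbor (c : Site) {i : Fin 4} (hp : lat p ∈ G.atomistic)
    (hp' : lat (neighbor p i).1 ∈ G.atomistic) {x : Space} (hx : x ∈ openFace G.ε p i) :
    G.trace η 𝒯 g v (cellBond η c p.1) p x =
      G.trace η 𝒯 g v (cellBond η c (neighbor p i).1.1) (neighbor p i).1 x := by
  have hB := hull_subset_cellBond hG h0 c p
  have hB' := hull_subset_cellBond hG h0 c (neighbor p i).1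
  have hl := isAtomistic_or_isInterfacial hG hη hp hB
  have hl' := isAtomistic_or_isInterfacial hG hη hp' hB'
  obtain ⟨k, hk⟩ := cellBond_neighbor (η := η) h0 c p i
  exact (isTrace_trace (exists_isTrace hG h0 hM hl hp hB)).eq_neighbor hG h0 hM hl hl'
    (isTrace_trace (exists_isTrace hG h0 hM hl' hp' hB')) hp hp' hB hB'
    (conforming_of_shift hG h0 hM hl hl' hk) hx

omit hη in
open Classical in
-- On interface faces the jump exchanges the flux of the trace for that of the interpolant from
-- `Ω_*`.
theorem bulkSum_sub_jumpSum (hl : G.IsAtomistic η l ∨ G.IsInterfacial η l) :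
    G.bulkSum η 𝒯 g v l - G.jumpSum η 𝒯 g v l =
      ∑ p ∈ G.atomisticIdx with hull G.ε (lat p) ⊆ closure (G.B η l),
        ∑ i, flux G.ε η p i (G.trace η 𝒯 g v l p) -
      ∑ q ∈ G.interfaceIdx with hull G.ε (lat q.1) ⊆ closure (G.B η l),
        (flux G.ε η q.1 q.2 (G.trace η 𝒯 g v l q.1) -
          flux G.ε η q.1 q.2 (scalarInterp G.ε g v (lat (neighbor q.1 q.2).1))) := by
  have ht : ∀ p, lat p ∈ G.atomistic → hull G.ε (lat p) ⊆ closure (G.B η l) →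
      IsTrace G η 𝒯 g v l p (G.trace η 𝒯 g v l p) := fun p hp hB =>
    isTrace_trace (exists_isTrace hG h0 hM hl hp hB)
  rw [bulkSum_eq hG h0 hM hl _ ht, jumpSum, sum_interfaceFaces hG]
  congr 1
  refine Finset.sum_congr rfl fun q hq => ?_
  rw [Finset.mem_filter, mem_interfaceIdx hG] at hq
  exact (ht q.1 hq.1.1 hq.2).sum_surfaceIntegral hG h0 hM hl hq.1.1 hq.2
    (neighbor_mem_continuum hG hq.1.1 hq.1.2) _

/-- The contributions of all bond volumes add up to those of the lattice tetrahedra. -/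
theorem sum_bulkSum_sub_jumpSum :
    ∑ l ∈ G.bondSites η, (G.bulkSum η 𝒯 g v l - G.jumpSum η 𝒯 g v l) =
      |(η 0 * η 1 * η 2 : ℝ)| *
        (G.ε ^ 3 / 6 * ∑ T ∈ G.atomistic, (scalarInterp G.ε g v T).linear (pos 1 η)) := by
  classical
  have hl : ∀ l ∈ G.bondSites η, G.IsAtomistic η l ∨ G.IsInterfacial η l := fun l hl =>
    (Finset.mem_filter.1 hl).2
  have h1 := sum_bondSites hG hη h0 _ id (fun p hp => (mem_atomisticIdx hG).1 hp) fun l p =>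
    ∑ i, flux G.ε η p i (G.trace η 𝒯 g v l p)
  simp only [id] at h1
  rw [Finset.sum_congr rfl fun l h => bulkSum_sub_jumpSum hG h0 hM (hl l h),
    Finset.sum_sub_distrib, h1,
    sum_bondSites hG hη h0 _ Prod.fst (fun q hq => ((mem_interfaceIdx hG).1 hq).1) fun l q =>
      flux G.ε η q.1 q.2 (G.trace η 𝒯 g v l q.1) -
          flux G.ε η q.1 q.2 (scalarInterp G.ε g v (lat (neighbor q.1 q.2).1)),
    ← Finset.sum_sub_distrib, ← card_bondClasses, ← nsmul_eq_mul, ← Finset.sum_const]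
  refine Finset.sum_congr rfl fun c _ => ?_
  -- The contribution of a class is now independent of `c`, provided that the fluxes of the traces
  -- through all faces reduce to those through interface faces.
  rw [Finset.sum_sub_distrib, sum_interface_flux hG, sub_sub_eq_add_sub, add_sub_assoc,
    add_comm, sub_add_eq_add_sub, sub_eq_iff_eq_add, add_right_inj]
  exact sum_flux_eq hG (fun p => G.trace η 𝒯 g v (cellBond η c p.1) p)
    fun p i hp hp' x hx => trace_neighbor hG hη h0 hM c hp hp' hx

omit h0 hη hM in
/-- Bond volumes of atomistic type contain no interface faces. -/
theorem jumpSum_of_isAtomistic (h : G.IsAtomistic η l) : G.jumpSum η 𝒯 g v l = 0 := by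
  classical
  have hε := hG.ε_pos.ne'
  rw [jumpSum, sum_interfaceFaces hG]
  refine Finset.sum_eq_zero fun q hq => ?_
  exfalso
  rw [Finset.mem_filter, mem_interfaceIdx hG] at hq
  obtain ⟨⟨h1, h2⟩, h3⟩ := hq
  obtain ⟨x, hx⟩ := openFace_nonempty hε q.1 q.2
  refine Set.disjoint_left.1 (disjoint_Ωa hG) (h (h3 (openFace_subset_hull hε _ _ hx)))
    (hull_subset_union (neighbor_mem_continuum hG h1 h2) ?_)
  exact openFace_subset_hull hε _ _ (openFace_neighbor q.1 q.2 hx)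

end Geometry
end BondVolume

namespace BondVolume
open MeasureTheory Set Filter Topology
open scoped NNReal

namespace Geometry

variable {G : Geometry} {R : Finset Site} {η : Site} {𝒯 : Site → Finset Tet}
  {g : Space →L[ℝ] ℝ} {v : Site → Space}

/-! ### Periodicity -/

theorem IsPeriodicZeroMean.eq_of_add (hv : G.IsPeriodicZeroMean v) (l n : Site) :
    v (fun i => l i + n i * ((2 * (G.M i : ℤ) - 1) * (G.k : ℤ))) = v l := by
  have h (i : Fin 3) : Function.Periodic v (Pi.single i ((2 * (G.M i : ℤ) - 1) * (G.k : ℤ))) :=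
    hv.periodic i
  have e : (fun i => l i + n i * ((2 * (G.M i : ℤ) - 1) * (G.k : ℤ))) =
      l + n 0 • Pi.single 0 ((2 * (G.M 0 : ℤ) - 1) * (G.k : ℤ)) +
      n 1 • Pi.single 1 ((2 * (G.M 1 : ℤ) - 1) * (G.k : ℤ)) +
      n 2 • Pi.single 2 ((2 * (G.M 2 : ℤ) - 1) * (G.k : ℤ)) := by
    funext i
    fin_cases i <;> simp
  rw [e, (h 2).zsmul, (h 1).zsmul, (h 0).zsmul]

/-- Translation followed by reduction modulo the period permutes the representatives. -/
theorem IsPeriodicZeroMean.sum_add (hG : G.IsAdmissible R) (hv : G.IsPeriodicZeroMean v)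
    (s : Site) : ∑ m ∈ G.periodSites, v (m + s) = ∑ m ∈ G.periodSites, v m := by
  let L (i : Fin 3) : ℤ := (2 * (G.M i : ℤ) - 1) * (G.k : ℤ)
  let a (i : Fin 3) : ℤ := (-(G.M i : ℤ) + 1) * (G.k : ℤ)
  have hL (i : Fin 3) : 0 < L i := by
    have h1 : (0 : ℤ) < G.M i := by exact_mod_cast hG.M_pos i
    have h2 : (0 : ℤ) < G.k := by exact_mod_cast hG.k_pos
    exact mul_pos (by omega) h2
  have hmem (m : Site) : m ∈ G.periodSites ↔ ∀ i, a i ≤ m i ∧ m i < a i + L i := by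
    rw [periodSites, Fintype.mem_piFinset]
    refine forall_congr' fun i => ?_
    rw [Finset.mem_Ico, show a i + L i = (G.M i : ℤ) * G.k by simp only [a, L]; ring]
  let r (m : Site) : Site := fun i => a i + (m i - a i) % L i
  have hr (m : Site) : r m ∈ G.periodSites := (hmem _).2 fun i =>
    ⟨by have := Int.emod_nonneg (m i - a i) (hL i).ne'; simp only [r]; omega,
      by have := Int.emod_lt_of_pos (m i - a i) (hL i); simp only [r]; omega⟩
  have hrr (m s : Site) (hm : m ∈ G.periodSites) : r (r (m + s) - s) = m := by
    funext i
    obtain ⟨h1, h2⟩ := (hmem m).1 hm i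
    simp only [r, Pi.add_apply, Pi.sub_apply]
    rw [show a i + (m i + s i - a i) % L i - s i - a i = (m i + s i - a i) % L i - s i by ring,
      Int.emod_sub_emod, show m i + s i - a i - s i = m i - a i by ring,
      Int.emod_eq_of_lt (by omega) (by omega)]
    ring
  have hv' (m : Site) : v (r m) = v m := by
    rw [← hv.eq_of_add (r m) fun i => (m i - a i) / L i]
    congr 1
    funext i
    have := Int.emod_add_mul_ediv (m i - a i) (L i)
    simp only [r]
    linarith
  refine Finset.sum_nbij' (fun m => r (m + s)) (fun m => r (m - s)) (fun m _ => hr _)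
    (fun m _ => hr _) (fun m hm => hrr m s hm) (fun m hm => ?_) fun m _ => (hv' _).symm
  simpa [sub_eq_add_neg] using hrr m (-s) hm

/-- For fixed `σ`, the derivative on the tetrahedron of cell `m` is a combination of four translates
of `g ∘ v` at `m`, with coefficients independent of `m`. Each translate sums to zero over a period.
-/
theorem sum_latticeTets (hG : G.IsAdmissible R) (hv : G.IsPeriodicZeroMean v) :
    ∑ T ∈ G.latticeTets, (scalarInterp G.ε g v T).linear (pos 1 η) = 0 := by
  have hε := hG.ε_pos.ne'
  have h1 : ∑ T ∈ G.latticeTets, (scalarInterp G.ε g v T).linear (pos 1 η) =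
      ∑ p ∈ G.periodSites ×ˢ (Finset.univ : Finset (Equiv.Perm (Fin 3))),
        (scalarInterp G.ε g v (lat p)).linear (pos 1 η) := by
    refine (Finset.sum_nbij lat ?_ lat_injective.injOn ?_ fun _ _ => rfl).symm
    · exact fun p hp => lat_mem_latticeTets.2 (Finset.mem_product.1 hp).1
    · intro T hT
      obtain ⟨p, hp, rfl⟩ := mem_latticeTets.1 hT
      exact ⟨p, Finset.mem_product.2 ⟨hp, Finset.mem_univ _⟩, rfl⟩
  have h2 (p : Site × Equiv.Perm (Fin 3)) : (scalarInterp G.ε g v (lat p)).linear (pos 1 η) =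
      ∑ j, dirCoef G.ε η p.2 j * g (v (lat p j)) := by
    rw [← sum_dirCoef_smul hε p, map_sum]
    have h3 (j : Fin 4) : g (v (lat p j)) = (scalarInterp G.ε g v (lat p)).linear
        (pos G.ε (lat p j)) + scalarInterp G.ε g v (lat p) 0 := by
      rw [← interp_apply (affineIndependent_lat hε p) v j, ← scalarInterp_apply]
      exact congrFun (scalarInterp G.ε g v (lat p)).decomp _
    simp only [h3, mul_add, Finset.sum_add_distrib, ← Finset.sum_mul, sum_dirCoef, zero_mul,
      add_zero, map_smul, smul_eq_mul]
  rw [h1, Finset.sum_product_right]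
  refine Finset.sum_eq_zero fun σ _ => ?_
  simp only [h2]
  rw [Finset.sum_comm]
  refine Finset.sum_eq_zero fun j _ => ?_
  have h4 : ∑ m ∈ G.periodSites, v (lat (m, σ) j) = 0 := by
    rw [← hv.zero_mean, ← hv.sum_add hG fun c => if (σ.symm c).val < j.val then 1 else 0]
    rfl
  rw [← Finset.mul_sum, ← map_sum, h4, map_zero, mul_zero]

open Classical in
/-- The derivatives of the parts of the energy which belong to one interaction vector cancel. -/
theorem sum_derivatives_eq_zero (hG : G.IsAdmissible R) (hη : η ∈ R) (h0 : ∀ i, η i ≠ 0)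
    (hM : G.IsInterfaceMesh η 𝒯) (hv : G.IsPeriodicZeroMean v) :
    G.ε ^ 3 * ∑ l ∈ G.sites with G.IsAtomistic η l, g (diffQuot G.ε η v l) +
      G.ε ^ 3 / 6 * ∑ T ∈ G.continuum, (scalarInterp G.ε g v T).linear (pos 1 η) +
      ∑ l ∈ G.sites with G.IsInterfacial η l, 1 / |(η 0 * η 1 * η 2 : ℝ)| *
        (G.bulkSum η 𝒯 g v l - G.jumpSum η 𝒯 g v l) = 0 := by
  have hN : |(η 0 * η 1 * η 2 : ℝ)| ≠ 0 := by simp [h0]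
  have h1 := sum_bulkSum_sub_jumpSum (g := g) (v := v) hG hη h0 hM
  rw [show G.bondSites η = G.sites.filter (fun l => G.IsAtomistic η l ∨ G.IsInterfacial η l)
    from Finset.filter_congr_decidable .., Finset.filter_or, Finset.sum_union] at h1
  · have h2 : ∀ l ∈ G.sites.filter (fun l => G.IsAtomistic η l),
        G.bulkSum η 𝒯 g v l - G.jumpSum η 𝒯 g v l =
        |(η 0 * η 1 * η 2 : ℝ)| * (G.ε ^ 3 * g (diffQuot G.ε η v l)) := by
      intro l hl
      have hl := (Finset.mem_filter.1 hl).2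
      rw [bulkSum_of_isAtomistic hG h0 hM hl, jumpSum_of_isAtomistic hG hl, sub_zero]
    rw [Finset.sum_congr rfl h2, ← Finset.mul_sum, ← Finset.mul_sum] at h1
    have h3 := sum_latticeTets (η := η) (g := g) hG hv
    rw [← Finset.sum_sdiff hG.atomistic_subset] at h3
    rw [← Finset.mul_sum]
    change G.ε ^ 3 * _ + G.ε ^ 3 / 6 * ∑ T ∈ G.latticeTets \ G.atomistic, _ + _ = 0
    field_simp
    -- `h1` trades the bond volumes for the lattice tetrahedra of `Ω_a`, and `h3` says that these
    -- and the tetrahedra of `Ω_*` cancel.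
    linear_combination 6 * h1 + |(η 0 * η 1 * η 2 : ℝ)| * G.ε ^ 3 * h3
  · rw [Finset.disjoint_filter]
    exact fun l _ h1 h2 => not_isAtomistic_of_isInterfacial hG h2 h1

end Geometry
end BondVolume

namespace BondVolume
open MeasureTheory Set Filter Topology
open scoped NNReal

/-! ### The derivative of the energy -/

/-- Pulls the functional out of the integral. The parameter `t` then enters only through the
functional, and nothing has to be differentiated under the integral. -/
theorem surfaceIntegral_indicator_comp (a b c : Space) {s : Set Space} (hs : MeasurableSet s)
    {W : Space → Space} (hW : Continuous W) (L : Space →L[ℝ] ℝ) :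
    surfaceIntegral a b c (s.indicator fun x => L (W x)) =
      L (‖areaVector a b c‖ •
        ∫ q in triangle, s.indicator W (a + q.1 • (b - a) + q.2 • (c - a))) := by
  have hγ : Continuous fun q : ℝ × ℝ => a + q.1 • (b - a) + q.2 • (c - a) := by fun_prop
  have hi : IntegrableOn (fun q : ℝ × ℝ => s.indicator W (a + q.1 • (b - a) + q.2 • (c - a)))
      triangle := by
    have h1 : IntegrableOn (fun q : ℝ × ℝ => W (a + q.1 • (b - a) + q.2 • (c - a))) triangle :=
      (hW.comp hγ).continuousOn.integrableOn_compact isCompact_triangle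
    exact Integrable.indicator h1 (hγ.measurable hs)
  rw [map_smul, smul_eq_mul, ← L.integral_comp_comm hi, surfaceIntegral_eq, triangleIntegral]
  congr 1
  refine integral_congr_ae (ae_of_all _ fun q => ?_)
  by_cases h : a + q.1 • (b - a) + q.2 • (c - a) ∈ s <;> simp [h]

theorem hasDerivAt_comp_line {f : Space → ℝ} (hf : ContDiff ℝ 1 f) (a c : Space) :
    HasDerivAt (fun t : ℝ => f (a + t • c)) (fderiv ℝ f a c) 0 := by
  have h1 : HasDerivAt (fun t : ℝ => a + t • c) c 0 := by
    simpa using ((hasDerivAt_id (0 : ℝ)).smul_const c).const_add a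
  have h2 : HasFDerivAt f (fderiv ℝ f (a + (0 : ℝ) • c)) (a + (0 : ℝ) • c) :=
    (hf.differentiable one_ne_zero _).hasFDerivAt
  have h3 := h2.comp_hasDerivAt (0 : ℝ) h1
  rw [zero_smul, add_zero] at h3
  exact h3

/-- As the second argument vanishes at `t = 0`, the difference quotient is `fderiv ℝ f (a + t • c)
V`. Continuity of the derivative suffices, so no second derivative of `f` is required. -/
theorem hasDerivAt_fderiv_smul {f : Space → ℝ} (hf : ContDiff ℝ 1 f) (a c V : Space) :
    HasDerivAt (fun t : ℝ => fderiv ℝ f (a + t • c) (t • V)) (fderiv ℝ f a V) 0 := by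
  have hc : Continuous fun t : ℝ => fderiv ℝ f (a + t • c) V :=
    ((hf.continuous_fderiv one_ne_zero).comp (by fun_prop)).clm_apply continuous_const
  rw [hasDerivAt_iff_tendsto_slope_zero]
  have h1 : Tendsto (fun t : ℝ => fderiv ℝ f (a + t • c) V) (𝓝[≠] 0) (𝓝 (fderiv ℝ f a V)) := by
    simpa using (hc.tendsto 0).mono_left nhdsWithin_le_nhds
  refine h1.congr' ?_
  filter_upwards [self_mem_nhdsWithin] with t ht
  have ht : t ≠ 0 := ht
  simp [ht]

theorem interp_add_smul {ε : ℝ} {T : Tet} (h : AffineIndependent ℝ (fun j => pos ε (T j)))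
    (A : Space →ₗ[ℝ] Space) {u : Site → Space} (hu : ∀ l, u l = A (pos ε l)) (t : ℝ)
    (v : Site → Space) : interp ε T (u + t • v) = A.toAffineMap + t • interp ε T v :=
  interp_eq h fun j => by simp [interp_apply h, hu]

namespace Geometry

variable {G : Geometry} {R : Finset Site} {η : Site} {𝒯 : Site → Finset Tet}
  {φ : Site → Space → ℝ} {F : Matrix (Fin 3) (Fin 3) ℝ}

theorem diffQuot_homogeneous_add (hG : G.IsAdmissible R) (F : Matrix (Fin 3) (Fin 3) ℝ) (t : ℝ)
    (v : Site → Space) (l : Site) : diffQuot G.ε η (G.homogeneous F + t • v) l =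
      Matrix.toEuclideanLin F (pos 1 η) + t • diffQuot G.ε η v l := by
  have hε := hG.ε_pos.ne'
  have hp := pos_one_eq hG.ε_pos.ne' η l
  rw [hp, map_smul, map_sub]
  simp only [diffQuot, homogeneous, Pi.add_apply, Pi.smul_apply]
  module

theorem hasDerivAt_energyAtomistic (hG : G.IsAdmissible R) (hφ : ContDiff ℝ 1 (φ η))
    (v : Site → Space) : HasDerivAt
      (fun t : ℝ => G.energyAtomistic φ η (G.homogeneous F + t • v))
      (open Classical in G.ε ^ 3 * ∑ l ∈ G.sites with G.IsAtomistic η l,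
        fderiv ℝ (φ η) (Matrix.toEuclideanLin F (pos 1 η)) (diffQuot G.ε η v l)) 0 := by
  simp only [energyAtomistic, diffQuot_homogeneous_add hG]
  exact (HasDerivAt.fun_sum fun l _ => hasDerivAt_comp_line hφ _ _).const_mul _

theorem hasDerivAt_interp (hφ : ContDiff ℝ 1 (φ η)) {T : Tet}
    (hT : AffineIndependent ℝ (fun j => pos G.ε (T j))) (v : Site → Space) : HasDerivAt
      (fun t : ℝ => φ η ((interp G.ε T (G.homogeneous F + t • v)).linear (pos 1 η)))
      ((scalarInterp G.ε (fderiv ℝ (φ η) (Matrix.toEuclideanLin F (pos 1 η))) v T).linear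
        (pos 1 η)) 0 := by
  simp only [interp_add_smul hT (Matrix.toEuclideanLin F) (u := G.homogeneous F) (fun _ => rfl)]
  exact hasDerivAt_comp_line hφ _ _

theorem latticeTets_nondegenerate (hG : G.IsAdmissible R) {T : Tet} (hT : T ∈ G.latticeTets) :
    AffineIndependent ℝ (fun j => pos G.ε (T j)) := by
  obtain ⟨p, -, rfl⟩ := mem_latticeTets.1 hT
  exact affineIndependent_lat hG.ε_pos.ne' p

theorem hasDerivAt_energyContinuum (hG : G.IsAdmissible R) (hφ : ContDiff ℝ 1 (φ η))
    (v : Site → Space) : HasDerivAt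
      (fun t : ℝ => G.energyContinuum φ η (G.homogeneous F + t • v))
      (G.ε ^ 3 / 6 * ∑ T ∈ G.continuum,
        (scalarInterp G.ε (fderiv ℝ (φ η) (Matrix.toEuclideanLin F (pos 1 η))) v T).linear
          (pos 1 η)) 0 := by
  simp only [energyContinuum]
  exact (HasDerivAt.fun_sum fun T hT => hasDerivAt_interp hφ (latticeTets_nondegenerate hG
    (Finset.mem_sdiff.1 hT).1) v).const_mul _

theorem hasDerivAt_bulkTerm (hG : G.IsAdmissible R) (hM : G.IsInterfaceMesh η 𝒯)
    (hφ : ContDiff ℝ 1 (φ η)) {l : Site} (hl : G.IsInterfacial η l) (v : Site → Space) :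
    HasDerivAt (fun t : ℝ => G.bulkTerm φ η 𝒯 (G.homogeneous F + t • v) l)
      (G.bulkSum η 𝒯 (fderiv ℝ (φ η) (Matrix.toEuclideanLin F (pos 1 η))) v l) 0 := by
  simp only [bulkTerm, bulkSum, setIntegral_const, bondMesh_of_isInterfacial hG hl]
  exact HasDerivAt.fun_sum fun S hS => (hasDerivAt_interp hφ (hM.nondegenerate l hl S
    (mem_atomisticElements.1 hS).1) v).const_mul _

theorem hasDerivAt_surfaceIntegral_jumpDensity (hφ : ContDiff ℝ 1 (φ η)) {S T : Tet}
    (hS : AffineIndependent ℝ (fun j => pos G.ε (S j)))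
    (hT : AffineIndependent ℝ (fun j => pos G.ε (T j))) (v : Site → Space) (a b c ν : Space) :
    HasDerivAt (fun t : ℝ => surfaceIntegral a b c ((hull G.ε S).indicator
        (G.jumpDensity φ η (G.homogeneous F + t • v) S T ν)))
      (surfaceIntegral a b c ((hull G.ε S).indicator fun x => inner ℝ ν (pos 1 η) *
        (scalarInterp G.ε (fderiv ℝ (φ η) (Matrix.toEuclideanLin F (pos 1 η))) v S x -
          scalarInterp G.ε (fderiv ℝ (φ η) (Matrix.toEuclideanLin F (pos 1 η))) v T x))) 0 := by
  set W : Space → Space := fun x =>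
    inner ℝ ν (pos 1 η) • (interp G.ε S v x - interp G.ε T v x) with hWdef
  have hW : Continuous W := by
    have h1 := (interp G.ε S v).continuous_of_finiteDimensional
    have h2 := (interp G.ε T v).continuous_of_finiteDimensional
    fun_prop
  set d : Space := (1 / 2 : ℝ) •
    ((interp G.ε S v).linear (pos 1 η) + (interp G.ε T v).linear (pos 1 η)) with hd
  -- In the average the two copies of `F η` combine to one. In the jump the two copies of `F x`
  -- carry opposite normals and cancel, which leaves the factor `t`.
  have hj (t : ℝ) : G.jumpDensity φ η (G.homogeneous F + t • v) S T ν = fun x =>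
      (t • fderiv ℝ (φ η) (Matrix.toEuclideanLin F (pos 1 η) + t • d)) (W x) := by
    funext x
    rw [jumpDensity,
      interp_add_smul hS (Matrix.toEuclideanLin F) (u := G.homogeneous F) (fun _ => rfl),
      interp_add_smul hT (Matrix.toEuclideanLin F) (u := G.homogeneous F) (fun _ => rfl),
      _root_.smul_apply, ← map_smul (fderiv ℝ (φ η) _)]
    congr 2
    · simp only [hd, AffineMap.add_linear, AffineMap.smul_linear, LinearMap.toAffineMap_linear,
        LinearMap.add_apply, LinearMap.smul_apply]
      module
    · simp only [hWdef, inner_neg_left, AffineMap.coe_add, AffineMap.coe_smul,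
        LinearMap.coe_toAffineMap, Pi.add_apply, Pi.smul_apply]
      module
  simp only [hj, surfaceIntegral_indicator_comp a b c (measurableSet_hull S) hW]
  have e : (fun x => inner ℝ ν (pos 1 η) *
      (scalarInterp G.ε (fderiv ℝ (φ η) (Matrix.toEuclideanLin F (pos 1 η))) v S x -
        scalarInterp G.ε (fderiv ℝ (φ η) (Matrix.toEuclideanLin F (pos 1 η))) v T x)) =
      fun x => fderiv ℝ (φ η) (Matrix.toEuclideanLin F (pos 1 η)) (W x) := by
    funext x
    simp [scalarInterp_apply, hWdef]
  rw [e, surfaceIntegral_indicator_comp a b c (measurableSet_hull S) hW]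
  simp only [_root_.smul_apply, ← map_smul]
  exact hasDerivAt_fderiv_smul hφ _ d _

theorem hasDerivAt_jumpTerm (hG : G.IsAdmissible R) (hM : G.IsInterfaceMesh η 𝒯)
    (hφ : ContDiff ℝ 1 (φ η)) {l : Site} (hl : G.IsInterfacial η l) (v : Site → Space) :
    HasDerivAt (fun t : ℝ => G.jumpTerm φ η 𝒯 (G.homogeneous F + t • v) l)
      (G.jumpSum η 𝒯 (fderiv ℝ (φ η) (Matrix.toEuclideanLin F (pos 1 η))) v l) 0 := by
  simp only [jumpTerm, jumpSum, bondMesh_of_isInterfacial hG hl]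
  refine HasDerivAt.fun_sum fun f hf => HasDerivAt.fun_sum fun S hS => ?_
  classical
  refine hasDerivAt_surfaceIntegral_jumpDensity hφ
    (hM.nondegenerate l hl S (mem_atomisticElements.1 hS).1) (latticeTets_nondegenerate hG ?_) ..
  exact (Finset.mem_sdiff.1 (Finset.mem_product.1 (Finset.mem_product.1
    (Finset.mem_filter.1 hf).1).2).1).1

theorem hasDerivAt_energyInterface (hG : G.IsAdmissible R) (hM : G.IsInterfaceMesh η 𝒯)
    (hφ : ContDiff ℝ 1 (φ η)) (v : Site → Space) : HasDerivAt
      (fun t : ℝ => G.energyInterface φ η 𝒯 (G.homogeneous F + t • v))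
      (open Classical in ∑ l ∈ G.sites with G.IsInterfacial η l, 1 / |(η 0 * η 1 * η 2 : ℝ)| *
        (G.bulkSum η 𝒯 (fderiv ℝ (φ η) (Matrix.toEuclideanLin F (pos 1 η))) v l -
          G.jumpSum η 𝒯 (fderiv ℝ (φ η) (Matrix.toEuclideanLin F (pos 1 η))) v l)) 0 := by
  simp only [energyInterface]
  refine HasDerivAt.fun_sum fun l hl => ?_
  classical
  have hl : G.IsInterfacial η l := (Finset.mem_filter.1 hl).2
  exact ((hasDerivAt_bulkTerm hG hM hφ hl v).sub (hasDerivAt_jumpTerm hG hM hφ hl v)).const_mul _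

end Geometry
end BondVolume

/-! ### Absence of ghost forces -/

theorem proposition5p1
    (R : Finset BondVolume.Site) (hR : ∀ η ∈ R, ∀ i, η i ≠ 0)
    (φ : BondVolume.Site → BondVolume.Space → ℝ) (hφ : ∀ η ∈ R, ContDiff ℝ 1 (φ η))
    (G : BondVolume.Geometry) (hG : G.IsAdmissible R)
    (𝒯 : BondVolume.Site → BondVolume.Site → Finset BondVolume.Tet)
    (h𝒯 : ∀ η ∈ R, G.IsInterfaceMesh η (𝒯 η))
    (F : Matrix (Fin 3) (Fin 3) ℝ) (hF : 0 < F.det)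
    (v : BondVolume.Site → BondVolume.Space) (hv : G.IsPeriodicZeroMean v) :
    HasDerivAt (fun t : ℝ => G.energy R φ 𝒯 (G.homogeneous F + t • v)) 0 0 := by
  simp only [BondVolume.Geometry.energy]
  -- The derivative vanishes for each interaction vector separately.
  rw [show (0 : ℝ) = ∑ η ∈ R, 0 from Finset.sum_const_zero.symm]
  refine HasDerivAt.fun_sum fun η hη => ?_
  rw [Finset.sum_const_zero]
  have h := ((BondVolume.Geometry.hasDerivAt_energyAtomistic (F := F) hG (hφ η hη) v).add
    (BondVolume.Geometry.hasDerivAt_energyContinuum (F := F) hG (hφ η hη) v)).add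
    (BondVolume.Geometry.hasDerivAt_energyInterface (F := F) hG (h𝒯 η hη) (hφ η hη) v)
  rw [BondVolume.Geometry.sum_derivatives_eq_zero hG hη (hR η hη) (h𝒯 η hη) hv] at h
  exact h
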